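/- **Setting.** Let $m>0$ and $r_0=2m$. Consider the Schwarzschild spacetime of mass $m$ in double null coordinates $(s,\underline s,\vartheta)$, $\vartheta\in\mathbb S^2$, $$g=2\Omega^2(ds\otimes d\underline s+d\underline s\otimes ds)+r^2\mathring g,\qquad (r-r_0)e^{r/r_0}=s\,e^{(\underline s+s+r_0)/r_0},\qquad \Omega^2=\tfrac{s+r_0}{r}e^{(\underline s+s+r_0-r)/r_0},$$ where $\mathring g$ is the unit round metric. Let $\Sigma_{s,\underline s}$ be the spheres of constant $s,\underline s$. The event horizon is $s=0$, and on the null hypersurface $\underline s=0$ one has $r=r_0+s$. *Foliations.* Let $\mathcal H=\{\underline s=h(s,\vartheta)\}$ be an incoming null hypersurface foliated by spheres $\Sigma_u=\{s=f_u(\vartheta)\}$, $u\ge0$. Let $\underline L$ be the null normal of $\mathcal H$ with $\underline Lu=1$, and $L'$ the other null normal of $\Sigma_u$ with $g(L',\underline L)=2$. Let $\chi'$, $\underline\chi$ be the second fundamental forms of $\Sigma_u$ relative to $L'$, $\underline L$ (with trace-free parts $\hat\chi'$, $\hat{\underline\chi}$), $\eta(X)=\frac12g(\nabla_X\underline L,L')$,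 $K$ the Gauss curvature, $\rho=\frac14R(L',\underline L,\underline L,L')$, and $r_u$ the area radius of $\Sigma_u$. The foliation is a *constant mass aspect function foliation* if $\mu=K-\frac14\mathrm{tr}\chi'\,\mathrm{tr}\underline\chi-\mathrm{div}\,\eta$ is constant on every $\Sigma_u$ and $r_u=r_{u=0}+u$. The foliation $\{\Sigma_{u,\underline s=0}\}_{u\ge0}$ is one. *Linearisation.* A linearised perturbation of this foliation, with linearised perturbation $(\delta f,\delta\underline f)$ of the initial leaf $\Sigma_{0,0}$, is a pair of smooth functions $\delta h(s,\vartheta)$, $\delta f_u(\vartheta)$ with $\delta h|_{s=0}=\delta\underline f$, $\delta f_{u=0}=\delta f$, such that along the family $h=\varepsilon\,\delta h$, $f_u=u+\varepsilon\,\delta f_u$ the following hold to first order at $\varepsilon=0$, for $s,u\ge0$: the hypersurface is null, $\mu$ is constant on each leaf, and $r_u=r_{u=0}+u$. The linearised perturbation $\delta q$ of a limit $q=\lim_{u\to\infty}Q_u$ is $\lim_{u\to\infty}\partial_\varepsilon|_{\varepsilon=0}Q_u$. *Quantities at null infinity.* Let $g_\infty=\lim r_u^{-2}g_{\Sigma_u}$,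 $K_\infty=\lim r_u^2K$, $P=\lim r_u^3\rho$, $\Sigma=\lim\hat{\underline\chi}$, $\Xi=\lim r_u^{-1}\hat\chi'$ and $N=-P-\frac12(\Sigma,\Xi)$. The Bondi energy is the limit of the Hawking masses $\frac{r_u}{2}\bigl(1-\frac1{16\pi}\int_{\Sigma_u}\mathrm{tr}\chi'\,\mathrm{tr}\underline\chi\bigr)$, $E=\frac1{8\pi}\int N\,d\mathrm{vol}_{g_\infty}$. The linear momentum is $P^i=\frac1{8\pi}\int Y^iN\,d\mathrm{vol}_{g_\infty}$, and the Bondi mass is $m_B=\sqrt{E^2-\sum_i(P^i)^2}$. Here, for the background, $Y^1,Y^2,Y^3$ are the Cartesian coordinate functions of the unit sphere in an orthonormal basis of $\mathbb R^3$. A linearised perturbation $\delta Y^i$ of them is *admissible* if it is smooth and, to first order, $\Delta_{g_\infty}Y^i=-2Y^i$ and $\int Y^iY^j\,d\mathrm{vol}_{g_\infty}=\frac{4\pi}3\delta^{ij}$ are preserved. Let $V$ be the 4-dimensional space of linearised perturbations $\delta f=0$, $\delta\underline f\in\mathrm{span}\{1,Y^1,Y^2,Y^3\}$ of $\Sigma_{0,0}$.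 **Theorem 12.1.** Let $\delta f=0$ and $\delta\underline f=c_0+r_0(c_1Y^1+c_2Y^2+c_3Y^3)$ with $c_0,c_1,c_2,c_3\in\mathbb R$. A linearised perturbation of the constant mass aspect function foliation with this initial data exists, and it is unique for $s,u\ge0$. It remains asymptotically round: $K_\infty=1$ for the background and $\delta K_\infty=0$. The asymptotic quantities above and their linearised perturbations exist, and so do admissible $\delta Y^i$. The linearised Bondi energy is $\delta E=0$ (both as the linearised limit of the Hawking mass and as the linearisation of $\frac1{8\pi}\int N$). For every admissible $\delta Y^i$, $$\delta P^i=c_i\Bigl(\frac{e^{3/2}}3-\frac43\Bigr)r_0\quad(i=1,2,3),\qquad \delta m_B=0 .$$ Hence the map from $V$ to the linearised linear momenta, $\delta\underline f\mapsto(\delta P^1,\delta P^2,\delta P^3)\in\mathbb R^3$, is well defined, linear and surjective, and its kernel consists exactly of the constant functions $\delta\underline f=c_0$. -/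

import Mathlib

open Real Set Filter Topology MeasureTheory
open scoped Manifold ContDiff

noncomputable section

namespace CMAFoliation

/-! ### The unit sphere and its spherical coordinates -/

abbrev E3 : Type := EuclideanSpace ℝ (Fin 3)

/-- The unit sphere of Euclidean 3-space, with its smooth structure from Mathlib. -/
abbrev S2 : Type := Metric.sphere (0 : E3) 1

instance : Fact (Module.finrank ℝ E3 = 2 + 1) := ⟨by simp⟩

/-- Points of the coordinate plane of the chart `(θ, φ)`: `y 0 = θ`, `y 1 = φ`. -/
abbrev Chart : Type := Fin 2 → ℝ

/-- Spherical coordinates are regular where `0 < θ < π`. -/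
def chartDomain : Set Chart := {y | 0 < y 0 ∧ y 0 < π}

lemma sph_aux (a b : ℝ) :
    (!₂[sin a * cos b, sin a * sin b, cos a] : E3) ∈ Metric.sphere (0 : E3) 1 := by
  rw [mem_sphere_zero_iff_norm, EuclideanSpace.norm_eq, Real.sqrt_eq_one]
  simp only [Fin.sum_univ_three, Real.norm_eq_abs, sq_abs]
  simp
  nlinarith [sin_sq_add_cos_sq a, sin_sq_add_cos_sq b]

/-- The point of the sphere with spherical coordinates `y = (θ, φ)`. -/
def sph (y : Chart) : S2 :=
  ⟨!₂[sin (y 0) * cos (y 1), sin (y 0) * sin (y 1), cos (y 0)], sph_aux (y 0) (y 1)⟩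

/-! ### Pseudo-Riemannian geometry in coordinates -/

section Coordinates

variable {n : ℕ}

/-- The partial derivative in the `i`-th coordinate. -/
def pd (i : Fin n) (F : (Fin n → ℝ) → ℝ) (x : Fin n → ℝ) : ℝ :=
  deriv (fun t => F (Function.update x i t)) (x i)

/-- The Christoffel symbol `Γ^k_{ij}` of the metric `G`. -/
def christoffel (G : (Fin n → ℝ) → Matrix (Fin n) (Fin n) ℝ) (x : Fin n → ℝ)
    (k i j : Fin n) : ℝ :=
  (1 / 2) * ∑ l, (G x)⁻¹ k l *
    (pd i (fun z => G z j l) x + pd j (fun z => G z i l) x - pd l (fun z => G z i j) x)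

/-- `R_{abcd} = g(R(∂_a, ∂_b) ∂_c, ∂_d)` with
`R(X, Y) Z = ∇_X ∇_Y Z - ∇_Y ∇_X Z - ∇_{[X, Y]} Z`. -/
def riemann (G : (Fin n → ℝ) → Matrix (Fin n) (Fin n) ℝ) (x : Fin n → ℝ)
    (a b c d : Fin n) : ℝ :=
  ∑ e, G x d e *
    (pd a (fun z => christoffel G z e b c) x - pd b (fun z => christoffel G z e a c) x
      + ∑ k, (christoffel G x e a k * christoffel G x k b c
          - christoffel G x e b k * christoffel G x k a c))

/-- The scalar product of the coordinate vectors `v`, `w` at `x`. -/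
def ip (G : (Fin n → ℝ) → Matrix (Fin n) (Fin n) ℝ) (x v w : Fin n → ℝ) : ℝ :=
  ∑ a, ∑ b, G x a b * v a * w b

end Coordinates

/-! ### Intrinsic geometry of a 2-sphere with metric `h` in the chart `(θ, φ)` -/

abbrev Mat2 : Type := Matrix (Fin 2) (Fin 2) ℝ

/-- The Gauss curvature. -/
def gaussCurvature (h : Chart → Mat2) (y : Chart) : ℝ :=
  riemann h y 0 1 1 0 / (h y).det

/-- The divergence of the 1-form `η`. -/
def divergence (h : Chart → Mat2) (η : Fin 2 → Chart → ℝ) (y : Chart) : ℝ :=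
  ∑ i, ∑ j, (h y)⁻¹ i j * (pd i (η j) y - ∑ k, christoffel h y k i j * η k y)

/-- The Laplace-Beltrami operator. -/
def laplacian (h : Chart → Mat2) (F : Chart → ℝ) (y : Chart) : ℝ :=
  divergence h (fun j => pd j F) y

/-- `∫ F dvol_h` over the sphere; the chart omits only a null set. -/
def surfaceIntegral (h : Chart → Mat2) (F : Chart → ℝ) : ℝ :=
  ∫ p in Ioo (0 : ℝ) π ×ˢ Ioo (0 : ℝ) (2 * π), F ![p.1, p.2] * √((h ![p.1, p.2]).det)

/-- The area radius `r`, `|Σ| = 4 π r²`. -/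
def areaRadius (h : Chart → Mat2) : ℝ :=
  √(surfaceIntegral h (fun _ => 1) / (4 * π))

/-- The trace of the symmetric 2-tensor `k` with respect to `h`. -/
def trace2 (h k : Mat2) : ℝ := ∑ i, ∑ j, h⁻¹ i j * k i j

/-- The scalar product of two 2-tensors with respect to `h`. -/
def tensorIp (h k l : Mat2) : ℝ :=
  ∑ a, ∑ b, ∑ c, ∑ d, h⁻¹ a c * h⁻¹ b d * k a b * l c d

/-! ### The Schwarzschild spacetime in double null coordinates

Coordinates `x 0 = s`, `x 1 = s̲` (written `t` below), `x 2 = θ`, `x 3 = φ`;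
`r₀ = 2m` is the area radius of the event horizon `s = 0`. -/

/-- The area radius function `r > 0`, `(r - r₀) exp (r / r₀) = s exp ((s̲ + s + r₀) / r₀)`. -/
def schwR (r₀ s t : ℝ) : ℝ :=
  Function.invFunOn (fun r => (r - r₀) * exp (r / r₀)) (Ioi 0) (s * exp ((t + s + r₀) / r₀))

/-- `Ω² = (s + r₀) / r * exp ((s̲ + s + r₀ - r) / r₀)`. -/
def omegaSq (r₀ s t : ℝ) : ℝ :=
  (s + r₀) / schwR r₀ s t * exp ((t + s + r₀ - schwR r₀ s t) / r₀)

/-- `g = 2 Ω² (ds ⊗ ds̲ + ds̲ ⊗ ds) + r² (dθ² + sin² θ dφ²)`. -/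
def schwarzschild (r₀ : ℝ) (x : Fin 4 → ℝ) : Matrix (Fin 4) (Fin 4) ℝ :=
  !![0, 2 * omegaSq r₀ (x 0) (x 1), 0, 0;
     2 * omegaSq r₀ (x 0) (x 1), 0, 0, 0;
     0, 0, schwR r₀ (x 0) (x 1) ^ 2, 0;
     0, 0, 0, schwR r₀ (x 0) (x 1) ^ 2 * sin (x 2) ^ 2]

/-! ### Spacelike surfaces in the Schwarzschild spacetime

A surface is given by its parametrisation `X` in the coordinates `(s, s̲, θ, φ)`. -/

abbrev Surface : Type := Chart → Fin 4 → ℝ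

/-- The surface `s = f, s̲ = f̲`. -/
def graphSurface (f fb : Chart → ℝ) : Surface := fun y => ![f y, fb y, y 0, y 1]

/-- The tangent vector `∂_i X`. -/
def tangent (X : Surface) (i : Fin 2) (y : Chart) : Fin 4 → ℝ :=
  fun a => pd i (fun z => X z a) y

/-- The intrinsic metric. -/
def inducedMetric (r₀ : ℝ) (X : Surface) (y : Chart) : Mat2 :=
  Matrix.of fun i j => ip (schwarzschild r₀) (X y) (tangent X i y) (tangent X j y)

/-- `∇_{∂_i X} W` for a vector field `W` along the surface. -/
def covD (r₀ : ℝ) (X : Surface) (i : Fin 2) (W : Chart → Fin 4 → ℝ) (y : Chart) : Fin 4 → ℝ :=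
  fun a => pd i (fun z => W z a) y
    + ∑ b, ∑ c, christoffel (schwarzschild r₀) (X y) a b c * tangent X i y b * W y c

/-- `χ(∂_i, ∂_j) = g(∇_i W, ∂_j)`, the second fundamental form relative to the normal `W`. -/
def secondForm (r₀ : ℝ) (X : Surface) (W : Chart → Fin 4 → ℝ) (y : Chart) : Mat2 :=
  Matrix.of fun i j => ip (schwarzschild r₀) (X y) (covD r₀ X i W y) (tangent X j y)

/-- The null expansion `tr χ`. -/
def expansion (r₀ : ℝ) (X : Surface) (W : Chart → Fin 4 → ℝ) (y : Chart) : ℝ :=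
  trace2 (inducedMetric r₀ X y) (secondForm r₀ X W y)

/-- The shear, the trace-free part of `χ`. -/
def shear (r₀ : ℝ) (X : Surface) (W : Chart → Fin 4 → ℝ) (y : Chart) : Mat2 :=
  secondForm r₀ X W y - ((1 / 2) * expansion r₀ X W y) • inducedMetric r₀ X y

/-- The torsion `η(∂_i) = ½ g(∇_i L̲, L')` of the conjugate null frame `(L', L̲)`. -/
def torsion (r₀ : ℝ) (X : Surface) (Lp Lb : Chart → Fin 4 → ℝ) (i : Fin 2) (y : Chart) : ℝ :=
  (1 / 2) * ip (schwarzschild r₀) (X y) (covD r₀ X i Lb y) (Lp y)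

/-- The mass aspect function `μ = K - ¼ tr χ' tr χ̲ - div η`. -/
def massAspect (r₀ : ℝ) (X : Surface) (Lp Lb : Chart → Fin 4 → ℝ) (y : Chart) : ℝ :=
  gaussCurvature (inducedMetric r₀ X) y
    - (1 / 4) * expansion r₀ X Lp y * expansion r₀ X Lb y
    - divergence (inducedMetric r₀ X) (torsion r₀ X Lp Lb) y

/-- The curvature component `ρ = ¼ R(L', L̲, L̲, L')`. -/
def rhoComponent (r₀ : ℝ) (X : Surface) (Lp Lb : Chart → Fin 4 → ℝ) (y : Chart) : ℝ :=
  (1 / 4) * ∑ a, ∑ b, ∑ c, ∑ d,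
    riemann (schwarzschild r₀) (X y) a b c d * Lp y a * Lb y b * Lb y c * Lp y d

/-- The Hawking mass `r/2 (1 - (1/16π) ∫ tr χ' tr χ̲ dvol)`. -/
def hawkingMass (r₀ : ℝ) (X : Surface) (Lp Lb : Chart → Fin 4 → ℝ) : ℝ :=
  areaRadius (inducedMetric r₀ X) / 2 *
    (1 - 1 / (16 * π) * surfaceIntegral (inducedMetric r₀ X)
      (fun y => expansion r₀ X Lp y * expansion r₀ X Lb y))

/-! ### The conjugate null frame of a graph `s = f, s̲ = f̲`

A vector `A ∂_s + B ∂_s̲ + C^i ∂_i` is normal to the graph iff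
`C = -2 Ω² r⁻² (A ∇f̲ + B ∇f)` (gradients of the unit round sphere), and it is null iff moreover
`A B + Ω² r⁻² |A df̲ + B df|² = 0`. For `A = 1` this is `p B² + (1 + 2 m) B + q = 0` with
`p = Ω² r⁻² |df|²`, `m = Ω² r⁻² df · df̲`, `q = Ω² r⁻² |df̲|²`; the incoming direction is given by
the root that vanishes with `q`. The outgoing direction arises in the same way from `B = 1`. -/

/-- The root of `p z² + (1 + 2 m) z + q = 0` that vanishes with `q`. -/
def nullRoot (p m q : ℝ) : ℝ :=
  -2 * q / ((1 + 2 * m) + √((1 + 2 * m) ^ 2 - 4 * p * q))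

/-- `Ω² r⁻² ⟨α, β⟩` for covectors `α`, `β` at the point `x`, with `⟨,⟩` that of the unit sphere. -/
def covecIp (r₀ : ℝ) (x : Fin 4 → ℝ) (α β : Fin 2 → ℝ) : ℝ :=
  omegaSq r₀ (x 0) (x 1) / schwR r₀ (x 0) (x 1) ^ 2 * (α 0 * β 0 + α 1 * β 1 / sin (x 2) ^ 2)

/-- The normal vector of the graph with `∂_s`-component `A` and `∂_s̲`-component `B`. -/
def graphNormal (r₀ : ℝ) (X : Surface) (y : Chart) (A B : ℝ) : Fin 4 → ℝ :=
  let c := -2 * omegaSq r₀ (X y 0) (X y 1) / schwR r₀ (X y 0) (X y 1) ^ 2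
  ![A, B,
    c * (A * tangent X 0 y 1 + B * tangent X 0 y 0),
    c * (A * tangent X 1 y 1 + B * tangent X 1 y 0) / sin (X y 2) ^ 2]

/-- The incoming null normal `L̲` with `L̲ s = 1`. -/
def incoming (r₀ : ℝ) (X : Surface) (y : Chart) : Fin 4 → ℝ :=
  let df : Fin 2 → ℝ := fun i => tangent X i y 0
  let dfb : Fin 2 → ℝ := fun i => tangent X i y 1
  graphNormal r₀ X y 1
    (nullRoot (covecIp r₀ (X y) df df) (covecIp r₀ (X y) df dfb) (covecIp r₀ (X y) dfb dfb))

/-- The outgoing null normal `ℓ` with `ℓ s̲ = 1`. -/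
def outgoing (r₀ : ℝ) (X : Surface) (y : Chart) : Fin 4 → ℝ :=
  let df : Fin 2 → ℝ := fun i => tangent X i y 0
  let dfb : Fin 2 → ℝ := fun i => tangent X i y 1
  graphNormal r₀ X y
    (nullRoot (covecIp r₀ (X y) dfb dfb) (covecIp r₀ (X y) df dfb) (covecIp r₀ (X y) df df)) 1

/-- The outgoing null normal `L'` conjugate to `incoming`: `g(L', L̲) = 2`. -/
def conjugate (r₀ : ℝ) (X : Surface) (y : Chart) : Fin 4 → ℝ :=
  (2 / ip (schwarzschild r₀) (X y) (incoming r₀ X y) (outgoing r₀ X y)) • outgoing r₀ X y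

/-! ### Foliated hypersurfaces

`h` describes the hypersurface `s̲ = h(s, ϑ)`, and `f` the leaves `Σ_u`, `s = f(u, ϑ)`, in it. -/

/-- `g⁻¹(dΦ, dΦ)` for `Φ = s̲ - h(s, ϑ)`, at the point of the hypersurface with coordinates
`(s, y)`; the hypersurface is null iff this vanishes. -/
def nullity (r₀ : ℝ) (h : ℝ → S2 → ℝ) (s : ℝ) (y : Chart) : ℝ :=
  let dΦ : Fin 4 → ℝ := ![-deriv (fun σ => h σ (sph y)) s, 1,
    -pd 0 (fun z => h s (sph z)) y, -pd 1 (fun z => h s (sph z)) y]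
  ∑ a, ∑ b, (schwarzschild r₀ ![s, h s (sph y), y 0, y 1])⁻¹ a b * dΦ a * dΦ b

/-- The leaf `Σ_u`. -/
def leaf (h f : ℝ → S2 → ℝ) (u : ℝ) : Surface :=
  graphSurface (fun y => f u (sph y)) (fun y => h (f u (sph y)) (sph y))

/-- The metric of the leaf `Σ_u`. -/
def leafMetric (r₀ : ℝ) (h f : ℝ → S2 → ℝ) (u : ℝ) : Chart → Mat2 :=
  inducedMetric r₀ (leaf h f u)

/-- The lapse function `a`: with `L̲` the incoming null normal normalised by `L̲ s = 1`,
`(a L̲) u = 1`. Differentiating `s = f(u, ϑ)` along `L̲` gives `1 = ∂_u f · L̲ u + L̲^i ∂_i f`. -/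
def lapse (r₀ : ℝ) (h f : ℝ → S2 → ℝ) (u : ℝ) (y : Chart) : ℝ :=
  deriv (fun v => f v (sph y)) u /
    (1 - (incoming r₀ (leaf h f u) y 2 * tangent (leaf h f u) 0 y 0
      + incoming r₀ (leaf h f u) y 3 * tangent (leaf h f u) 1 y 0))

/-- The null normal `L̲^u` relative to the foliation: `L̲^u u = 1`. -/
def folLb (r₀ : ℝ) (h f : ℝ → S2 → ℝ) (u : ℝ) (y : Chart) : Fin 4 → ℝ :=
  lapse r₀ h f u y • incoming r₀ (leaf h f u) y

/-- The conjugate null normal `L'^u` relative to the foliation. -/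
def folLp (r₀ : ℝ) (h f : ℝ → S2 → ℝ) (u : ℝ) (y : Chart) : Fin 4 → ℝ :=
  (lapse r₀ h f u y)⁻¹ • conjugate r₀ (leaf h f u) y

/-- The mass aspect function of `Σ_u` relative to the foliation. -/
def folMassAspect (r₀ : ℝ) (h f : ℝ → S2 → ℝ) (u : ℝ) (y : Chart) : ℝ :=
  massAspect r₀ (leaf h f u) (folLp r₀ h f u) (folLb r₀ h f u) y

/-- The Hawking mass of `Σ_u`. -/
def folHawkingMass (r₀ : ℝ) (h f : ℝ → S2 → ℝ) (u : ℝ) : ℝ :=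
  hawkingMass r₀ (leaf h f u) (folLp r₀ h f u) (folLb r₀ h f u)

/-- The area radius `r_u` of `Σ_u`. -/
def folRadius (r₀ : ℝ) (h f : ℝ → S2 → ℝ) (u : ℝ) : ℝ :=
  areaRadius (leafMetric r₀ h f u)

/-! ### Linearisation at the spherically symmetric foliation `{Σ_{s, s̲ = 0}}_{s ≥ 0}` -/

/-- The hypersurfaces `s̲ = ε δh`. -/
def varH (δh : ℝ → S2 → ℝ) (ε : ℝ) : ℝ → S2 → ℝ := fun s ϑ => ε * δh s ϑ

/-- The leaves `s = u + ε δf_u`. -/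
def varF (δf : ℝ → S2 → ℝ) (ε : ℝ) : ℝ → S2 → ℝ := fun u ϑ => u + ε * δf u ϑ

/-- A function on `ℝ × S²` is smooth. -/
def SmoothOnRS2 (F : ℝ → S2 → ℝ) : Prop :=
  ContMDiff (𝓘(ℝ, ℝ).prod (𝓡 2)) 𝓘(ℝ, ℝ) ∞ (fun p : ℝ × S2 => F p.1 p.2)

/-- `(δh, δf)` is the linearised perturbation of the constant mass aspect function foliation
`{Σ_{s, 0}}_{s ≥ 0}` with the linearised perturbation `(δf₀, δfb₀)` of the initial leaf `Σ_{0,0}`: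
along `ε ↦ (ε δh, u + ε δf)` the following equations hold to first order at `ε = 0`. -/
structure IsLinearisedFoliation (r₀ : ℝ) (δf₀ δfb₀ : S2 → ℝ) (δh δf : ℝ → S2 → ℝ) : Prop where
  smooth_h : SmoothOnRS2 δh
  smooth_f : SmoothOnRS2 δf
  init_h : ∀ ϑ, δh 0 ϑ = δfb₀ ϑ
  init_f : ∀ ϑ, δf 0 ϑ = δf₀ ϑ
  /-- The hypersurface is null. -/
  null : ∀ s, 0 ≤ s → ∀ y ∈ chartDomain,
    HasDerivAt (fun ε => nullity r₀ (varH δh ε) s y) 0 0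
  /-- The mass aspect function is constant on each leaf. -/
  massAspect_const : ∀ u, 0 ≤ u → ∃ c : ℝ, ∀ y ∈ chartDomain,
    HasDerivAt (fun ε => folMassAspect r₀ (varH δh ε) (varF δf ε) u y) c 0
  /-- The labelling `r_u = r_0 + u`. -/
  labelling : ∀ u, 0 ≤ u → HasDerivAt (fun ε =>
    folRadius r₀ (varH δh ε) (varF δf ε) u - (folRadius r₀ (varH δh ε) (varF δf ε) 0 + u)) 0 0

/-- For a quantity `Q u ε` of the leaf `Σ_u` of the `ε`-th foliation: its limit at null infinity
is `q` for the foliation `ε = 0`, and the linearised perturbation of this limit is `δq`. -/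
def HasAsymptoticJet (Q : ℝ → ℝ → ℝ) (q δq : ℝ) : Prop :=
  (∀ u, 0 ≤ u → DifferentiableAt ℝ (Q u) 0) ∧
  Tendsto (fun u => Q u 0) atTop (𝓝 q) ∧
  Tendsto (fun u => deriv (Q u) 0) atTop (𝓝 δq)

/-- The limits at null infinity `P = lim r³ ρ`, `Σ = lim χ̲̂`, `Ξ = lim r⁻¹ χ̂'`, and the limit
renormalised metric `g = lim r⁻² g_u`, of a foliation. -/
structure AsymptoticData where
  P : Chart → ℝ
  Sig : Chart → Mat2
  Xi : Chart → Mat2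
  g : Chart → Mat2

namespace AsymptoticData

/-- The line `ε ↦ A + ε δA`. -/
def line (A δA : AsymptoticData) (ε : ℝ) : AsymptoticData where
  P y := A.P y + ε * δA.P y
  Sig y := A.Sig y + ε • δA.Sig y
  Xi y := A.Xi y + ε • δA.Xi y
  g y := A.g y + ε • δA.g y

/-- `N = -P - ½ (Σ, Ξ)`. -/
def N (A : AsymptoticData) (y : Chart) : ℝ :=
  -A.P y - (1 / 2) * tensorIp (A.g y) (A.Sig y) (A.Xi y)

/-- The Bondi energy `(1/8π) ∫ N dvol`. -/
def energy (A : AsymptoticData) : ℝ := 1 / (8 * π) * surfaceIntegral A.g A.N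

/-- The linear momentum `(1/8π) ∫ Y^i N dvol` relative to the functions `Y^i`. -/
def momentum (A : AsymptoticData) (Y : Fin 3 → S2 → ℝ) (i : Fin 3) : ℝ :=
  1 / (8 * π) * surfaceIntegral A.g (fun y => Y i (sph y) * A.N y)

/-- The Bondi mass `√(E² - |P|²)`. -/
def bondiMass (A : AsymptoticData) (Y : Fin 3 → S2 → ℝ) : ℝ :=
  √(A.energy ^ 2 - ∑ i, A.momentum Y i ^ 2)

end AsymptoticData

/-- `A` and `δA` are the asymptotic limits of `{Σ_{s, 0}}` and their linearised perturbations. -/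
structure IsAsymptoticJet (r₀ : ℝ) (δh δf : ℝ → S2 → ℝ) (A δA : AsymptoticData) : Prop where
  rho : ∀ y ∈ chartDomain, HasAsymptoticJet (fun u ε =>
    folRadius r₀ (varH δh ε) (varF δf ε) u ^ 3 *
      rhoComponent r₀ (leaf (varH δh ε) (varF δf ε) u) (folLp r₀ (varH δh ε) (varF δf ε) u)
        (folLb r₀ (varH δh ε) (varF δf ε) u) y) (A.P y) (δA.P y)
  shear_in : ∀ y ∈ chartDomain, ∀ i j, HasAsymptoticJet (fun u ε =>
    shear r₀ (leaf (varH δh ε) (varF δf ε) u) (folLb r₀ (varH δh ε) (varF δf ε) u) y i j)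
      (A.Sig y i j) (δA.Sig y i j)
  shear_out : ∀ y ∈ chartDomain, ∀ i j, HasAsymptoticJet (fun u ε =>
    (folRadius r₀ (varH δh ε) (varF δf ε) u)⁻¹ *
      shear r₀ (leaf (varH δh ε) (varF δf ε) u) (folLp r₀ (varH δh ε) (varF δf ε) u) y i j)
      (A.Xi y i j) (δA.Xi y i j)
  metric : ∀ y ∈ chartDomain, ∀ i j, HasAsymptoticJet (fun u ε =>
    (folRadius r₀ (varH δh ε) (varF δf ε) u ^ 2)⁻¹ *
      leafMetric r₀ (varH δh ε) (varF δf ε) u y i j) (A.g y i j) (δA.g y i j)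

/-- The foliation stays asymptotically round to first order: the limit renormalised Gauss
curvature `lim r² K` is `1`, and its linearised perturbation is `0`. -/
def IsRoundJet (r₀ : ℝ) (δh δf : ℝ → S2 → ℝ) : Prop :=
  ∀ y ∈ chartDomain, HasAsymptoticJet (fun u ε =>
    folRadius r₀ (varH δh ε) (varF δf ε) u ^ 2 *
      gaussCurvature (leafMetric r₀ (varH δh ε) (varF δf ε) u) y) 1 0

/-- The degree one spherical harmonics `Y^i`: the Cartesian coordinate functions of the unit sphere
with respect to an orthonormal basis. -/
def sphHarmonic (b : OrthonormalBasis (Fin 3) ℝ E3) (i : Fin 3) (ϑ : S2) : ℝ :=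
  inner ℝ (b i) (ϑ : E3)

/-- The functions `Y^i + ε δY^i`. -/
def varY (b : OrthonormalBasis (Fin 3) ℝ E3) (δY : Fin 3 → S2 → ℝ) (ε : ℝ) : Fin 3 → S2 → ℝ :=
  fun i ϑ => sphHarmonic b i ϑ + ε * δY i ϑ

/-- `δY` is an admissible linearised perturbation of the functions `Y^i` for the linearised
perturbation of the limit renormalised metric: to first order, the `Y^i` remain first
eigenfunctions of the Laplacian with `∫ Y^i Y^j dvol = (4π/3) δ_ij`. -/
structure IsAdmissible (b : OrthonormalBasis (Fin 3) ℝ E3) (A δA : AsymptoticData)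
    (δY : Fin 3 → S2 → ℝ) : Prop where
  smooth : ∀ i, ContMDiff (𝓡 2) 𝓘(ℝ, ℝ) ∞ (δY i)
  eigen : ∀ i, ∀ y ∈ chartDomain, HasDerivAt (fun ε =>
    laplacian (A.line δA ε).g (fun z => varY b δY ε i (sph z)) y + 2 * varY b δY ε i (sph y)) 0 0
  orthogonal : ∀ i j, HasDerivAt (fun ε => surfaceIntegral (A.line δA ε).g
    (fun y => varY b δY ε i (sph y) * varY b δY ε j (sph y))) 0 0

/-- The linearised perturbation `δf = 0`, `δf̲ = v` of the initial leaf `Σ_{0,0}` determines a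
linearised perturbation of the constant mass aspect function foliation; this remains an
asymptotic reference frame, and the linearised perturbations of its Bondi energy, linear momentum
and Bondi mass at null infinity are `δE`, `δP`, `δm`, whatever admissible linearised perturbation
of the functions `Y^i` is chosen. -/
structure HasLinearisedEnergyMomentum (r₀ : ℝ) (b : OrthonormalBasis (Fin 3) ℝ E3) (v : S2 → ℝ)
    (δE : ℝ) (δP : Fin 3 → ℝ) (δm : ℝ) : Prop where
  exists_foliation : ∃ δh δf, IsLinearisedFoliation r₀ 0 v δh δf
  unique_foliation : ∀ δh δf δh' δf', IsLinearisedFoliation r₀ 0 v δh δf →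
    IsLinearisedFoliation r₀ 0 v δh' δf' → ∀ u, 0 ≤ u → δh u = δh' u ∧ δf u = δf' u
  round : ∀ δh δf, IsLinearisedFoliation r₀ 0 v δh δf → IsRoundJet r₀ δh δf
  values : ∀ δh δf, IsLinearisedFoliation r₀ 0 v δh δf →
    ∃ A δA, IsAsymptoticJet r₀ δh δf A δA ∧
      -- the Bondi energy is the limit of the Hawking mass, and equals `(1/8π) ∫ N dvol`
      HasAsymptoticJet (fun u ε => folHawkingMass r₀ (varH δh ε) (varF δf ε) u) A.energy δE ∧
      HasDerivAt (fun ε => (A.line δA ε).energy) δE 0 ∧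
      (∃ δY, IsAdmissible b A δA δY) ∧
      ∀ δY, IsAdmissible b A δA δY →
        (∀ i, HasDerivAt (fun ε => (A.line δA ε).momentum (varY b δY ε) i) (δP i) 0) ∧
        HasDerivAt (fun ε => (A.line δA ε).bondiMass (varY b δY ε)) δm 0

/-- The 4-dimensional space `V` spanned by the spherical harmonics of degrees 0 and 1. -/
def spaceV (b : OrthonormalBasis (Fin 3) ℝ E3) : Submodule ℝ (S2 → ℝ) :=
  Submodule.span ℝ (insert (fun _ => 1) (Set.range (sphHarmonic b)))

end CMAFoliation

end

open CMAFoliation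

open Real Set Filter Topology MeasureTheory
open scoped Manifold ContDiff

noncomputable section

namespace CMAFoliation

/-! ### Partial derivatives -/

/-! Write r = r₀ + u, F = δf_u, H = δh. All first-order variations are computed once and for all.
The null condition linearises to ∂_s δh = 0, so H keeps its initial value `δf̲`. The radius varies
by R = F + (u/r) H, the induced metric stays conformally round with factor 1 + 2εR/r, and the mass
aspect varies by -(3r₀/r⁴) R - (u/r⁴) ΔH + ΔF/r³ - Δ(∂_u F)/r². This last expression has to be
constant on each sphere.

For H = c₀ + r₀ζ with ζ = ⟨w, ·⟩ a linear function (Δζ = -2ζ), the ansatz F = α + βζ turns the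
equation into a scalar linear ODE for β, with solution `profile`. The labelling by area radius fixes
α = -(u/r) c₀. As u → ∞ the relative radius perturbation R/r tends to κζ with κ = 8/3 - (2/3)
e^{3/2} (`tendsto_amplitude`). A conformal factor of degree one is an infinitesimal conformal motion
of the sphere, so the limit stays round. The shears vanish to first order because the Hessian of ζ
is pure trace (`roundHess_zeta`). Only ρ = -r₀/r³ is left, giving N = r₀ - 3r₀κεζ to first order.

The energy does not change because ζ has mean zero. In the momentum there are three contributions,
in the proportion -3 from N, +2 from the area form and -2 from the forced mean of δY^i. Their sum
gives δP^i = -(κ/2) r₀ c_i, which is the stated constant; it is nonzero since e³ ≠ 16. The Bondi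
mass is stationary because the background momentum vanishes.

Uniqueness is obtained without expanding in spherical harmonics. The mean-free difference D from the
explicit solution satisfies Δ(∂_u D - D/r) = -(3r₀/r²) D. Testing with powers of linear functions
gives a triangular system of linear ODEs for the moments of D, all with zero initial value, so every
moment vanishes (`MeanFreeSolution.moment_eq_zero`). By Stone-Weierstrass D = 0
(`eq_zero_of_moments`).

Two calculi carry the computations. `HasJet` treats pointwise first-order expansions that are
jointly smooth in ε and the chart, and so may be differentiated in the chart. Integrals such as the
area and the Hawking mass need control uniform up to the poles, where the chart degenerates. For
this `Zonal` records that a family is a smooth function of ε and of ζ alone, and ζ ranges over a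
compact interval. Classification makes this applicable: every solution is affine in ζ. -/

lemma two_le_infty : (2 : WithTop ℕ∞) ≤ ∞ := by
  have : ((2 : ℕ∞) : WithTop ℕ∞) ≤ ((⊤ : ℕ∞) : WithTop ℕ∞) := WithTop.coe_le_coe.2 le_top
  exact this

section Pd

variable {n : ℕ}

lemma hasDerivAt_comp_update {F : (Fin n → ℝ) → ℝ} {x : Fin n → ℝ} (h : DifferentiableAt ℝ F x)
    (i : Fin n) :
    HasDerivAt (fun t => F (Function.update x i t)) (fderiv ℝ F x (Pi.single i 1)) (x i) := by
  have h1 := hasDerivAt_update x i (x i)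
  have h2 : HasFDerivAt F (fderiv ℝ F x) (Function.update x i (x i)) := by
    simpa using h.hasFDerivAt
  exact h2.comp_hasDerivAt (x i) h1

lemma pd_eq_fderiv {F : (Fin n → ℝ) → ℝ} {x : Fin n → ℝ} (h : DifferentiableAt ℝ F x)
    (i : Fin n) : pd i F x = fderiv ℝ F x (Pi.single i 1) :=
  (hasDerivAt_comp_update h i).deriv

lemma hasDerivAt_pd {F : (Fin n → ℝ) → ℝ} {x : Fin n → ℝ} (h : DifferentiableAt ℝ F x)
    (i : Fin n) : HasDerivAt (fun t => F (Function.update x i t)) (pd i F x) (x i) := by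
  rw [pd_eq_fderiv h]; exact hasDerivAt_comp_update h i

lemma pd_congr {F G : (Fin n → ℝ) → ℝ} {x : Fin n → ℝ} (h : F =ᶠ[𝓝 x] G) (i : Fin n) :
    pd i F x = pd i G x := by
  have hc : ContinuousAt (fun t => Function.update x i t) (x i) :=
    (hasDerivAt_update x i (x i)).continuousAt
  have : Tendsto (fun t => Function.update x i t) (𝓝 (x i)) (𝓝 x) := by
    simpa [ContinuousAt] using hc
  exact Filter.EventuallyEq.deriv_eq (this.eventually h)

lemma pd_congr_on {F G : (Fin n → ℝ) → ℝ} {U : Set (Fin n → ℝ)} (hU : IsOpen U)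
    (h : ∀ x ∈ U, F x = G x) {x : Fin n → ℝ} (hx : x ∈ U) (i : Fin n) : pd i F x = pd i G x :=
  pd_congr (Filter.eventuallyEq_of_mem (hU.mem_nhds hx) h) i

lemma pd_const (c : ℝ) (i : Fin n) (x : Fin n → ℝ) : pd i (fun _ => c) x = 0 := by
  simp [pd]

lemma pd_add {F G : (Fin n → ℝ) → ℝ} {x : Fin n → ℝ} (hF : DifferentiableAt ℝ F x)
    (hG : DifferentiableAt ℝ G x) (i : Fin n) :
    pd i (fun z => F z + G z) x = pd i F x + pd i G x :=
  ((hasDerivAt_pd hF i).add (hasDerivAt_pd hG i)).deriv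

lemma pd_sub {F G : (Fin n → ℝ) → ℝ} {x : Fin n → ℝ} (hF : DifferentiableAt ℝ F x)
    (hG : DifferentiableAt ℝ G x) (i : Fin n) :
    pd i (fun z => F z - G z) x = pd i F x - pd i G x :=
  ((hasDerivAt_pd hF i).sub (hasDerivAt_pd hG i)).deriv

lemma pd_neg (F : (Fin n → ℝ) → ℝ) (x : Fin n → ℝ) (i : Fin n) :
    pd i (fun z => -F z) x = -pd i F x := by
  simp [pd, deriv.fun_neg]

lemma pd_mul {F G : (Fin n → ℝ) → ℝ} {x : Fin n → ℝ} (hF : DifferentiableAt ℝ F x)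
    (hG : DifferentiableAt ℝ G x) (i : Fin n) :
    pd i (fun z => F z * G z) x = pd i F x * G x + F x * pd i G x := by
  have := ((hasDerivAt_pd hF i).fun_mul (hasDerivAt_pd hG i)).deriv
  simpa [pd] using this

lemma pd_const_mul (c : ℝ) {F : (Fin n → ℝ) → ℝ} {x : Fin n → ℝ} (hF : DifferentiableAt ℝ F x)
    (i : Fin n) : pd i (fun z => c * F z) x = c * pd i F x :=
  ((hasDerivAt_pd hF i).const_mul c).deriv

lemma pd_comp {F : (Fin n → ℝ) → ℝ} {x : Fin n → ℝ} {g : ℝ → ℝ} {g' : ℝ}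
    (hg : HasDerivAt g g' (F x)) (hF : DifferentiableAt ℝ F x) (i : Fin n) :
    pd i (fun z => g (F z)) x = g' * pd i F x := by
  have h := hasDerivAt_pd hF i
  have hg' : HasDerivAt g g' (F (Function.update x i (x i))) := by simpa using hg
  exact (hg'.comp (x i) h).deriv

lemma pd_coord_self (g : ℝ → ℝ) (i : Fin n) (x : Fin n → ℝ) :
    pd i (fun z => g (z i)) x = deriv g (x i) := by
  simp [pd]

lemma pd_coord_ne (g : ℝ → ℝ) {i j : Fin n} (hij : j ≠ i) (x : Fin n → ℝ) :
    pd i (fun z => g (z j)) x = 0 := by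
  simp [pd, Function.update_of_ne hij]

lemma contDiffAt_pd {F : (Fin n → ℝ) → ℝ} {x : Fin n → ℝ} (h : ContDiffAt ℝ ∞ F x) (i : Fin n) :
    ContDiffAt ℝ ∞ (pd i F) x := by
  have h1 : ContDiffAt ℝ ∞ (fun z => fderiv ℝ F z (Pi.single i 1)) x :=
    (h.fderiv_right (m := ∞) (by simp)).clm_apply contDiffAt_const
  refine h1.congr_of_eventuallyEq ?_
  have h2 : ∀ᶠ z in 𝓝 x, ContDiffAt ℝ 1 F z := (h.of_le (by simp)).eventually (by simp)
  filter_upwards [h2] with z hz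
  exact pd_eq_fderiv (hz.differentiableAt (by simp)) i

lemma contDiff_pd {F : (Fin n → ℝ) → ℝ} (h : ContDiff ℝ ∞ F) (i : Fin n) :
    ContDiff ℝ ∞ (pd i F) :=
  contDiff_iff_contDiffAt.2 fun _ => contDiffAt_pd h.contDiffAt i

lemma pd_comm {F : (Fin n → ℝ) → ℝ} {x : Fin n → ℝ} (h : ContDiffAt ℝ ∞ F x) (i j : Fin n) :
    pd i (pd j F) x = pd j (pd i F) x := by
  have key : ∀ i j : Fin n, pd i (pd j F) x =
      fderiv ℝ (fderiv ℝ F) x (Pi.single i 1) (Pi.single j 1) := by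
    intro i j
    have h2 : ∀ᶠ z in 𝓝 x, ContDiffAt ℝ 1 F z := (h.of_le (by simp)).eventually (by simp)
    have h3 : pd j F =ᶠ[𝓝 x] fun z => fderiv ℝ F z (Pi.single j 1) := by
      filter_upwards [h2] with z hz using pd_eq_fderiv (hz.differentiableAt (by simp)) j
    have h4 : DifferentiableAt ℝ (fderiv ℝ F) x :=
      (h.fderiv_right (m := ∞) (by simp)).differentiableAt (by simp)
    rw [pd_congr h3, pd_eq_fderiv (h4.clm_apply (differentiableAt_const _)),
      fderiv_clm_apply h4 (differentiableAt_const _)]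
    simp
  rw [key, key]
  exact (h.isSymmSndFDerivAt (by simpa using two_le_infty)).eq _ _

end Pd

lemma isOpen_chartDomain : IsOpen chartDomain :=
  (isOpen_lt continuous_const (continuous_apply 0)).inter
    (isOpen_lt (continuous_apply 0) continuous_const)

lemma sin_pos_of_mem {y : Chart} (hy : y ∈ chartDomain) : 0 < sin (y 0) :=
  sin_pos_of_pos_of_lt_pi hy.1 hy.2

lemma sin_ne_zero_of_mem {y : Chart} (hy : y ∈ chartDomain) : sin (y 0) ≠ 0 :=
  (sin_pos_of_mem hy).ne'

/-! ### Functions on the sphere in the chart -/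

lemma contMDiff_sph : ContMDiff 𝓘(ℝ, Chart) (𝓡 2) ∞ sph := by
  have h : ContDiff ℝ ∞ (fun y : Chart =>
      (!₂[sin (y 0) * cos (y 1), sin (y 0) * sin (y 1), cos (y 0)] : E3)) := by
    rw [contDiff_euclidean]
    intro i
    fin_cases i <;> simp <;> fun_prop
  exact h.contMDiff.codRestrict_sphere fun y => sph_aux (y 0) (y 1)

/-- The map `sph` is smooth on the whole plane, so pulled-back functions are smooth across the lines
θ = 0, π as well. This is what makes integrals over the closed coordinate rectangle harmless. -/
lemma contDiff_comp_sph {F : S2 → ℝ} (hF : ContMDiff (𝓡 2) 𝓘(ℝ, ℝ) ∞ F) :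
    ContDiff ℝ ∞ (fun y => F (sph y)) :=
  (hF.comp contMDiff_sph).contDiff

lemma SmoothOnRS2.contDiff {F : ℝ → S2 → ℝ} (hF : SmoothOnRS2 F) :
    ContDiff ℝ ∞ (fun p : ℝ × Chart => F p.1 (sph p.2)) := by
  have h1 : ContMDiff 𝓘(ℝ, ℝ × Chart) (𝓘(ℝ, ℝ).prod (𝓡 2)) ∞
      (fun p : ℝ × Chart => (p.1, sph p.2)) :=
    contDiff_fst.contMDiff.prodMk (contMDiff_sph.comp contDiff_snd.contMDiff)
  have := ContMDiff.comp hF h1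
  exact this.contDiff

lemma SmoothOnRS2.differentiableAt {F : ℝ → S2 → ℝ} (hF : SmoothOnRS2 F) (u : ℝ) (y : Chart) :
    DifferentiableAt ℝ (fun v => F v (sph y)) u :=
  ((hF.contDiff.comp (contDiff_id.prodMk contDiff_const)).differentiable (by simp)) u

lemma SmoothOnRS2.contDiff_deriv {F : ℝ → S2 → ℝ} (hF : SmoothOnRS2 F) :
    ContDiff ℝ ∞ (fun p : ℝ × Chart => deriv (fun v => F v (sph p.2)) p.1) := by
  have h := hF.contDiff
  have h1 : ContDiff ℝ ∞ (fun p : ℝ × Chart =>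
      fderiv ℝ (fun p : ℝ × Chart => F p.1 (sph p.2)) p (1, 0)) :=
    (h.fderiv_right (m := ∞) (by simp)).clm_apply contDiff_const
  convert h1 using 2 with p
  have h2 : HasDerivAt (fun v : ℝ => (v, p.2)) (1, 0) p.1 :=
    (hasDerivAt_id p.1).prodMk (hasDerivAt_const _ _)
  have h3 : HasFDerivAt (fun p : ℝ × Chart => F p.1 (sph p.2)) _ (p.1, p.2) :=
    (h.differentiable (by simp) p).hasFDerivAt
  exact (h3.comp_hasDerivAt p.1 h2).deriv

/-! ### First-order jets of families of functions in the chart -/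

/-- The family `Q ε` of functions in the chart is smooth near `ε = 0`, with `Q 0 = q` and
`∂_ε Q = dq` at `ε = 0`. -/
def HasJet (Q : ℝ → Chart → ℝ) (q dq : Chart → ℝ) : Prop :=
  ∀ y ∈ chartDomain, ContDiffAt ℝ ∞ (fun p : ℝ × Chart => Q p.1 p.2) (0, y) ∧ Q 0 y = q y ∧
    HasDerivAt (fun ε => Q ε y) (dq y) 0

lemma hasFDerivAt_fderiv_apply {E : Type*} [NormedAddCommGroup E] [NormedSpace ℝ E] {G : E → ℝ}
    {x : E} (h : ContDiffAt ℝ ∞ G x) (e : E) :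
    HasFDerivAt (fun z => fderiv ℝ G z e) ((fderiv ℝ (fderiv ℝ G) x).flip e) x := by
  have hfd : ContDiffAt ℝ ∞ (fderiv ℝ G) x := h.fderiv_right (by simp)
  have h1 : HasFDerivAt (fderiv ℝ G) (fderiv ℝ (fderiv ℝ G) x) x :=
    (hfd.differentiableAt (by simp)).hasFDerivAt
  have h2 := h1.clm_apply (hasFDerivAt_const e x)
  simpa using h2

namespace HasJet

variable {Q P : ℝ → Chart → ℝ} {q dq p dp : Chart → ℝ}

lemma value (h : HasJet Q q dq) {y : Chart} (hy : y ∈ chartDomain) : Q 0 y = q y := (h y hy).2.1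

lemma hasDerivAt (h : HasJet Q q dq) {y : Chart} (hy : y ∈ chartDomain) :
    HasDerivAt (fun ε => Q ε y) (dq y) 0 := (h y hy).2.2

lemma contDiffAt (h : HasJet Q q dq) {y : Chart} (hy : y ∈ chartDomain) :
    ContDiffAt ℝ ∞ (fun p : ℝ × Chart => Q p.1 p.2) (0, y) := (h y hy).1

lemma continuousAt (h : HasJet Q q dq) {y : Chart} (hy : y ∈ chartDomain) :
    ContinuousAt (fun p : ℝ × Chart => Q p.1 p.2) (0, y) := (h y hy).1.continuousAt

lemma eventually_mem (h : HasJet Q q dq) {y : Chart} (hy : y ∈ chartDomain) {U : Set ℝ}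
    (hU : IsOpen U) (hq : q y ∈ U) : ∀ᶠ p : ℝ × Chart in 𝓝 (0, y), Q p.1 p.2 ∈ U :=
  (h.continuousAt hy).eventually_mem (hU.mem_nhds (by simpa [h.value hy] using hq))

lemma eventually_ne (h : HasJet Q q dq) {y : Chart} (hy : y ∈ chartDomain)
    (hq : q y ≠ 0) : ∀ᶠ p : ℝ × Chart in 𝓝 (0, y), Q p.1 p.2 ≠ 0 :=
  h.eventually_mem hy isOpen_ne hq

lemma congr (h : HasJet Q q dq) (hq : ∀ y ∈ chartDomain, q y = p y)
    (hd : ∀ y ∈ chartDomain, dq y = dp y) : HasJet Q p dp := fun y hy => by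
  obtain ⟨h1, h2, h3⟩ := h y hy
  exact ⟨h1, h2.trans (hq y hy), hd y hy ▸ h3⟩

/-- Explicit formulas for the connection hold only while the leaf lies in `domain4`, hence only for
ε and the chart point near the given ones. Joint agreement near (0, y) is enough to transport a jet.
-/
lemma congr_fun (h : HasJet Q q dq)
    (hP : ∀ y ∈ chartDomain, ∀ᶠ z : ℝ × Chart in 𝓝 (0, y), P z.1 z.2 = Q z.1 z.2) :
    HasJet P q dq := fun y hy => by
  obtain ⟨h1, h2, h3⟩ := h y hy
  refine ⟨h1.congr_of_eventuallyEq (hP y hy), (hP y hy).self_of_nhds.trans h2, ?_⟩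
  refine h3.congr_of_eventuallyEq ?_
  have : Tendsto (fun ε : ℝ => (ε, y)) (𝓝 0) (𝓝 (0, y)) := by
    have : Continuous (fun ε : ℝ => (ε, y)) := by fun_prop
    exact this.tendsto 0
  exact this.eventually (hP y hy)

lemma of_contDiff {g : Chart → ℝ} (hg : ∀ y ∈ chartDomain, ContDiffAt ℝ ∞ g y) :
    HasJet (fun _ y => g y) g (fun _ => 0) := fun y hy =>
  ⟨(hg y hy).comp (0, y) contDiffAt_snd, rfl, hasDerivAt_const _ _⟩

lemma const (c : ℝ) : HasJet (fun _ _ => c) (fun _ => c) (fun _ => 0) :=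
  of_contDiff fun _ _ => contDiffAt_const

lemma eps_mul {g : Chart → ℝ} (hg : ∀ y ∈ chartDomain, ContDiffAt ℝ ∞ g y) :
    HasJet (fun ε y => ε * g y) (fun _ => 0) g := fun y hy =>
  ⟨contDiffAt_fst.mul ((hg y hy).comp (0, y) contDiffAt_snd), by simp,
    by simpa using (hasDerivAt_id (0 : ℝ)).mul_const (g y)⟩

lemma add (hQ : HasJet Q q dq) (hP : HasJet P p dp) :
    HasJet (fun ε y => Q ε y + P ε y) (fun y => q y + p y) (fun y => dq y + dp y) :=
  fun y hy => ⟨(hQ y hy).1.add (hP y hy).1, by simp only [hQ.value hy, hP.value hy],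
    (hQ.hasDerivAt hy).add (hP.hasDerivAt hy)⟩

lemma sub (hQ : HasJet Q q dq) (hP : HasJet P p dp) :
    HasJet (fun ε y => Q ε y - P ε y) (fun y => q y - p y) (fun y => dq y - dp y) :=
  fun y hy => ⟨(hQ y hy).1.sub (hP y hy).1, by simp only [hQ.value hy, hP.value hy],
    (hQ.hasDerivAt hy).sub (hP.hasDerivAt hy)⟩

lemma neg (hQ : HasJet Q q dq) :
    HasJet (fun ε y => -Q ε y) (fun y => -q y) (fun y => -dq y) :=
  fun y hy => ⟨(hQ y hy).1.neg, by simp only [hQ.value hy], (hQ.hasDerivAt hy).neg⟩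

lemma mul (hQ : HasJet Q q dq) (hP : HasJet P p dp) :
    HasJet (fun ε y => Q ε y * P ε y) (fun y => q y * p y)
      (fun y => dq y * p y + q y * dp y) :=
  fun y hy => ⟨(hQ y hy).1.mul (hP y hy).1, by simp only [hQ.value hy, hP.value hy], by
    have := (hQ.hasDerivAt hy).fun_mul (hP.hasDerivAt hy)
    rwa [hQ.value hy, hP.value hy] at this⟩

lemma const_mul (c : ℝ) (hQ : HasJet Q q dq) :
    HasJet (fun ε y => c * Q ε y) (fun y => c * q y) (fun y => c * dq y) :=
  ((const c).mul hQ).congr (fun _ _ => rfl) (fun _ _ => by ring)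

lemma comp {g : ℝ → ℝ} {g' : Chart → ℝ} (hQ : HasJet Q q dq)
    (hg : ∀ y ∈ chartDomain, ContDiffAt ℝ ∞ g (q y))
    (hg' : ∀ y ∈ chartDomain, HasDerivAt g (g' y) (q y)) :
    HasJet (fun ε y => g (Q ε y)) (fun y => g (q y)) (fun y => g' y * dq y) :=
  fun y hy => by
    have hv := hQ.value hy
    refine ⟨?_, by simp only [hv], ?_⟩
    · have h2 : ContDiffAt ℝ ∞ g ((fun p : ℝ × Chart => Q p.1 p.2) (0, y)) := by
        simpa [hv] using hg y hy
      exact h2.comp (0, y) (hQ y hy).1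
    · have h2 : HasDerivAt g (g' y) (Q 0 y) := by simpa [hv] using hg' y hy
      exact h2.comp 0 (hQ.hasDerivAt hy)

lemma inv (hQ : HasJet Q q dq) (h0 : ∀ y ∈ chartDomain, q y ≠ 0) :
    HasJet (fun ε y => (Q ε y)⁻¹) (fun y => (q y)⁻¹) (fun y => -dq y / q y ^ 2) :=
  (hQ.comp (g := fun x => x⁻¹) (fun y hy => contDiffAt_inv ℝ (h0 y hy))
    (fun y hy => hasDerivAt_inv (h0 y hy))).congr (fun _ _ => rfl) (fun _ _ => by ring)

lemma div (hQ : HasJet Q q dq) (hP : HasJet P p dp) (h0 : ∀ y ∈ chartDomain, p y ≠ 0) :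
    HasJet (fun ε y => Q ε y / P ε y) (fun y => q y / p y)
      (fun y => dq y / p y - q y * dp y / p y ^ 2) := by
  simpa only [div_eq_mul_inv] using (hQ.mul (hP.inv h0)).congr (p := fun y => q y * (p y)⁻¹)
    (dp := fun y => dq y * (p y)⁻¹ - q y * dp y * (p y ^ 2)⁻¹) (fun _ _ => rfl)
    (fun _ _ => by ring)

lemma pow (hQ : HasJet Q q dq) (n : ℕ) :
    HasJet (fun ε y => Q ε y ^ n) (fun y => q y ^ n) (fun y => n * q y ^ (n - 1) * dq y) :=
  hQ.comp (g := fun x => x ^ n) (fun _ _ => contDiffAt_id.pow n) (fun _ _ => hasDerivAt_pow n _)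

lemma sqrt (hQ : HasJet Q q dq) (h0 : ∀ y ∈ chartDomain, 0 < q y) :
    HasJet (fun ε y => √(Q ε y)) (fun y => √(q y)) (fun y => dq y / (2 * √(q y))) :=
  (hQ.comp (g := Real.sqrt) (fun y hy => Real.contDiffAt_sqrt (h0 y hy).ne')
    (fun y hy => Real.hasDerivAt_sqrt (h0 y hy).ne')).congr (fun _ _ => rfl)
    (fun _ _ => by ring)

/-- Composition with a function of two variables. -/
lemma comp₂ {G : ℝ × ℝ → ℝ} {a b : Chart → ℝ} (hQ : HasJet Q q dq) (hP : HasJet P p dp)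
    (hG : ∀ y ∈ chartDomain, ContDiffAt ℝ ∞ G (q y, p y))
    (ha : ∀ y ∈ chartDomain, HasDerivAt (fun s => G (s, p y)) (a y) (q y))
    (hb : ∀ y ∈ chartDomain, HasDerivAt (fun t => G (q y, t)) (b y) (p y)) :
    HasJet (fun ε y => G (Q ε y, P ε y)) (fun y => G (q y, p y))
      (fun y => a y * dq y + b y * dp y) := fun y hy => by
  have hv := hQ.value hy
  have hw := hP.value hy
  have hd : HasFDerivAt G (fderiv ℝ G (q y, p y)) (q y, p y) :=
    ((hG y hy).differentiableAt (by simp)).hasFDerivAt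
  have h1 : fderiv ℝ G (q y, p y) (1, 0) = a y := by
    have hc : HasDerivAt (fun s : ℝ => (s, p y)) (1, 0) (q y) :=
      (hasDerivAt_id _).prodMk (hasDerivAt_const _ _)
    exact (hd.comp_hasDerivAt (q y) hc).unique (ha y hy)
  have h2 : fderiv ℝ G (q y, p y) (0, 1) = b y := by
    have hc : HasDerivAt (fun t : ℝ => (q y, t)) (0, 1) (p y) :=
      (hasDerivAt_const _ _).prodMk (hasDerivAt_id _)
    exact (hd.comp_hasDerivAt (p y) hc).unique (hb y hy)
  refine ⟨?_, by simp only [hv, hw], ?_⟩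
  · have h3 : ContDiffAt ℝ ∞ G ((fun z : ℝ × Chart => (Q z.1 z.2, P z.1 z.2)) (0, y)) := by
      simpa [hv, hw] using hG y hy
    exact h3.comp (0, y) ((hQ y hy).1.prodMk (hP y hy).1)
  · have hc := (hQ.hasDerivAt hy).prodMk (hP.hasDerivAt hy)
    have hd' : HasFDerivAt G (fderiv ℝ G (q y, p y)) (Q 0 y, P 0 y) := by rwa [hv, hw]
    have := hd'.comp_hasDerivAt 0 hc
    refine this.congr_deriv ?_
    have e : (dq y, dp y) = dq y • ((1 : ℝ), (0 : ℝ)) + dp y • ((0 : ℝ), (1 : ℝ)) := by simp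
    rw [e, map_add, map_smul, map_smul, h1, h2]
    simp [mul_comm]

/-- A jet may be differentiated in the chart. -/
lemma pd (hQ : HasJet Q q dq) (i : Fin 2) :
    HasJet (fun ε y => CMAFoliation.pd i (Q ε) y) (fun y => CMAFoliation.pd i q y)
      (fun y => CMAFoliation.pd i dq y) := fun y hy => by
  set G : ℝ × Chart → ℝ := fun p => Q p.1 p.2 with hG
  set e : ℝ × Chart := (0, Pi.single i 1) with he
  have hs : ContDiffAt ℝ ∞ G (0, y) := hQ.contDiffAt hy
  have hs1 : ∀ᶠ z in 𝓝 ((0 : ℝ), y), ContDiffAt ℝ 1 G z :=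
    (hs.of_le (by simp)).eventually (by simp)
  have hpd : (fun z : ℝ × Chart => CMAFoliation.pd i (Q z.1) z.2) =ᶠ[𝓝 (0, y)]
      fun z => fderiv ℝ G z e := by
    filter_upwards [hs1] with z hz
    have hd : HasFDerivAt G (fderiv ℝ G z) (z.1, z.2) :=
      (hz.differentiableAt (by simp)).hasFDerivAt
    have hc : HasFDerivAt (fun w : Chart => (z.1, w)) (ContinuousLinearMap.inr ℝ ℝ Chart) z.2 :=
      hasFDerivAt_prodMk_right z.1 z.2
    have h1 := hd.comp z.2 hc
    have h2 := pd_eq_fderiv h1.differentiableAt i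
    rw [h1.fderiv] at h2
    exact h2
  have hfd : ContDiffAt ℝ ∞ (fderiv ℝ G) (0, y) := hs.fderiv_right (by simp)
  have hcurve : HasDerivAt (fun ε : ℝ => (ε, y)) ((1 : ℝ), (0 : Chart)) 0 :=
    (hasDerivAt_id _).prodMk (hasDerivAt_const _ _)
  refine ⟨(hfd.clm_apply contDiffAt_const).congr_of_eventuallyEq hpd, ?_, ?_⟩
  · exact pd_congr_on isOpen_chartDomain (fun z hz => hQ.value hz) hy i
  · have h1 : HasDerivAt (fun ε : ℝ => fderiv ℝ G (ε, y) e)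
        (fderiv ℝ (fderiv ℝ G) (0, y) (1, 0) e) 0 := by
      exact (hasFDerivAt_fderiv_apply hs e).comp_hasDerivAt (0 : ℝ) hcurve
    have h2 : (fun ε : ℝ => CMAFoliation.pd i (Q ε) y) =ᶠ[𝓝 0] fun ε => fderiv ℝ G (ε, y) e :=
      hcurve.continuousAt.tendsto.eventually hpd
    have h3 : CMAFoliation.pd i dq y = fderiv ℝ (fderiv ℝ G) (0, y) (1, 0) e := by
      have h4 : ∀ z ∈ chartDomain, dq z = fderiv ℝ G (0, z) (1, 0) := fun z hz => by
        have hd : HasFDerivAt G (fderiv ℝ G (0, z)) (0, z) :=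
          ((hQ.contDiffAt hz).differentiableAt (by simp)).hasFDerivAt
        have hc : HasDerivAt (fun ε : ℝ => (ε, z)) ((1 : ℝ), (0 : Chart)) 0 :=
          (hasDerivAt_id _).prodMk (hasDerivAt_const _ _)
        have h5 := hd.comp_hasDerivAt (0 : ℝ) hc
        exact (hQ.hasDerivAt hz).unique h5
      rw [pd_congr_on isOpen_chartDomain h4 hy i]
      have hc : HasFDerivAt (fun w : Chart => ((0 : ℝ), w))
          (ContinuousLinearMap.inr ℝ ℝ Chart) y := hasFDerivAt_prodMk_right 0 y
      have h5 := (hasFDerivAt_fderiv_apply hs ((1 : ℝ), (0 : Chart))).comp y hc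
      have h6 := pd_eq_fderiv h5.differentiableAt i
      rw [h5.fderiv] at h6
      refine h6.trans ?_
      -- Symmetry of the second derivative of the joint function exchanges ∂_ε and ∂_i.
      have hsym := (hs.isSymmSndFDerivAt (by simpa using two_le_infty)).eq e (1, 0)
      simpa using hsym
    simp only [h3]
    exact h1.congr_of_eventuallyEq h2

end HasJet

/-! ### The radius function and the lapse of the double null coordinates -/

/-- The function `(r - r₀) exp (r / r₀)` that the radius inverts. -/
def radial (r₀ r : ℝ) : ℝ := (r - r₀) * exp (r / r₀)

/-- The part of the `(s, s̲)`-plane covered by the double null coordinates. -/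
def region (r₀ : ℝ) : Set (ℝ × ℝ) := {q | -r₀ < q.1 ∧ -r₀ < q.1 * exp ((q.2 + q.1 + r₀) / r₀)}

lemma isOpen_region (r₀ : ℝ) : IsOpen (region r₀) := by
  have h : Continuous fun q : ℝ × ℝ => q.1 * exp ((q.2 + q.1 + r₀) / r₀) := by fun_prop
  exact (isOpen_lt continuous_const continuous_fst).inter (isOpen_lt continuous_const h)


lemma mem_region_of_nonneg {r₀ : ℝ} (hr₀ : 0 < r₀) {s : ℝ} (hs : 0 ≤ s) (t : ℝ) : (s, t) ∈ region r₀ := by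
  refine ⟨by simp; linarith, ?_⟩
  have : 0 ≤ s * exp ((t + s + r₀) / r₀) := by positivity
  simp only; linarith

lemma hasDerivAt_radial {r₀ : ℝ} (hr₀ : 0 < r₀) (r : ℝ) : HasDerivAt (radial r₀) (r / r₀ * exp (r / r₀)) r := by
  have h1 : HasDerivAt (fun r => r - r₀) 1 r := (hasDerivAt_id r).sub_const r₀
  have h2 : HasDerivAt (fun r => exp (r / r₀)) (exp (r / r₀) * (1 / r₀)) r :=
    ((hasDerivAt_id r).div_const r₀).exp
  refine (h1.mul h2).congr_deriv ?_
  field_simp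
  ring

lemma contDiff_radial (r₀ : ℝ) : ContDiff ℝ ∞ (radial r₀) := by
  unfold radial; fun_prop

lemma strictMonoOn_radial {r₀ : ℝ} (hr₀ : 0 < r₀) : StrictMonoOn (radial r₀) (Ioi 0) := by
  refine strictMonoOn_of_deriv_pos (convex_Ioi 0) (contDiff_radial r₀).continuous.continuousOn ?_
  intro x hx
  rw [interior_Ioi] at hx
  rw [(hasDerivAt_radial hr₀ x).deriv]
  have : 0 < x := hx
  positivity

/-- The bound -r₀ is the value of `radial` at r = 0, the singularity; above it the intermediate
value theorem applies. -/
lemma exists_radial_eq {r₀ : ℝ} (hr₀ : 0 < r₀) {z : ℝ} (hz : -r₀ < z) : ∃ r ∈ Ioi (0 : ℝ), radial r₀ r = z := by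
  have h0 : radial r₀ 0 = -r₀ := by simp [radial]
  have hM : ∃ M, 0 < M ∧ z ≤ radial r₀ M := by
    -- At r = r₀ + |z| the first factor is |z| and the exponential is at least 1.
    refine ⟨r₀ + |z|, by positivity, ?_⟩
    have h1 : 1 ≤ exp ((r₀ + |z|) / r₀) := one_le_exp (by positivity)
    simp only [radial, add_sub_cancel_left]
    nlinarith [le_abs_self z, abs_nonneg z]
  obtain ⟨M, hM0, hM1⟩ := hM
  have := intermediate_value_Icc hM0.le (contDiff_radial r₀).continuous.continuousOn
  obtain ⟨r, hr, hr'⟩ := this ⟨by rw [h0]; exact hz.le, hM1⟩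
  refine ⟨r, ?_, hr'⟩
  rcases hr.1.lt_or_eq with h | h
  · exact h
  · exfalso; rw [← h, h0] at hr'; linarith

lemma schwR_spec {r₀ : ℝ} (hr₀ : 0 < r₀) {s t : ℝ} (h : (s, t) ∈ region r₀) :
    0 < schwR r₀ s t ∧ radial r₀ (schwR r₀ s t) = s * exp ((t + s + r₀) / r₀) := by
  have hex := exists_radial_eq hr₀ h.2
  exact ⟨Function.invFunOn_mem hex, Function.invFunOn_eq hex⟩

lemma schwR_pos {r₀ : ℝ} (hr₀ : 0 < r₀) {s t : ℝ} (h : (s, t) ∈ region r₀) : 0 < schwR r₀ s t := (schwR_spec hr₀ h).1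

lemma schwR_eq_of_radial_eq {r₀ : ℝ} (hr₀ : 0 < r₀) {s t r : ℝ} (hr : 0 < r)
    (h : radial r₀ r = s * exp ((t + s + r₀) / r₀)) : schwR r₀ s t = r := by
  have hex : ∃ a ∈ Ioi (0 : ℝ), radial r₀ a = s * exp ((t + s + r₀) / r₀) := ⟨r, hr, h⟩
  refine (strictMonoOn_radial hr₀).injOn (Function.invFunOn_mem hex) hr ?_
  rw [h]
  exact Function.invFunOn_eq hex

lemma schwR_zero {r₀ : ℝ} (hr₀ : 0 < r₀) {s : ℝ} (hs : -r₀ < s) : schwR r₀ s 0 = r₀ + s :=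
  schwR_eq_of_radial_eq hr₀ (by linarith) (by simp [radial, add_comm])

lemma omegaSq_zero {r₀ : ℝ} (hr₀ : 0 < r₀) {s : ℝ} (hs : -r₀ < s) : omegaSq r₀ s 0 = 1 := by
  have : r₀ + s ≠ 0 := by linarith
  simp [omegaSq, schwR_zero hr₀ hs, add_comm s r₀, this]

/-- The derivative of `radial` is positive at every r > 0, so a smooth local inverse exists. It
takes positive values, and injectivity of `radial` there identifies it with the globally chosen
inverse `schwR`. -/
lemma contDiffAt_schwR {r₀ : ℝ} (hr₀ : 0 < r₀) {s t : ℝ} (h : (s, t) ∈ region r₀) :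
    ContDiffAt ℝ ∞ (fun q : ℝ × ℝ => schwR r₀ q.1 q.2) (s, t) := by
  set r := schwR r₀ s t with hr
  obtain ⟨hpos, hrad⟩ := schwR_spec hr₀ h
  rw [← hr] at hpos hrad
  have hd : r / r₀ * exp (r / r₀) ≠ 0 := by positivity
  have hc : ContDiffAt ℝ ∞ (radial r₀) r := (contDiff_radial r₀).contDiffAt
  have hf : HasFDerivAt (radial r₀)
      (ContinuousLinearEquiv.unitsEquivAut ℝ (Units.mk0 _ hd) : ℝ →L[ℝ] ℝ) r := by
    refine (hasDerivAt_radial hr₀ r).hasFDerivAt.congr_fderiv ?_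
    ext; simp
  have hinv := hc.to_localInverse hf (by simp)
  set g := hc.localInverse hf (by simp) with hg
  have hmap : ContDiffAt ℝ ∞ (fun q : ℝ × ℝ => q.1 * exp ((q.2 + q.1 + r₀) / r₀)) (s, t) := by
    fun_prop
  have hcomp : ContDiffAt ℝ ∞ (fun q : ℝ × ℝ => g (q.1 * exp ((q.2 + q.1 + r₀) / r₀))) (s, t) := by
    refine ContDiffAt.comp (s, t) ?_ hmap
    rw [← hrad]
    exact hinv
  refine hcomp.congr_of_eventuallyEq ?_
  have hz : ∀ᶠ z in 𝓝 (radial r₀ r), radial r₀ (g z) = z ∧ 0 < g z := by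
    have h1 : ∀ᶠ z in 𝓝 (radial r₀ r), radial r₀ (g z) = z :=
      (hc.hasStrictFDerivAt' hf (by simp)).eventually_right_inverse
    have h2 : g (radial r₀ r) = r := hc.localInverse_apply_image hf (by simp)
    have h3 : ∀ᶠ z in 𝓝 (radial r₀ r), g z ∈ Ioi (0 : ℝ) :=
      hinv.continuousAt.eventually_mem (isOpen_Ioi.mem_nhds (by rw [h2]; exact hpos))
    exact h1.and h3
  have hz' : ∀ᶠ q : ℝ × ℝ in 𝓝 (s, t), radial r₀ (g (q.1 * exp ((q.2 + q.1 + r₀) / r₀))) =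
      q.1 * exp ((q.2 + q.1 + r₀) / r₀) ∧ 0 < g (q.1 * exp ((q.2 + q.1 + r₀) / r₀)) := by
    have := hmap.continuousAt.tendsto
    simp only [← hrad] at this
    exact this.eventually hz
  filter_upwards [hz'] with q hq
  exact schwR_eq_of_radial_eq hr₀ hq.2 hq.1

lemma contDiffAt_omegaSq {r₀ : ℝ} (hr₀ : 0 < r₀) {s t : ℝ} (h : (s, t) ∈ region r₀) :
    ContDiffAt ℝ ∞ (fun q : ℝ × ℝ => omegaSq r₀ q.1 q.2) (s, t) := by
  have hR := contDiffAt_schwR hr₀ h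
  have hpos := schwR_pos hr₀ h
  unfold omegaSq
  refine ContDiffAt.mul (ContDiffAt.div (by fun_prop) hR hpos.ne') (ContDiffAt.exp ?_)
  exact ContDiffAt.div_const (by fun_prop) _

lemma omegaSq_pos {r₀ : ℝ} (hr₀ : 0 < r₀) {s t : ℝ} (h : (s, t) ∈ region r₀) : 0 < omegaSq r₀ s t := by
  have hpos := schwR_pos hr₀ h
  have : 0 < s + r₀ := by have := h.1; simp only at this; linarith
  unfold omegaSq; positivity

/-- Implicit differentiation of the defining equation of r. The result is the formula for Ω² once
the exponential is split as below. -/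
lemma hasDerivAt_schwR_left {r₀ : ℝ} (hr₀ : 0 < r₀) {s t : ℝ} (h : (s, t) ∈ region r₀) :
    HasDerivAt (fun σ => schwR r₀ σ t) (omegaSq r₀ s t) s := by
  have hd : DifferentiableAt ℝ (fun σ => schwR r₀ σ t) s :=
    DifferentiableAt.comp (f := fun σ : ℝ => (σ, t)) (g := fun q : ℝ × ℝ => schwR r₀ q.1 q.2) s
      ((contDiffAt_schwR hr₀ h).differentiableAt (by simp)) (by fun_prop)
  refine hd.hasDerivAt.congr_deriv ?_
  have h1 := (hasDerivAt_radial hr₀ (schwR r₀ s t)).comp s hd.hasDerivAt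
  have h2 : HasDerivAt (fun σ : ℝ => σ * exp ((t + σ + r₀) / r₀))
      (1 * exp ((t + s + r₀) / r₀) + s * (exp ((t + s + r₀) / r₀) * (1 / r₀))) s :=
    (hasDerivAt_id s).mul ((((hasDerivAt_id s).const_add t).add_const r₀).div_const r₀).exp
  have h3 : (radial r₀ ∘ fun σ => schwR r₀ σ t) =ᶠ[𝓝 s]
      fun σ : ℝ => σ * exp ((t + σ + r₀) / r₀) := by
    have : ∀ᶠ σ in 𝓝 s, (σ, t) ∈ region r₀ :=
      (Continuous.tendsto (f := fun σ : ℝ => (σ, t)) (by fun_prop) s).eventually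
        ((isOpen_region r₀).mem_nhds h)
    filter_upwards [this] with σ hσ using (schwR_spec hr₀ hσ).2
  have h4 := h1.unique (h2.congr_of_eventuallyEq h3)
  have hpos := schwR_pos hr₀ h
  have e : exp ((t + s + r₀ - schwR r₀ s t) / r₀) * exp (schwR r₀ s t / r₀) =
      exp ((t + s + r₀) / r₀) := by
    rw [← exp_add]; congr 1; field_simp; ring
  rw [← e] at h4
  unfold omegaSq
  have he := exp_pos (schwR r₀ s t / r₀)
  field_simp at h4 ⊢
  linear_combination h4

/-- Implicit differentiation again: the right side of the defining equation is exponential in s̲, so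
its derivative is itself divided by r₀, and the equation turns it back into (r - r₀) e^{r/r₀} / r₀.
-/
lemma hasDerivAt_schwR_right {r₀ : ℝ} (hr₀ : 0 < r₀) {s t : ℝ} (h : (s, t) ∈ region r₀) :
    HasDerivAt (fun τ => schwR r₀ s τ) (1 - r₀ / schwR r₀ s t) t := by
  have hd : DifferentiableAt ℝ (fun τ => schwR r₀ s τ) t :=
    DifferentiableAt.comp (f := fun τ : ℝ => (s, τ)) (g := fun q : ℝ × ℝ => schwR r₀ q.1 q.2) t
      ((contDiffAt_schwR hr₀ h).differentiableAt (by simp)) (by fun_prop)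
  refine hd.hasDerivAt.congr_deriv ?_
  have h1 := (hasDerivAt_radial hr₀ (schwR r₀ s t)).comp t hd.hasDerivAt
  have h2 : HasDerivAt (fun τ : ℝ => s * exp ((τ + s + r₀) / r₀))
      (s * (exp ((t + s + r₀) / r₀) * (1 / r₀))) t :=
    ((((hasDerivAt_id t).add_const s).add_const r₀).div_const r₀).exp.const_mul s
  have h3 : (radial r₀ ∘ fun τ => schwR r₀ s τ) =ᶠ[𝓝 t]
      fun τ : ℝ => s * exp ((τ + s + r₀) / r₀) := by
    have : ∀ᶠ τ in 𝓝 t, (s, τ) ∈ region r₀ :=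
      (Continuous.tendsto (f := fun τ : ℝ => (s, τ)) (by fun_prop) t).eventually
        ((isOpen_region r₀).mem_nhds h)
    filter_upwards [this] with σ hσ using (schwR_spec hr₀ hσ).2
  have h4 := h1.unique (h2.congr_of_eventuallyEq h3)
  obtain ⟨hpos, hrad⟩ := schwR_spec hr₀ h
  rw [← mul_assoc, ← hrad] at h4
  unfold radial at h4
  have he := exp_pos (schwR r₀ s t / r₀)
  field_simp at h4 ⊢
  linear_combination h4

lemma hasDerivAt_omegaSq_right {r₀ : ℝ} (hr₀ : 0 < r₀) {s t : ℝ} (h : (s, t) ∈ region r₀) :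
    HasDerivAt (fun τ => omegaSq r₀ s τ) (omegaSq r₀ s t * (r₀ / schwR r₀ s t ^ 2)) t := by
  have hR := hasDerivAt_schwR_right hr₀ h
  have hpos := schwR_pos hr₀ h
  have h1 := ((hasDerivAt_const t (s + r₀)).div hR hpos.ne').mul
    ((((((hasDerivAt_id t).add_const s).add_const r₀).sub hR).div_const r₀).exp)
  refine h1.congr_deriv ?_
  simp only [omegaSq, id, Pi.div_apply, Pi.sub_apply]
  generalize exp ((t + s + r₀ - schwR r₀ s t) / r₀) = e
  field_simp
  ring

/-- `∂_s log Ω²`. -/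
def logOmegaS (r₀ s t : ℝ) : ℝ :=
  1 / (s + r₀) + 1 / r₀ - omegaSq r₀ s t * (1 / schwR r₀ s t + 1 / r₀)

lemma hasDerivAt_omegaSq_left {r₀ : ℝ} (hr₀ : 0 < r₀) {s t : ℝ} (h : (s, t) ∈ region r₀) :
    HasDerivAt (fun σ => omegaSq r₀ σ t) (omegaSq r₀ s t * logOmegaS r₀ s t) s := by
  have hR := hasDerivAt_schwR_left hr₀ h
  have hpos := schwR_pos hr₀ h
  have hs : 0 < s + r₀ := by have := h.1; simp only at this; linarith
  have h1 := (((hasDerivAt_id s).add_const r₀).div hR hpos.ne').mul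
    ((((((hasDerivAt_id s).const_add t).add_const r₀).sub hR).div_const r₀).exp)
  refine h1.congr_deriv ?_
  simp only [logOmegaS, omegaSq, id, Pi.div_apply, Pi.sub_apply]
  generalize exp ((t + s + r₀ - schwR r₀ s t) / r₀) = e
  field_simp
  ring

lemma contDiffAt_logOmegaS {r₀ : ℝ} (hr₀ : 0 < r₀) {s t : ℝ} (h : (s, t) ∈ region r₀) :
    ContDiffAt ℝ ∞ (fun q : ℝ × ℝ => logOmegaS r₀ q.1 q.2) (s, t) := by
  have hR := contDiffAt_schwR hr₀ h
  have hW := contDiffAt_omegaSq hr₀ h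
  have hpos := schwR_pos hr₀ h
  have hs : s + r₀ ≠ 0 := by have := h.1; simp only at this; linarith
  unfold logOmegaS
  refine ContDiffAt.sub (ContDiffAt.add (ContDiffAt.div contDiffAt_const (by fun_prop) hs)
    contDiffAt_const) (hW.mul (ContDiffAt.add (ContDiffAt.div contDiffAt_const hR hpos.ne')
    contDiffAt_const))

/-! ### The Levi-Civita connection of the Schwarzschild metric -/

/-- The domain of the coordinates `(s, s̲, θ, φ)`. -/
def domain4 (r₀ : ℝ) : Set (Fin 4 → ℝ) := {x | (x 0, x 1) ∈ region r₀ ∧ sin (x 2) ≠ 0}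

lemma isOpen_domain4 (r₀ : ℝ) : IsOpen (domain4 r₀) := by
  have h : Continuous fun x : Fin 4 → ℝ => (x 0, x 1) := by fun_prop
  have h' : Continuous fun x : Fin 4 → ℝ => sin (x 2) := by fun_prop
  exact ((isOpen_region r₀).preimage h).inter (isOpen_ne.preimage h')

lemma schwarzschild_inv {r₀ : ℝ} (hr₀ : 0 < r₀) {x : Fin 4 → ℝ} (hx : x ∈ domain4 r₀) :
    (schwarzschild r₀ x)⁻¹ =
      !![0, (2 * omegaSq r₀ (x 0) (x 1))⁻¹, 0, 0;
         (2 * omegaSq r₀ (x 0) (x 1))⁻¹, 0, 0, 0;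
         0, 0, (schwR r₀ (x 0) (x 1) ^ 2)⁻¹, 0;
         0, 0, 0, (schwR r₀ (x 0) (x 1) ^ 2 * sin (x 2) ^ 2)⁻¹] := by
  have hR := (schwR_pos hr₀ hx.1).ne'
  have hW := (omegaSq_pos hr₀ hx.1).ne'
  have hs := hx.2
  refine Matrix.inv_eq_right_inv ?_
  unfold schwarzschild
  generalize schwR r₀ (x 0) (x 1) = R at *
  generalize omegaSq r₀ (x 0) (x 1) = W at *
  generalize sin (x 2) = S at *
  ext i j
  fin_cases i <;> fin_cases j <;> simp [Matrix.mul_apply, Fin.sum_univ_four] <;> field_simp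

lemma pd_radial_one (g : ℝ → ℝ → ℝ) {x : Fin 4 → ℝ} {d : ℝ}
    (h : HasDerivAt (fun τ => g (x 0) τ) d (x 1)) :
    pd 1 (fun z : Fin 4 → ℝ => g (z 0) (z 1)) x = d := by
  simpa [pd] using h.deriv

lemma pd_radial_two (g : ℝ → ℝ → ℝ) (x : Fin 4 → ℝ) :
    pd 2 (fun z : Fin 4 → ℝ => g (z 0) (z 1)) x = 0 := by
  simp [pd]

lemma pd_radial_three (g : ℝ → ℝ → ℝ) (x : Fin 4 → ℝ) :
    pd 3 (fun z : Fin 4 → ℝ => g (z 0) (z 1)) x = 0 := by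
  simp [pd]

/-- The partial derivatives `∂_l g_ij` of the Schwarzschild metric. -/
def schwDeriv (r₀ : ℝ) (x : Fin 4 → ℝ) (l i j : Fin 4) : ℝ :=
  let R := schwR r₀ (x 0) (x 1)
  let W := omegaSq r₀ (x 0) (x 1)
  let S := sin (x 2)
  let D := logOmegaS r₀ (x 0) (x 1)
  match l, i, j with
  | 0, 0, 1 | 0, 1, 0 => 2 * (W * D)
  | 0, 2, 2 => 2 * R * W
  | 0, 3, 3 => 2 * R * W * S ^ 2
  | 1, 0, 1 | 1, 1, 0 => 2 * (W * (r₀ / R ^ 2))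
  | 1, 2, 2 => 2 * (R - r₀)
  | 1, 3, 3 => 2 * (R - r₀) * S ^ 2
  | 2, 3, 3 => R ^ 2 * (2 * S * cos (x 2))
  | _, _, _ => 0

lemma pd_schwarzschild {r₀ : ℝ} (hr₀ : 0 < r₀) {x : Fin 4 → ℝ} (hx : x ∈ domain4 r₀)
    (l i j : Fin 4) : pd l (fun z => schwarzschild r₀ z i j) x = schwDeriv r₀ x l i j := by
  have hpos := schwR_pos hr₀ hx.1
  have hRs := hasDerivAt_schwR_left hr₀ hx.1
  have hRt := hasDerivAt_schwR_right hr₀ hx.1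
  have hWs := hasDerivAt_omegaSq_left hr₀ hx.1
  have hWt := hasDerivAt_omegaSq_right hr₀ hx.1
  have hRs2 := (hRs.pow 2).deriv
  have hRt2 := (hRt.pow 2).deriv
  have e : 2 * schwR r₀ (x 0) (x 1) * (1 - r₀ / schwR r₀ (x 0) (x 1)) =
      2 * (schwR r₀ (x 0) (x 1) - r₀) := by field_simp
  simp only [Pi.pow_def, Nat.cast_ofNat, Nat.add_one_sub_one, pow_one] at *
  rw [e] at hRt2
  fin_cases l <;> fin_cases i <;> fin_cases j <;>
    simp [pd, schwarzschild, schwDeriv] <;>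
    first
      | exact hWs.deriv
      | exact hWt.deriv
      | exact hRs2
      | exact hRt2
      | exact Or.inl hRs2
      | exact Or.inl hRt2

/-- The Christoffel symbols `Γ^k_ij` of the Schwarzschild metric. -/
def schwGamma (r₀ : ℝ) (x : Fin 4 → ℝ) (k i j : Fin 4) : ℝ :=
  let R := schwR r₀ (x 0) (x 1)
  let W := omegaSq r₀ (x 0) (x 1)
  let S := sin (x 2)
  match k, i, j with
  | 0, 0, 0 => logOmegaS r₀ (x 0) (x 1)
  | 0, 2, 2 => -(R - r₀) / (2 * W)
  | 0, 3, 3 => -(R - r₀) / (2 * W) * S ^ 2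
  | 1, 1, 1 => r₀ / R ^ 2
  | 1, 2, 2 => -R / 2
  | 1, 3, 3 => -R / 2 * S ^ 2
  | 2, 0, 2 | 2, 2, 0 | 3, 0, 3 | 3, 3, 0 => W / R
  | 2, 1, 2 | 2, 2, 1 | 3, 1, 3 | 3, 3, 1 => (R - r₀) / R ^ 2
  | 2, 3, 3 => -(S * cos (x 2))
  | 3, 2, 3 | 3, 3, 2 => cos (x 2) / S
  | _, _, _ => 0

set_option maxHeartbeats 1600000 in
lemma christoffel_schwarzschild {r₀ : ℝ} (hr₀ : 0 < r₀) {x : Fin 4 → ℝ} (hx : x ∈ domain4 r₀)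
    (k i j : Fin 4) : christoffel (schwarzschild r₀) x k i j = schwGamma r₀ x k i j := by
  have hR := (schwR_pos hr₀ hx.1).ne'
  have hW := (omegaSq_pos hr₀ hx.1).ne'
  have hs := hx.2
  simp only [christoffel, schwarzschild_inv hr₀ hx, pd_schwarzschild hr₀ hx, Fin.sum_univ_four]
  unfold schwDeriv schwGamma
  generalize schwR r₀ (x 0) (x 1) = R at *
  generalize omegaSq r₀ (x 0) (x 1) = W at *
  generalize logOmegaS r₀ (x 0) (x 1) = D at *
  generalize sin (x 2) = S at *
  generalize cos (x 2) = T at *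
  fin_cases k <;> simp <;> fin_cases i <;> fin_cases j <;> simp <;> field_simp <;> try ring

lemma contDiffAt_schwGamma {r₀ : ℝ} (hr₀ : 0 < r₀) {x : Fin 4 → ℝ} (hx : x ∈ domain4 r₀)
    (k i j : Fin 4) : ContDiffAt ℝ ∞ (fun z => schwGamma r₀ z k i j) x := by
  have hR := (schwR_pos hr₀ hx.1).ne'
  have hW := (omegaSq_pos hr₀ hx.1).ne'
  have hs := hx.2
  have hpr : ContDiffAt ℝ ∞ (fun z : Fin 4 → ℝ => (z 0, z 1)) x := by fun_prop
  have hRc : ContDiffAt ℝ ∞ (fun z : Fin 4 → ℝ => schwR r₀ (z 0) (z 1)) x :=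
    ContDiffAt.comp (g := fun q : ℝ × ℝ => schwR r₀ q.1 q.2) x (contDiffAt_schwR hr₀ hx.1) hpr
  have hWc : ContDiffAt ℝ ∞ (fun z : Fin 4 → ℝ => omegaSq r₀ (z 0) (z 1)) x :=
    ContDiffAt.comp (g := fun q : ℝ × ℝ => omegaSq r₀ q.1 q.2) x (contDiffAt_omegaSq hr₀ hx.1) hpr
  have hDc : ContDiffAt ℝ ∞ (fun z : Fin 4 → ℝ => logOmegaS r₀ (z 0) (z 1)) x :=
    ContDiffAt.comp (g := fun q : ℝ × ℝ => logOmegaS r₀ q.1 q.2) x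
      (contDiffAt_logOmegaS hr₀ hx.1) hpr
  have hSc : ContDiffAt ℝ ∞ (fun z : Fin 4 → ℝ => sin (z 2)) x := by fun_prop
  have hTc : ContDiffAt ℝ ∞ (fun z : Fin 4 → ℝ => cos (z 2)) x := by fun_prop
  have ha : ContDiffAt ℝ ∞ (fun z : Fin 4 → ℝ => -(schwR r₀ (z 0) (z 1) - r₀) /
      (2 * omegaSq r₀ (z 0) (z 1))) x :=
    (hRc.sub contDiffAt_const).neg.div (contDiffAt_const.mul hWc) (by positivity)
  have ha' : ContDiffAt ℝ ∞ (fun z : Fin 4 → ℝ => -(schwR r₀ (z 0) (z 1) - r₀) /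
      (2 * omegaSq r₀ (z 0) (z 1)) * sin (z 2) ^ 2) x := ha.mul (hSc.pow 2)
  have hb : ContDiffAt ℝ ∞ (fun z : Fin 4 → ℝ => -schwR r₀ (z 0) (z 1) / 2) x :=
    hRc.neg.div_const 2
  have hb' : ContDiffAt ℝ ∞ (fun z : Fin 4 → ℝ => -schwR r₀ (z 0) (z 1) / 2 * sin (z 2) ^ 2) x :=
    hb.mul (hSc.pow 2)
  have hc : ContDiffAt ℝ ∞ (fun z : Fin 4 → ℝ => r₀ / schwR r₀ (z 0) (z 1) ^ 2) x :=
    contDiffAt_const.div (hRc.pow 2) (by positivity)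
  have hd : ContDiffAt ℝ ∞ (fun z : Fin 4 → ℝ =>
      omegaSq r₀ (z 0) (z 1) / schwR r₀ (z 0) (z 1)) x := hWc.div hRc hR
  have hq : ContDiffAt ℝ ∞ (fun z : Fin 4 → ℝ =>
      (schwR r₀ (z 0) (z 1) - r₀) / schwR r₀ (z 0) (z 1) ^ 2) x :=
    (hRc.sub contDiffAt_const).div (hRc.pow 2) (by positivity)
  have he : ContDiffAt ℝ ∞ (fun z : Fin 4 → ℝ => -(sin (z 2) * cos (z 2))) x := (hSc.mul hTc).neg
  have hf : ContDiffAt ℝ ∞ (fun z : Fin 4 → ℝ => cos (z 2) / sin (z 2)) x := hTc.div hSc hs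
  fin_cases k <;> fin_cases i <;> fin_cases j <;> first | exact contDiffAt_const | assumption

lemma contDiffAt_christoffel_schwarzschild {r₀ : ℝ} (hr₀ : 0 < r₀) {x : Fin 4 → ℝ}
    (hx : x ∈ domain4 r₀) (k i j : Fin 4) :
    ContDiffAt ℝ ∞ (fun z => christoffel (schwarzschild r₀) z k i j) x :=
  (contDiffAt_schwGamma hr₀ hx k i j).congr_of_eventuallyEq
    (Filter.eventuallyEq_of_mem ((isOpen_domain4 r₀).mem_nhds hx)
      fun _ hz => christoffel_schwarzschild hr₀ hz k i j)

lemma contDiffAt_schwarzschild {r₀ : ℝ} (hr₀ : 0 < r₀) {x : Fin 4 → ℝ}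
    (hx : x ∈ domain4 r₀) (i j : Fin 4) :
    ContDiffAt ℝ ∞ (fun z => schwarzschild r₀ z i j) x := by
  have hpr : ContDiffAt ℝ ∞ (fun z : Fin 4 → ℝ => (z 0, z 1)) x := by fun_prop
  have hRc : ContDiffAt ℝ ∞ (fun z : Fin 4 → ℝ => schwR r₀ (z 0) (z 1) ^ 2) x :=
    (ContDiffAt.comp (g := fun q : ℝ × ℝ => schwR r₀ q.1 q.2) x
      (contDiffAt_schwR hr₀ hx.1) hpr).pow 2
  have hWc : ContDiffAt ℝ ∞ (fun z : Fin 4 → ℝ => 2 * omegaSq r₀ (z 0) (z 1)) x :=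
    contDiffAt_const.mul (ContDiffAt.comp (g := fun q : ℝ × ℝ => omegaSq r₀ q.1 q.2) x
      (contDiffAt_omegaSq hr₀ hx.1) hpr)
  have hRS : ContDiffAt ℝ ∞ (fun z : Fin 4 → ℝ => schwR r₀ (z 0) (z 1) ^ 2 * sin (z 2) ^ 2) x :=
    hRc.mul (by fun_prop)
  fin_cases i <;> fin_cases j <;> first | exact contDiffAt_const | assumption

lemma contDiffAt_riemann_schwarzschild {r₀ : ℝ} (hr₀ : 0 < r₀) {x : Fin 4 → ℝ}
    (hx : x ∈ domain4 r₀) (a b c d : Fin 4) :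
    ContDiffAt ℝ ∞ (fun z => riemann (schwarzschild r₀) z a b c d) x := by
  have hΓ := fun k i j => contDiffAt_christoffel_schwarzschild hr₀ hx k i j
  unfold riemann
  refine ContDiffAt.sum fun e _ => (contDiffAt_schwarzschild hr₀ hx d e).mul ?_
  refine ((contDiffAt_pd (hΓ e b c) a).sub (contDiffAt_pd (hΓ e a c) b)).add ?_
  exact ContDiffAt.sum fun k _ => ((hΓ e a k).mul (hΓ k b c)).sub ((hΓ e b k).mul (hΓ k a c))

/-! ### Curvature components of Schwarzschild in the null directions. -/

lemma hasDerivAt_logOmegaS_right {r₀ : ℝ} (hr₀ : 0 < r₀) {s t : ℝ} (h : (s, t) ∈ region r₀) :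
    HasDerivAt (fun τ => logOmegaS r₀ s τ) (-2 * r₀ * omegaSq r₀ s t / schwR r₀ s t ^ 3) t := by
  have hR := hasDerivAt_schwR_right hr₀ h
  have hW := hasDerivAt_omegaSq_right hr₀ h
  have hpos := schwR_pos hr₀ h
  have h1 := (hW.mul (((hasDerivAt_const t (1 : ℝ)).div hR hpos.ne').add_const (1 / r₀))).const_sub
    (1 / (s + r₀) + 1 / r₀)
  refine h1.congr_deriv ?_
  simp only [Pi.div_apply]
  field_simp
  ring

lemma riemann_eq_of_mem {r₀ : ℝ} (hr₀ : 0 < r₀) {x : Fin 4 → ℝ}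
    (hx : x ∈ domain4 r₀) (a b c d : Fin 4) :
    riemann (schwarzschild r₀) x a b c d = ∑ e, schwarzschild r₀ x d e *
    (pd a (fun z => schwGamma r₀ z e b c) x - pd b (fun z => schwGamma r₀ z e a c) x
      + ∑ k, (schwGamma r₀ x e a k * schwGamma r₀ x k b c
          - schwGamma r₀ x e b k * schwGamma r₀ x k a c)) := by
  have h : ∀ a e b c, pd a (fun z => christoffel (schwarzschild r₀) z e b c) x =
      pd a (fun z => schwGamma r₀ z e b c) x := fun a e b c =>
    pd_congr_on (isOpen_domain4 r₀) (fun z hz => christoffel_schwarzschild hr₀ hz e b c) hx a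
  simp only [riemann, h, christoffel_schwarzschild hr₀ hx]

/-- The only surviving term is 2Ω² ∂_{s̲} Γ⁰₀₀, where Γ⁰₀₀ is the s-derivative of log Ω². This is
the component that gives ρ = -r₀/r³. -/
lemma riemann_tsst {r₀ : ℝ} (hr₀ : 0 < r₀) {x : Fin 4 → ℝ} (hx : x ∈ domain4 r₀) :
    riemann (schwarzschild r₀) x 1 0 0 1 =
      -4 * r₀ * omegaSq r₀ (x 0) (x 1) ^ 2 / schwR r₀ (x 0) (x 1) ^ 3 := by
  have h := pd_radial_one (logOmegaS r₀) (hasDerivAt_logOmegaS_right hr₀ hx.1)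
  rw [riemann_eq_of_mem hr₀ hx]
  simp [Fin.sum_univ_four, schwGamma, schwarzschild, pd_const, h]
  ring

-- By spherical symmetry, components with a single angular index vanish. Tilting the null frame by
-- first-order angular components therefore does not change ρ to first order.
set_option maxHeartbeats 800000 in
lemma riemann_single_angular {r₀ : ℝ} (hr₀ : 0 < r₀) {x : Fin 4 → ℝ} (hx : x ∈ domain4 r₀)
    {i : Fin 4} (hi : i = 2 ∨ i = 3) :
    riemann (schwarzschild r₀) x i 0 0 1 = 0 ∧ riemann (schwarzschild r₀) x 1 i 0 1 = 0 ∧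
    riemann (schwarzschild r₀) x 1 0 i 1 = 0 ∧ riemann (schwarzschild r₀) x 1 0 0 i = 0 := by
  have h2 := pd_radial_two (logOmegaS r₀) x
  have h3 := pd_radial_three (logOmegaS r₀) x
  simp only [riemann_eq_of_mem hr₀ hx]
  rcases hi with rfl | rfl <;>
    simp [Fin.sum_univ_four, schwGamma, schwarzschild, pd_const, h2, h3]

lemma ip_schwarzschild (r₀ : ℝ) (x v w : Fin 4 → ℝ) :
    ip (schwarzschild r₀) x v w = 2 * omegaSq r₀ (x 0) (x 1) * (v 0 * w 1 + v 1 * w 0) +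
      schwR r₀ (x 0) (x 1) ^ 2 * (v 2 * w 2 + sin (x 2) ^ 2 * (v 3 * w 3)) := by
  simp [ip, Fin.sum_univ_four, schwarzschild]
  ring

lemma covD_eq {r₀ : ℝ} (hr₀ : 0 < r₀) (X : Surface) (i : Fin 2) (V : Chart → Fin 4 → ℝ)
    {y : Chart} (hy : X y ∈ domain4 r₀) :
    covD r₀ X i V y = ![
      pd i (fun z => V z 0) y + logOmegaS r₀ (X y 0) (X y 1) * (tangent X i y 0 * V y 0)
        + -(schwR r₀ (X y 0) (X y 1) - r₀) / (2 * omegaSq r₀ (X y 0) (X y 1)) *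
          (tangent X i y 2 * V y 2 + sin (X y 2) ^ 2 * (tangent X i y 3 * V y 3)),
      pd i (fun z => V z 1) y + r₀ / schwR r₀ (X y 0) (X y 1) ^ 2 * (tangent X i y 1 * V y 1)
        + -schwR r₀ (X y 0) (X y 1) / 2 *
          (tangent X i y 2 * V y 2 + sin (X y 2) ^ 2 * (tangent X i y 3 * V y 3)),
      pd i (fun z => V z 2) y
        + omegaSq r₀ (X y 0) (X y 1) / schwR r₀ (X y 0) (X y 1) *
          (tangent X i y 0 * V y 2 + tangent X i y 2 * V y 0)
        + (schwR r₀ (X y 0) (X y 1) - r₀) / schwR r₀ (X y 0) (X y 1) ^ 2 *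
          (tangent X i y 1 * V y 2 + tangent X i y 2 * V y 1)
        - sin (X y 2) * cos (X y 2) * (tangent X i y 3 * V y 3),
      pd i (fun z => V z 3) y
        + omegaSq r₀ (X y 0) (X y 1) / schwR r₀ (X y 0) (X y 1) *
          (tangent X i y 0 * V y 3 + tangent X i y 3 * V y 0)
        + (schwR r₀ (X y 0) (X y 1) - r₀) / schwR r₀ (X y 0) (X y 1) ^ 2 *
          (tangent X i y 1 * V y 3 + tangent X i y 3 * V y 1)
        + cos (X y 2) / sin (X y 2) * (tangent X i y 2 * V y 3 + tangent X i y 3 * V y 2)] := by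
  funext a
  simp only [covD, christoffel_schwarzschild hr₀ hy, Fin.sum_univ_four]
  fin_cases a <;> simp [schwGamma] <;> ring

/-! ### Jets of the intrinsic geometry of nearly round spheres -/

/-- The unit round metric in the chart. -/
def roundMetric (y : Chart) : Mat2 := !![1, 0; 0, sin (y 0) ^ 2]

/-- The divergence on the unit round sphere. -/
def roundDiv (η : Fin 2 → Chart → ℝ) (y : Chart) : ℝ :=
  pd 0 (η 0) y + cos (y 0) / sin (y 0) * η 0 y + pd 1 (η 1) y / sin (y 0) ^ 2

/-- The Laplacian on the unit round sphere. -/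
def roundLap (F : Chart → ℝ) (y : Chart) : ℝ := roundDiv (fun j => pd j F) y

lemma roundLap_eq (F : Chart → ℝ) (y : Chart) : roundLap F y =
    pd 0 (pd 0 F) y + cos (y 0) / sin (y 0) * pd 0 F y + pd 1 (pd 1 F) y / sin (y 0) ^ 2 := rfl

lemma hasJet_sin : HasJet (fun _ y => sin (y 0)) (fun y => sin (y 0)) (fun _ => 0) :=
  HasJet.of_contDiff fun _ _ => by fun_prop

lemma hasJet_cos : HasJet (fun _ y => cos (y 0)) (fun y => cos (y 0)) (fun _ => 0) :=
  HasJet.of_contDiff fun _ _ => by fun_prop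

lemma contDiff_roundMetric (i j : Fin 2) : ContDiff ℝ ∞ (fun y => roundMetric y i j) := by
  fin_cases i <;> fin_cases j <;> simp [roundMetric] <;> fun_prop

/-- The derivatives `∂_l g_ij` of the round metric. -/
def roundDeriv (y : Chart) (l i j : Fin 2) : ℝ :=
  if l = 0 ∧ i = 1 ∧ j = 1 then 2 * sin (y 0) * cos (y 0) else 0

lemma pd_zero_sin_sq (y : Chart) : pd 0 (fun y : Chart => sin (y 0) ^ 2) y =
    2 * sin (y 0) * cos (y 0) := by
  rw [pd_coord_self (fun t => sin t ^ 2)]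
  simp

lemma pd_roundMetric (l i j : Fin 2) (y : Chart) :
    pd l (fun z => roundMetric z i j) y = roundDeriv y l i j := by
  have h0 := pd_zero_sin_sq y
  have h1 : pd 1 (fun y : Chart => sin (y 0) ^ 2) y = 0 :=
    pd_coord_ne (fun t => sin t ^ 2) (by decide) y
  fin_cases l <;> fin_cases i <;> fin_cases j <;>
    simp [roundMetric, roundDeriv, pd_const, h0, h1]

lemma mat2_inv_apply (h : Mat2) : h⁻¹ 0 0 = h 1 1 / h.det ∧ h⁻¹ 0 1 = -h 0 1 / h.det ∧
    h⁻¹ 1 0 = -h 1 0 / h.det ∧ h⁻¹ 1 1 = h 0 0 / h.det := by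
  simp [Matrix.inv_def, Matrix.adjugate_fin_two, div_eq_inv_mul]

/-- The family of metrics `h ε` is to first order the conformal family `r² (1 + 2 ε φ)` times the
round metric. -/
structure ConformalJet (h : ℝ → Chart → Mat2) (r : ℝ) (φ : Chart → ℝ) : Prop where
  pos : 0 < r
  smooth : ∀ y ∈ chartDomain, ContDiffAt ℝ ∞ φ y
  jet : ∀ i j, HasJet (fun ε y => h ε y i j) (fun y => r ^ 2 * roundMetric y i j)
    (fun y => 2 * r ^ 2 * (φ y * roundMetric y i j))

/-- The inverse of the round metric. -/
def roundInv (y : Chart) : Mat2 := !![1, 0; 0, (sin (y 0) ^ 2)⁻¹]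

/-- The Christoffel symbols of the round metric. -/
def roundGamma (y : Chart) (k i j : Fin 2) : ℝ :=
  match k, i, j with
  | 0, 1, 1 => -(sin (y 0) * cos (y 0))
  | 1, 0, 1 | 1, 1, 0 => cos (y 0) / sin (y 0)
  | _, _, _ => 0

/-- The linearised Christoffel symbols of the conformal family `exp (2 ε φ)` times the round
metric. -/
def conformalGamma (φ : Chart → ℝ) (y : Chart) (k i j : Fin 2) : ℝ :=
  (if k = i then pd j φ y else 0) + (if k = j then pd i φ y else 0)
    - roundMetric y i j * (roundInv y k k * pd k φ y)

namespace ConformalJet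

variable {h : ℝ → Chart → Mat2} {r : ℝ} {φ : Chart → ℝ}

lemma det (H : ConformalJet h r φ) : HasJet (fun ε y => (h ε y).det)
    (fun y => r ^ 4 * sin (y 0) ^ 2) (fun y => 4 * r ^ 4 * φ y * sin (y 0) ^ 2) := by
  simp only [Matrix.det_fin_two]
  refine (((H.jet 0 0).mul (H.jet 1 1)).sub ((H.jet 0 1).mul (H.jet 1 0))).congr ?_ ?_ <;>
    intro y _ <;> simp [roundMetric] <;> ring

lemma inv (H : ConformalJet h r φ) (i j : Fin 2) : HasJet (fun ε y => (h ε y)⁻¹ i j)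
    (fun y => roundInv y i j / r ^ 2) (fun y => -2 * φ y * roundInv y i j / r ^ 2) := by
  have hr := H.pos.ne'
  have hd : ∀ y ∈ chartDomain, r ^ 4 * sin (y 0) ^ 2 ≠ 0 := fun y hy => by
    have := sin_ne_zero_of_mem hy
    positivity
  have e := fun ε y => mat2_inv_apply (h ε y)
  fin_cases i <;> fin_cases j
  · simp only [Fin.zero_eta, (e _ _).1]
    refine ((H.jet 1 1).div H.det hd).congr ?_ ?_ <;> intro y hy <;>
      have := sin_ne_zero_of_mem hy <;> simp [roundMetric, roundInv] <;> field_simp <;> ring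
  · simp only [Fin.zero_eta, Fin.mk_one, (e _ _).2.1]
    refine ((H.jet 0 1).neg.div H.det hd).congr ?_ ?_ <;> intro y _ <;>
      simp [roundMetric, roundInv]
  · simp only [Fin.zero_eta, Fin.mk_one, (e _ _).2.2.1]
    refine ((H.jet 1 0).neg.div H.det hd).congr ?_ ?_ <;> intro y _ <;>
      simp [roundMetric, roundInv]
  · simp only [Fin.mk_one, (e _ _).2.2.2]
    refine ((H.jet 0 0).div H.det hd).congr ?_ ?_ <;> intro y hy <;>
      have := sin_ne_zero_of_mem hy <;> simp [roundMetric, roundInv] <;> field_simp <;> ring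

lemma pd_jet (H : ConformalJet h r φ) (l i j : Fin 2) :
    HasJet (fun ε y => pd l (fun z => h ε z i j) y) (fun y => r ^ 2 * roundDeriv y l i j)
      (fun y => 2 * r ^ 2 * (pd l φ y * roundMetric y i j + φ y * roundDeriv y l i j)) := by
  refine ((H.jet i j).pd l).congr ?_ ?_ <;> intro y hy
  · rw [pd_const_mul _ ((contDiff_roundMetric i j).differentiable (by simp) y), pd_roundMetric]
  · have h1 := (H.smooth y hy).differentiableAt (by simp)
    have h2 := (contDiff_roundMetric i j).differentiable (by simp) y
    rw [pd_const_mul _ (h1.fun_mul h2), pd_mul h1 h2, pd_roundMetric]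

/-- The constant factor r² cancels between the metric and its inverse, leaving the usual conformal
variation δ^k_i ∂_jφ + δ^k_j ∂_iφ - g_ij ∂^kφ. -/
lemma christoffel (H : ConformalJet h r φ) (k i j : Fin 2) :
    HasJet (fun ε y => christoffel (h ε) y k i j) (fun y => roundGamma y k i j)
      (fun y => conformalGamma φ y k i j) := by
  have hr := H.pos.ne'
  simp only [CMAFoliation.christoffel, Fin.sum_univ_two]
  refine ((((H.inv k 0).mul (((H.pd_jet i j 0).add (H.pd_jet j i 0)).sub (H.pd_jet 0 i j))).add
    ((H.inv k 1).mul (((H.pd_jet i j 1).add (H.pd_jet j i 1)).sub (H.pd_jet 1 i j)))).const_mul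
      (1 / 2)).congr ?_ ?_
  · intro y hy
    have := sin_ne_zero_of_mem hy
    fin_cases k <;> fin_cases i <;> fin_cases j <;>
      simp [roundInv, roundDeriv, roundGamma] <;> field_simp
  · intro y hy
    have := sin_ne_zero_of_mem hy
    fin_cases k <;> fin_cases i <;> fin_cases j <;>
      simp [roundInv, roundDeriv, conformalGamma, roundMetric] <;> field_simp <;> ring

/-- This linearises the conformal law K = r⁻² e^{-2φ} (1 - Δφ). Here it is derived from the Riemann
tensor itself, through the jets of the Christoffel symbols. -/
lemma gaussCurvature (H : ConformalJet h r φ) :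
    HasJet (fun ε y => gaussCurvature (h ε) y) (fun _ => 1 / r ^ 2)
      (fun y => -(2 * φ y + roundLap φ y) / r ^ 2) := by
  have hr := H.pos.ne'
  have hd : ∀ y ∈ chartDomain, r ^ 4 * sin (y 0) ^ 2 ≠ 0 := fun y hy => by
    have := sin_ne_zero_of_mem hy
    positivity
  have G := H.christoffel
  simp only [CMAFoliation.gaussCurvature, riemann, Fin.sum_univ_two]
  have A := (((G 0 1 1).pd 0).sub ((G 0 0 1).pd 1)).add
    ((((G 0 0 0).mul (G 0 1 1)).sub ((G 0 1 0).mul (G 0 0 1))).add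
      (((G 0 0 1).mul (G 1 1 1)).sub ((G 0 1 1).mul (G 1 0 1))))
  have B := (((G 1 1 1).pd 0).sub ((G 1 0 1).pd 1)).add
    ((((G 1 0 0).mul (G 0 1 1)).sub ((G 1 1 0).mul (G 0 0 1))).add
      (((G 1 0 1).mul (G 1 1 1)).sub ((G 1 1 1).mul (G 1 0 1))))
  refine ((((H.jet 0 0).mul A).add ((H.jet 0 1).mul B)).div H.det hd).congr ?_ ?_
  · intro y hy
    have hs := sin_ne_zero_of_mem hy
    have e1 : pd 0 (fun y : Chart => -(sin (y 0) * cos (y 0))) y =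
        -(cos (y 0) * cos (y 0) - sin (y 0) * sin (y 0)) := by
      rw [pd_coord_self (fun t => -(sin t * cos t))]
      have := ((hasDerivAt_sin (y 0)).fun_mul (hasDerivAt_cos (y 0))).fun_neg.deriv
      rw [this]; ring
    simp only [roundMetric, roundGamma, pd_const, e1]
    simp
    field_simp
    ring
  · intro y hy
    have hs := sin_ne_zero_of_mem hy
    have e1 : pd 0 (fun y : Chart => -(sin (y 0) * cos (y 0))) y =
        -(cos (y 0) * cos (y 0) - sin (y 0) * sin (y 0)) := by
      rw [pd_coord_self (fun t => -(sin t * cos t))]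
      have := ((hasDerivAt_sin (y 0)).fun_mul (hasDerivAt_cos (y 0))).fun_neg.deriv
      rw [this]; ring
    have e2 : pd 0 (fun y => conformalGamma φ y 0 1 1) y =
        -(2 * sin (y 0) * cos (y 0) * pd 0 φ y + sin (y 0) ^ 2 * pd 0 (pd 0 φ) y) := by
      have : (fun y => conformalGamma φ y 0 1 1) = fun y => -(sin (y 0) ^ 2 * pd 0 φ y) := by
        funext y; simp [conformalGamma, roundMetric, roundInv]
      rw [this, pd_neg, pd_mul (by fun_prop)
        ((contDiffAt_pd (H.smooth y hy) 0).differentiableAt (by simp)), pd_zero_sin_sq]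
    have e3 : pd 1 (fun y => conformalGamma φ y 0 0 1) y = pd 1 (pd 1 φ) y := by
      congr 1; funext y; simp [conformalGamma, roundMetric]
    simp only [roundLap_eq, e2, e3]
    simp only [roundMetric, roundGamma, conformalGamma, roundInv, pd_const, e1]
    simp
    field_simp
    ring

/-- In dimension two the divergence of a 1-form is conformally covariant: a factor e^{2φ} in the
metric only multiplies it by e^{-2φ}. -/
lemma divergence (H : ConformalJet h r φ) {η : ℝ → Fin 2 → Chart → ℝ} {e de : Fin 2 → Chart → ℝ}
    (hη : ∀ j, HasJet (fun ε y => η ε j y) (e j) (de j)) :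
    HasJet (fun ε y => divergence (h ε) (η ε) y) (fun y => roundDiv e y / r ^ 2)
      (fun y => (roundDiv de y - 2 * φ y * roundDiv e y) / r ^ 2) := by
  have hr := H.pos.ne'
  have G := H.christoffel
  simp only [CMAFoliation.divergence, Fin.sum_univ_two]
  have A := fun i j => (H.inv i j).mul (((hη j).pd i).sub
    (((G 0 i j).mul (hη 0)).add ((G 1 i j).mul (hη 1))))
  refine (((A 0 0).add (A 0 1)).add ((A 1 0).add (A 1 1))).congr ?_ ?_
  · intro y hy
    have hs := sin_ne_zero_of_mem hy
    simp [roundInv, roundGamma, roundDiv]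
    field_simp
    ring
  · intro y hy
    have hs := sin_ne_zero_of_mem hy
    simp [roundInv, roundGamma, roundDiv, conformalGamma, roundMetric]
    field_simp
    ring

lemma laplacian (H : ConformalJet h r φ) {F : ℝ → Chart → ℝ} {f df : Chart → ℝ}
    (hF : HasJet F f df) : HasJet (fun ε y => laplacian (h ε) (F ε) y)
      (fun y => roundLap f y / r ^ 2)
      (fun y => (roundLap df y - 2 * φ y * roundLap f y) / r ^ 2) :=
  H.divergence (η := fun ε j => pd j (F ε)) fun j => hF.pd j

end ConformalJet

/-! ### Jets of the null frame of a family of leaves -/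

/-- In the application the three coefficients are quadratic in the gradients of the graph functions,
hence of second order in ε. The correction that makes the normals null is then invisible to first
order. -/
lemma HasJet.nullRoot {p m q : ℝ → Chart → ℝ} (hp : HasJet p (fun _ => 0) (fun _ => 0))
    (hm : HasJet m (fun _ => 0) (fun _ => 0)) (hq : HasJet q (fun _ => 0) (fun _ => 0)) :
    HasJet (fun ε y => nullRoot (p ε y) (m ε y) (q ε y)) (fun _ => 0) (fun _ => 0) := by
  unfold CMAFoliation.nullRoot
  have h1 := (HasJet.const 1).add (hm.const_mul 2)
  have h2 := (h1.pow 2).sub ((hp.const_mul 4).mul hq)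
  have h3 := h1.add (h2.sqrt fun y _ => by norm_num)
  refine ((hq.const_mul (-2)).div h3 fun y _ => by norm_num).congr ?_ ?_ <;> intro y _ <;> simp

/-- The family of graphs `s = f ε, s̲ = b ε` has the jet `s = u + ε F, s̲ = ε H`. -/
structure LeafJet (r₀ u : ℝ) (f b : ℝ → Chart → ℝ) (F H : Chart → ℝ) : Prop where
  pos : 0 < r₀
  nonneg : 0 ≤ u
  jf : HasJet f (fun _ => u) F
  jb : HasJet b (fun _ => 0) H
  smoothF : ∀ y ∈ chartDomain, ContDiffAt ℝ ∞ F y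
  smoothH : ∀ y ∈ chartDomain, ContDiffAt ℝ ∞ H y

/-- The linearised perturbation of the radius function on a leaf. -/
def radiusPert (r₀ u : ℝ) (F H : Chart → ℝ) (y : Chart) : ℝ := F y + u / (r₀ + u) * H y

section Tangent

variable (f b : Chart → ℝ) (y : Chart)

lemma graph_zero : graphSurface f b y 0 = f y := rfl
lemma graph_one : graphSurface f b y 1 = b y := rfl
lemma graph_two : graphSurface f b y 2 = y 0 := rfl
lemma tangent_zero (i : Fin 2) : tangent (graphSurface f b) i y 0 = pd i f y := rfl
lemma tangent_one (i : Fin 2) : tangent (graphSurface f b) i y 1 = pd i b y := rfl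

lemma tangent_two (i : Fin 2) :
    tangent (graphSurface f b) i y 2 = if i = 0 then 1 else 0 := by
  change pd i (fun z : Chart => z 0) y = _
  fin_cases i
  · simpa using pd_coord_self (fun t => t) 0 y
  · simpa using pd_coord_ne (fun t => t) (i := 1) (j := 0) (by decide) y

lemma tangent_three (i : Fin 2) :
    tangent (graphSurface f b) i y 3 = if i = 1 then 1 else 0 := by
  change pd i (fun z : Chart => z 1) y = _
  fin_cases i
  · simpa using pd_coord_ne (fun t => t) (i := 0) (j := 1) (by decide) y
  · simpa using pd_coord_self (fun t => t) 1 y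

end Tangent

namespace LeafJet

variable {r₀ u : ℝ} {f b : ℝ → Chart → ℝ} {F H : Chart → ℝ}

lemma radius_pos (J : LeafJet r₀ u f b F H) : 0 < r₀ + u := by
  have := J.pos; have := J.nonneg; linarith

lemma mem_region (J : LeafJet r₀ u f b F H) : (u, 0) ∈ region r₀ :=
  mem_region_of_nonneg J.pos J.nonneg 0

lemma schwR_bg (J : LeafJet r₀ u f b F H) : schwR r₀ u 0 = r₀ + u :=
  schwR_zero J.pos (by have := J.pos; have := J.nonneg; linarith)

lemma omegaSq_bg (J : LeafJet r₀ u f b F H) : omegaSq r₀ u 0 = 1 :=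
  omegaSq_zero J.pos (by have := J.pos; have := J.nonneg; linarith)

lemma logOmegaS_bg (J : LeafJet r₀ u f b F H) : logOmegaS r₀ u 0 = 0 := by
  simp [logOmegaS, J.schwR_bg, J.omegaSq_bg, add_comm u r₀]

lemma radius (J : LeafJet r₀ u f b F H) : HasJet (fun ε y => schwR r₀ (f ε y) (b ε y))
    (fun _ => r₀ + u) (radiusPert r₀ u F H) := by
  have hr := J.radius_pos.ne'
  refine (HasJet.comp₂ (G := fun q : ℝ × ℝ => schwR r₀ q.1 q.2)
    (a := fun _ => omegaSq r₀ u 0) (b := fun _ => 1 - r₀ / schwR r₀ u 0) J.jf J.jb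
    (fun y _ => contDiffAt_schwR J.pos J.mem_region)
    (fun y _ => hasDerivAt_schwR_left J.pos J.mem_region)
    (fun y _ => hasDerivAt_schwR_right J.pos J.mem_region)).congr ?_ ?_ <;> intro y _
  · exact J.schwR_bg
  · simp only [J.omegaSq_bg, J.schwR_bg, radiusPert]
    field_simp
    ring

/-- On s̲ = 0 one has Ω² = 1, so its s-derivative vanishes there and F does not enter. -/
lemma lapseSq (J : LeafJet r₀ u f b F H) : HasJet (fun ε y => omegaSq r₀ (f ε y) (b ε y))
    (fun _ => 1) (fun y => r₀ / (r₀ + u) ^ 2 * H y) := by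
  refine (HasJet.comp₂ (G := fun q : ℝ × ℝ => omegaSq r₀ q.1 q.2)
    (a := fun _ => omegaSq r₀ u 0 * logOmegaS r₀ u 0)
    (b := fun _ => omegaSq r₀ u 0 * (r₀ / schwR r₀ u 0 ^ 2)) J.jf J.jb
    (fun y _ => contDiffAt_omegaSq J.pos J.mem_region)
    (fun y _ => hasDerivAt_omegaSq_left J.pos J.mem_region)
    (fun y _ => hasDerivAt_omegaSq_right J.pos J.mem_region)).congr ?_ ?_ <;> intro y _
  · exact J.omegaSq_bg
  · simp only [J.omegaSq_bg, J.schwR_bg, J.logOmegaS_bg]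
    ring

lemma logOmegaS_jet (J : LeafJet r₀ u f b F H) :
    HasJet (fun ε y => logOmegaS r₀ (f ε y) (b ε y))
    (fun _ => 0) (fun y => -(2 * r₀ / (r₀ + u) ^ 3 * H y)) := by
  have hr := J.radius_pos.ne'
  have hr' : u + r₀ ≠ 0 := by rwa [add_comm]
  have hr₀ := J.pos.ne'
  unfold logOmegaS
  refine ((((HasJet.const 1).div (J.jf.add (HasJet.const r₀)) fun y _ => hr').add
    (HasJet.const (1 / r₀))).sub (J.lapseSq.mul
      (((HasJet.const 1).div J.radius fun y _ => hr).add (HasJet.const (1 / r₀))))).congr ?_ ?_ <;>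
    intro y _ <;> simp only [radiusPert, add_comm u r₀] <;> field_simp <;> ring

lemma eventually_mem_domain (J : LeafJet r₀ u f b F H) {y : Chart} (hy : y ∈ chartDomain) :
    ∀ᶠ z : ℝ × Chart in 𝓝 (0, y), graphSurface (f z.1) (b z.1) z.2 ∈ domain4 r₀ := by
  have h1 : ∀ᶠ z : ℝ × Chart in 𝓝 (0, y), (f z.1 z.2, b z.1 z.2) ∈ region r₀ := by
    refine ((J.jf.continuousAt hy).prodMk (J.jb.continuousAt hy)).eventually_mem
      ((isOpen_region r₀).mem_nhds ?_)
    simp only [J.jf.value hy, J.jb.value hy]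
    exact J.mem_region
  have h2 := hasJet_sin.eventually_ne hy (sin_ne_zero_of_mem hy)
  filter_upwards [h1, h2] with z hz1 hz2 using ⟨hz1, hz2⟩

lemma df (J : LeafJet r₀ u f b F H) (i : Fin 2) :
    HasJet (fun ε y => pd i (f ε) y) (fun _ => 0) (fun y => pd i F y) :=
  (J.jf.pd i).congr (fun y _ => pd_const u i y) fun _ _ => rfl

lemma db (J : LeafJet r₀ u f b F H) (i : Fin 2) :
    HasJet (fun ε y => pd i (b ε) y) (fun _ => 0) (fun y => pd i H y) :=
  (J.jb.pd i).congr (fun y _ => pd_const 0 i y) fun _ _ => rfl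

lemma smoothPert (J : LeafJet r₀ u f b F H) {y : Chart} (hy : y ∈ chartDomain) :
    ContDiffAt ℝ ∞ (radiusPert r₀ u F H) y :=
  (J.smoothF y hy).add (contDiffAt_const.mul (J.smoothH y hy))

end LeafJet

lemma inducedMetric_graph (r₀ : ℝ) (f b : Chart → ℝ) (y : Chart) (i j : Fin 2) :
    inducedMetric r₀ (graphSurface f b) y i j =
      2 * omegaSq r₀ (f y) (b y) * (pd i f y * pd j b y + pd i b y * pd j f y) +
      schwR r₀ (f y) (b y) ^ 2 * roundMetric y i j := by
  simp only [inducedMetric, Matrix.of_apply, ip_schwarzschild, tangent_zero, tangent_one,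
    tangent_two, tangent_three, graph_zero, graph_one, graph_two]
  fin_cases i <;> fin_cases j <;> simp [roundMetric]

namespace LeafJet

variable {r₀ u : ℝ} {f b : ℝ → Chart → ℝ} {F H : Chart → ℝ}

/-- The term 2Ω² (df ⊗ df̲ + df̲ ⊗ df) is of second order, so only the change of r² is felt and the
leaf stays conformally round to first order. -/
lemma metric (J : LeafJet r₀ u f b F H) :
    ConformalJet (fun ε => inducedMetric r₀ (graphSurface (f ε) (b ε))) (r₀ + u)
      (fun y => radiusPert r₀ u F H y / (r₀ + u)) where
  pos := J.radius_pos
  smooth y hy := (J.smoothPert hy).div_const _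
  jet i j := by
    have hr := J.radius_pos.ne'
    simp only [inducedMetric_graph]
    refine (((J.lapseSq.const_mul 2).mul (((J.df i).mul (J.db j)).add ((J.db i).mul (J.df j)))).add
      ((J.radius.pow 2).mul (HasJet.of_contDiff fun y _ =>
        (contDiff_roundMetric i j).contDiffAt))).congr ?_ ?_ <;> intro y _ <;> simp
    field_simp

lemma covecIp (J : LeafJet r₀ u f b F H) {α β : ℝ → Chart → Fin 2 → ℝ} {α' β' : Fin 2 → Chart → ℝ}
    (hα : ∀ i, HasJet (fun ε y => α ε y i) (fun _ => 0) (α' i))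
    (hβ : ∀ i, HasJet (fun ε y => β ε y i) (fun _ => 0) (β' i)) :
    HasJet (fun ε y => covecIp r₀ (graphSurface (f ε) (b ε) y) (α ε y) (β ε y))
      (fun _ => 0) (fun _ => 0) := by
  have hr := J.radius_pos.ne'
  simp only [CMAFoliation.covecIp, graph_zero, graph_one, graph_two]
  refine ((J.lapseSq.div (J.radius.pow 2) fun y _ => by positivity).mul
    (((hα 0).mul (hβ 0)).add (((hα 1).mul (hβ 1)).div (hasJet_sin.pow 2)
      fun y hy => pow_ne_zero 2 (sin_ne_zero_of_mem hy)))).congr ?_ ?_ <;>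
    intro y _ <;> simp

end LeafJet

/-- The family `V` of vector fields along the graphs has the jet
`(a + ε A) ∂_s + (c + ε B) ∂_s̲ - (2 ε / r²) ∇K`, with the gradient of the round sphere. -/
structure NormalJet (r a c : ℝ) (V : ℝ → Chart → Fin 4 → ℝ) (A B K : Chart → ℝ) : Prop where
  smooth : ∀ y ∈ chartDomain, ContDiffAt ℝ ∞ K y
  comp0 : HasJet (fun ε y => V ε y 0) (fun _ => a) A
  comp1 : HasJet (fun ε y => V ε y 1) (fun _ => c) B
  comp2 : HasJet (fun ε y => V ε y 2) (fun _ => 0) (fun y => -2 / r ^ 2 * pd 0 K y)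
  comp3 : HasJet (fun ε y => V ε y 3) (fun _ => 0)
    (fun y => -2 / r ^ 2 * (pd 1 K y / sin (y 0) ^ 2))

lemma NormalJet.smul {r a c : ℝ} {V : ℝ → Chart → Fin 4 → ℝ} {A B K : Chart → ℝ}
    (N : NormalJet r a c V A B K) {l : ℝ → Chart → ℝ} {l' : Chart → ℝ}
    (hl : HasJet l (fun _ => 1) l') : NormalJet r a c (fun ε y => l ε y • V ε y)
      (fun y => A y + a * l' y) (fun y => B y + c * l' y) K where
  smooth := N.smooth
  comp0 := (hl.mul N.comp0).congr (fun _ _ => by ring) fun _ _ => by ring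
  comp1 := (hl.mul N.comp1).congr (fun _ _ => by ring) fun _ _ => by ring
  comp2 := (hl.mul N.comp2).congr (fun _ _ => by ring) fun _ _ => by ring
  comp3 := (hl.mul N.comp3).congr (fun _ _ => by ring) fun _ _ => by ring

namespace LeafJet

variable {r₀ u : ℝ} {f b : ℝ → Chart → ℝ} {F H : Chart → ℝ}

lemma incoming (J : LeafJet r₀ u f b F H) :
    NormalJet (r₀ + u) 1 0 (fun ε => incoming r₀ (graphSurface (f ε) (b ε)))
      (fun _ => 0) (fun _ => 0) H := by
  have hr := J.radius_pos.ne'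
  have hB : HasJet (fun ε y => CMAFoliation.incoming r₀ (graphSurface (f ε) (b ε)) y 1)
      (fun _ => 0) (fun _ => 0) :=
    HasJet.nullRoot (J.covecIp J.df J.df) (J.covecIp J.df J.db) (J.covecIp J.db J.db)
  have hc := (J.lapseSq.const_mul (-2)).div (J.radius.pow 2) fun y _ => pow_ne_zero 2 hr
  refine ⟨J.smoothH, HasJet.const 1, hB, ?_, ?_⟩
  · refine (hc.mul (((HasJet.const 1).mul (J.db 0)).add (hB.mul (J.df 0)))).congr ?_ ?_ <;>
      intro y _ <;> simp
  · refine ((hc.mul (((HasJet.const 1).mul (J.db 1)).add (hB.mul (J.df 1)))).div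
      (hasJet_sin.pow 2) fun y hy => pow_ne_zero 2 (sin_ne_zero_of_mem hy)).congr ?_ ?_ <;>
      intro y _ <;> simp
    ring

lemma outgoing (J : LeafJet r₀ u f b F H) :
    NormalJet (r₀ + u) 0 1 (fun ε => outgoing r₀ (graphSurface (f ε) (b ε)))
      (fun _ => 0) (fun _ => 0) F := by
  have hr := J.radius_pos.ne'
  have hB : HasJet (fun ε y => CMAFoliation.outgoing r₀ (graphSurface (f ε) (b ε)) y 0)
      (fun _ => 0) (fun _ => 0) :=
    HasJet.nullRoot (J.covecIp J.db J.db) (J.covecIp J.df J.db) (J.covecIp J.df J.df)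
  have hc := (J.lapseSq.const_mul (-2)).div (J.radius.pow 2) fun y _ => pow_ne_zero 2 hr
  refine ⟨J.smoothF, hB, HasJet.const 1, ?_, ?_⟩
  · refine (hc.mul ((hB.mul (J.db 0)).add ((HasJet.const 1).mul (J.df 0)))).congr ?_ ?_ <;>
      intro y _ <;> simp
  · refine ((hc.mul ((hB.mul (J.db 1)).add ((HasJet.const 1).mul (J.df 1)))).div
      (hasJet_sin.pow 2) fun y hy => pow_ne_zero 2 (sin_ne_zero_of_mem hy)).congr ?_ ?_ <;>
      intro y _ <;> simp
    ring

/-- The angular components of both normals are of first order and enter through a product, so the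
pairing is 2Ω² up to second order. -/
lemma ip_frame (J : LeafJet r₀ u f b F H) :
    HasJet (fun ε y => ip (schwarzschild r₀) (graphSurface (f ε) (b ε) y)
      (CMAFoliation.incoming r₀ (graphSurface (f ε) (b ε)) y)
      (CMAFoliation.outgoing r₀ (graphSurface (f ε) (b ε)) y))
      (fun _ => 2) (fun y => 2 * (r₀ / (r₀ + u) ^ 2 * H y)) := by
  have I := J.incoming
  have O := J.outgoing
  simp only [ip_schwarzschild, graph_zero, graph_one, graph_two]
  refine (((J.lapseSq.const_mul 2).mul ((I.comp0.mul O.comp1).add (I.comp1.mul O.comp0))).add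
    ((J.radius.pow 2).mul ((I.comp2.mul O.comp2).add ((hasJet_sin.pow 2).mul
      (I.comp3.mul O.comp3))))).congr ?_ ?_ <;> intro y _ <;> simp

lemma conjugate (J : LeafJet r₀ u f b F H) :
    NormalJet (r₀ + u) 0 1 (fun ε => conjugate r₀ (graphSurface (f ε) (b ε)))
      (fun _ => 0) (fun y => -(r₀ / (r₀ + u) ^ 2 * H y)) F := by
  have h := ((HasJet.const 2).div J.ip_frame fun y _ => two_ne_zero).congr
    (p := fun _ => 1) (dp := fun y => -(r₀ / (r₀ + u) ^ 2 * H y)) (fun _ _ => by norm_num)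
    (fun _ _ => by ring)
  have := J.outgoing.smul h
  simp only [zero_mul, zero_add, add_zero, one_mul] at this
  exact this

end LeafJet

/-! ### Jets of the extrinsic geometry of a family of leaves -/

/-- The Hessian on the unit round sphere. -/
def roundHess (K : Chart → ℝ) (y : Chart) (i j : Fin 2) : ℝ :=
  pd i (pd j K) y - ∑ k, roundGamma y k i j * pd k K y

lemma covD_graph {r₀ : ℝ} (hr₀ : 0 < r₀) (f b : Chart → ℝ) (V : Chart → Fin 4 → ℝ)
    {y : Chart} (hy : graphSurface f b y ∈ domain4 r₀) (i : Fin 2) :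
    covD r₀ (graphSurface f b) i V y 0 = pd i (fun z => V z 0) y
        + logOmegaS r₀ (f y) (b y) * (pd i f y * V y 0)
        + -(schwR r₀ (f y) (b y) - r₀) / (2 * omegaSq r₀ (f y) (b y)) *
          (if i = 0 then V y 2 else sin (y 0) ^ 2 * V y 3) ∧
    covD r₀ (graphSurface f b) i V y 1 = pd i (fun z => V z 1) y
        + r₀ / schwR r₀ (f y) (b y) ^ 2 * (pd i b y * V y 1)
        + -schwR r₀ (f y) (b y) / 2 * (if i = 0 then V y 2 else sin (y 0) ^ 2 * V y 3) ∧
    covD r₀ (graphSurface f b) i V y 2 = pd i (fun z => V z 2) y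
        + omegaSq r₀ (f y) (b y) / schwR r₀ (f y) (b y) *
          (pd i f y * V y 2 + if i = 0 then V y 0 else 0)
        + (schwR r₀ (f y) (b y) - r₀) / schwR r₀ (f y) (b y) ^ 2 *
          (pd i b y * V y 2 + if i = 0 then V y 1 else 0)
        - sin (y 0) * cos (y 0) * (if i = 0 then 0 else V y 3) ∧
    covD r₀ (graphSurface f b) i V y 3 = pd i (fun z => V z 3) y
        + omegaSq r₀ (f y) (b y) / schwR r₀ (f y) (b y) *
          (pd i f y * V y 3 + if i = 0 then 0 else V y 0)
        + (schwR r₀ (f y) (b y) - r₀) / schwR r₀ (f y) (b y) ^ 2 *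
          (pd i b y * V y 3 + if i = 0 then 0 else V y 1)
        + cos (y 0) / sin (y 0) * (if i = 0 then V y 3 else V y 2) := by
  rw [covD_eq hr₀ _ i V hy]
  fin_cases i <;>
    simp [tangent_zero, tangent_one, tangent_two, tangent_three, graph_zero, graph_one, graph_two]

lemma secondForm_graph (r₀ : ℝ) (f b : Chart → ℝ) (V : Chart → Fin 4 → ℝ) (y : Chart)
    (i j : Fin 2) : secondForm r₀ (graphSurface f b) V y i j =
      2 * omegaSq r₀ (f y) (b y) * (covD r₀ (graphSurface f b) i V y 0 * pd j b y +
        covD r₀ (graphSurface f b) i V y 1 * pd j f y) +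
      schwR r₀ (f y) (b y) ^ 2 * (if j = 0 then covD r₀ (graphSurface f b) i V y 2 else
        sin (y 0) ^ 2 * covD r₀ (graphSurface f b) i V y 3) := by
  simp only [secondForm, Matrix.of_apply, ip_schwarzschild, tangent_zero, tangent_one,
    tangent_two, tangent_three, graph_zero, graph_one, graph_two]
  fin_cases j <;> simp

lemma HasJet.ite {P Q : ℝ → Chart → ℝ} {p dp q dq : Chart → ℝ} (c : Prop) [Decidable c]
    (hP : HasJet P p dp) (hQ : HasJet Q q dq) :
    HasJet (fun ε y => if c then P ε y else Q ε y) (fun y => if c then p y else q y)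
      (fun y => if c then dp y else dq y) := by
  split_ifs <;> assumption

namespace LeafJet

variable {r₀ u a c : ℝ} {f b : ℝ → Chart → ℝ} {F H A B K : Chart → ℝ} {V : ℝ → Chart → Fin 4 → ℝ}

lemma radialCoeff (J : LeafJet r₀ u f b F H) :
    HasJet (fun ε y => (schwR r₀ (f ε y) (b ε y) - r₀) / schwR r₀ (f ε y) (b ε y) ^ 2)
      (fun _ => u / (r₀ + u) ^ 2)
      (fun y => (r₀ - u) / (r₀ + u) ^ 3 * radiusPert r₀ u F H y) := by
  have hr := J.radius_pos.ne'
  refine ((J.radius.sub (HasJet.const r₀)).div (J.radius.pow 2)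
    fun y _ => pow_ne_zero 2 hr).congr ?_ ?_ <;> intro y _ <;> simp <;> field_simp <;> ring

lemma lapseCoeff (J : LeafJet r₀ u f b F H) :
    HasJet (fun ε y => omegaSq r₀ (f ε y) (b ε y) / schwR r₀ (f ε y) (b ε y))
      (fun _ => 1 / (r₀ + u))
      (fun y => r₀ / (r₀ + u) ^ 3 * H y - radiusPert r₀ u F H y / (r₀ + u) ^ 2) := by
  have hr := J.radius_pos.ne'
  refine (J.lapseSq.div J.radius fun y _ => hr).congr ?_ ?_ <;> intro y _ <;> simp
  field_simp

/-- The weights (a, c) treat both null normals at once: (1, 0) is the incoming and (0, 1) the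
outgoing direction. -/
lemma covD_zero (J : LeafJet r₀ u f b F H) (N : NormalJet (r₀ + u) a c V A B K) (i : Fin 2) :
    HasJet (fun ε y => covD r₀ (graphSurface (f ε) (b ε)) i (V ε) y 0) (fun _ => 0)
      (fun y => pd i A y + u / (r₀ + u) ^ 2 * pd i K y) := by
  have hr := J.radius_pos.ne'
  have h := (((N.comp0.pd i).add (J.logOmegaS_jet.mul ((J.df i).mul N.comp0))).add
    (((J.radius.sub (HasJet.const r₀)).neg.div (J.lapseSq.const_mul 2)
      fun y _ => by norm_num).mul (HasJet.ite (i = 0) N.comp2 ((hasJet_sin.pow 2).mul N.comp3))))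
  refine (h.congr_fun fun y hy => ?_).congr ?_ ?_
  · filter_upwards [J.eventually_mem_domain hy] with z hz
    exact (covD_graph J.pos _ _ (V z.1) hz i).1
  · intro y _; simp [pd_const]
  · intro y hy
    have := sin_ne_zero_of_mem hy
    fin_cases i <;> simp <;> field_simp

lemma covD_one (J : LeafJet r₀ u f b F H) (N : NormalJet (r₀ + u) a c V A B K) (i : Fin 2) :
    HasJet (fun ε y => covD r₀ (graphSurface (f ε) (b ε)) i (V ε) y 1) (fun _ => 0)
      (fun y => pd i B y + c * r₀ / (r₀ + u) ^ 2 * pd i H y + 1 / (r₀ + u) * pd i K y) := by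
  have hr := J.radius_pos.ne'
  have h := ((N.comp1.pd i).add (((HasJet.const r₀).div (J.radius.pow 2)
    fun y _ => pow_ne_zero 2 hr).mul ((J.db i).mul N.comp1))).add
    ((J.radius.neg.div (HasJet.const 2) fun y _ => by norm_num).mul
      (HasJet.ite (i = 0) N.comp2 ((hasJet_sin.pow 2).mul N.comp3)))
  refine (h.congr_fun fun y hy => ?_).congr ?_ ?_
  · filter_upwards [J.eventually_mem_domain hy] with z hz
    exact (covD_graph J.pos _ _ (V z.1) hz i).2.1
  · intro y _; simp [pd_const]
  · intro y hy
    have := sin_ne_zero_of_mem hy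
    fin_cases i <;> simp <;> field_simp <;> ring

/-- The linearisation of the coefficient of the metric in the second fundamental form, divided by
`r²`. -/
def formPert (r₀ u a c : ℝ) (F H A B : Chart → ℝ) (y : Chart) : ℝ :=
  1 / (r₀ + u) * A y + a * (r₀ / (r₀ + u) ^ 3 * H y - radiusPert r₀ u F H y / (r₀ + u) ^ 2)
    + u / (r₀ + u) ^ 2 * B y + c * ((r₀ - u) / (r₀ + u) ^ 3 * radiusPert r₀ u F H y)

lemma covD_two (J : LeafJet r₀ u f b F H) (N : NormalJet (r₀ + u) a c V A B K) (i : Fin 2) :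
    HasJet (fun ε y => covD r₀ (graphSurface (f ε) (b ε)) i (V ε) y 2)
      (fun _ => if i = 0 then a / (r₀ + u) + u * c / (r₀ + u) ^ 2 else 0)
      (fun y => (if i = 0 then formPert r₀ u a c F H A B y else 0)
        - 2 / (r₀ + u) ^ 2 * roundHess K y i 0) := by
  have hr := J.radius_pos.ne'
  have h := (((N.comp2.pd i).add (J.lapseCoeff.mul (((J.df i).mul N.comp2).add
    (HasJet.ite (i = 0) N.comp0 (HasJet.const 0))))).add (J.radialCoeff.mul
      (((J.db i).mul N.comp2).add (HasJet.ite (i = 0) N.comp1 (HasJet.const 0))))).sub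
      ((hasJet_sin.mul hasJet_cos).mul (HasJet.ite (i = 0) (HasJet.const 0) N.comp3))
  refine (h.congr_fun fun y hy => ?_).congr ?_ ?_
  · filter_upwards [J.eventually_mem_domain hy] with z hz
    exact (covD_graph J.pos _ _ (V z.1) hz i).2.2.1
  · intro y _; fin_cases i <;> simp [pd_const] <;> field_simp
  · intro y hy
    have := sin_ne_zero_of_mem hy
    have e : ∀ i : Fin 2, pd i (fun y => -2 / (r₀ + u) ^ 2 * pd 0 K y) y =
        -2 / (r₀ + u) ^ 2 * pd i (pd 0 K) y := fun i =>
      pd_const_mul _ ((contDiffAt_pd (N.smooth y hy) 0).differentiableAt (by simp)) i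
    simp only [e]
    fin_cases i <;> simp [roundHess, roundGamma, formPert] <;> field_simp <;> ring

lemma covD_three (J : LeafJet r₀ u f b F H) (N : NormalJet (r₀ + u) a c V A B K) (i : Fin 2) :
    HasJet (fun ε y => covD r₀ (graphSurface (f ε) (b ε)) i (V ε) y 3)
      (fun _ => if i = 0 then 0 else a / (r₀ + u) + u * c / (r₀ + u) ^ 2)
      (fun y => (if i = 0 then 0 else formPert r₀ u a c F H A B y)
        - 2 / (r₀ + u) ^ 2 * (roundHess K y i 1 / sin (y 0) ^ 2)) := by
  have hr := J.radius_pos.ne'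
  have h := (((N.comp3.pd i).add (J.lapseCoeff.mul (((J.df i).mul N.comp3).add
    (HasJet.ite (i = 0) (HasJet.const 0) N.comp0)))).add (J.radialCoeff.mul
      (((J.db i).mul N.comp3).add (HasJet.ite (i = 0) (HasJet.const 0) N.comp1)))).add
      ((hasJet_cos.div hasJet_sin fun y hy => sin_ne_zero_of_mem hy).mul
        (HasJet.ite (i = 0) N.comp3 N.comp2))
  refine (h.congr_fun fun y hy => ?_).congr ?_ ?_
  · filter_upwards [J.eventually_mem_domain hy] with z hz
    exact (covD_graph J.pos _ _ (V z.1) hz i).2.2.2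
  · intro y _; fin_cases i <;> simp [pd_const] <;> field_simp
  · intro y hy
    have hs := sin_ne_zero_of_mem hy
    have hK := (contDiffAt_pd (N.smooth y hy) 1).differentiableAt (by simp)
    have hS : DifferentiableAt ℝ (fun y : Chart => (sin (y 0) ^ 2)⁻¹) y :=
      DifferentiableAt.inv (by fun_prop) (pow_ne_zero 2 hs)
    have e1 : ∀ i : Fin 2, pd i (fun y : Chart => (sin (y 0) ^ 2)⁻¹) y =
        if i = 0 then -(2 * cos (y 0) / sin (y 0) ^ 3) else 0 := fun i => by
      rw [pd_comp (F := fun y : Chart => sin (y 0) ^ 2)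
        (hasDerivAt_inv (pow_ne_zero 2 hs)) (by fun_prop)]
      fin_cases i
      · simp [pd_zero_sin_sq]; field_simp
      · simp [pd_coord_ne (fun t => sin t ^ 2) (i := (1 : Fin 2)) (j := 0) (by decide)]
    have e : ∀ i : Fin 2, pd i (fun y => -2 / (r₀ + u) ^ 2 * (pd 1 K y / sin (y 0) ^ 2)) y =
        -2 / (r₀ + u) ^ 2 * (pd i (pd 1 K) y * (sin (y 0) ^ 2)⁻¹ +
          pd 1 K y * if i = 0 then -(2 * cos (y 0) / sin (y 0) ^ 3) else 0) := fun i => by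
      simp only [div_eq_mul_inv (pd 1 K _)]
      rw [pd_const_mul _ (hK.fun_mul hS), pd_mul hK hS, e1]
    simp only [e]
    fin_cases i <;> simp [roundHess, roundGamma, formPert] <;> field_simp <;> ring

/-- The angular part -(2ε/r²)∇K of the normal contributes -2 Hess K, and all other first-order terms
are multiples of the round metric. The components ∂_s and ∂_s̲ of the covariant derivative only meet
df and df̲, which makes them of second order. -/
lemma secondForm (J : LeafJet r₀ u f b F H) (N : NormalJet (r₀ + u) a c V A B K) (i j : Fin 2) :
    HasJet (fun ε y => secondForm r₀ (graphSurface (f ε) (b ε)) (V ε) y i j)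
      (fun y => ((r₀ + u) * a + u * c) * roundMetric y i j)
      (fun y => ((a + c) * radiusPert r₀ u F H y + (r₀ + u) * A y + u * B y
        + a * r₀ / (r₀ + u) * H y) * roundMetric y i j - 2 * roundHess K y i j) := by
  have hr := J.radius_pos.ne'
  simp only [secondForm_graph]
  refine (((J.lapseSq.const_mul 2).mul (((J.covD_zero N i).mul (J.db j)).add
    ((J.covD_one N i).mul (J.df j)))).add ((J.radius.pow 2).mul (HasJet.ite (j = 0)
      (J.covD_two N i) ((hasJet_sin.pow 2).mul (J.covD_three N i))))).congr ?_ ?_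
  · intro y _
    fin_cases i <;> fin_cases j <;> simp [roundMetric] <;> field_simp
  · intro y hy
    have hs := sin_ne_zero_of_mem hy
    fin_cases i <;> fin_cases j <;> simp [roundMetric, formPert] <;> field_simp <;> ring

lemma roundHess_trace (K : Chart → ℝ) (y : Chart) :
    roundHess K y 0 0 + roundHess K y 1 1 / sin (y 0) ^ 2 = roundLap K y := by
  by_cases hs : sin (y 0) = 0
  · simp [roundHess, roundGamma, roundLap_eq, hs]
  · simp [roundHess, roundGamma, roundLap_eq]
    field_simp
    ring

lemma expansion (J : LeafJet r₀ u f b F H) (N : NormalJet (r₀ + u) a c V A B K) :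
    HasJet (fun ε y => expansion r₀ (graphSurface (f ε) (b ε)) (V ε) y)
      (fun _ => 2 * ((r₀ + u) * a + u * c) / (r₀ + u) ^ 2)
      (fun y => 2 * ((a + c) * radiusPert r₀ u F H y + (r₀ + u) * A y + u * B y
        + a * r₀ / (r₀ + u) * H y - roundLap K y
        - 2 * ((r₀ + u) * a + u * c) / (r₀ + u) * radiusPert r₀ u F H y) / (r₀ + u) ^ 2) := by
  have hr := J.radius_pos.ne'
  have I := J.metric.inv
  have S := J.secondForm N
  simp only [CMAFoliation.expansion, trace2, Fin.sum_univ_two]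
  refine ((((I 0 0).mul (S 0 0)).add ((I 0 1).mul (S 0 1))).add
    (((I 1 0).mul (S 1 0)).add ((I 1 1).mul (S 1 1)))).congr ?_ ?_
  · intro y hy
    have hs := sin_ne_zero_of_mem hy
    simp [roundMetric, roundInv]
    field_simp
    ring
  · intro y hy
    have hs := sin_ne_zero_of_mem hy
    rw [← roundHess_trace]
    simp [roundMetric, roundInv]
    field_simp
    ring

/-- Multiples of the round metric drop out, so the shear sees only the trace-free Hessian of the
potential K of the angular part: K = H for the incoming and K = F for the outgoing normal. -/
lemma shear (J : LeafJet r₀ u f b F H) (N : NormalJet (r₀ + u) a c V A B K) (i j : Fin 2) :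
    HasJet (fun ε y => shear r₀ (graphSurface (f ε) (b ε)) (V ε) y i j) (fun _ => 0)
      (fun y => roundLap K y * roundMetric y i j - 2 * roundHess K y i j) := by
  have hr := J.radius_pos.ne'
  simp only [CMAFoliation.shear, Matrix.sub_apply, Matrix.smul_apply, smul_eq_mul]
  refine ((J.secondForm N i j).sub (((J.expansion N).const_mul (1 / 2)).mul
    (J.metric.jet i j))).congr ?_ ?_ <;> intro y _ <;> field_simp <;> ring

/-- The term with ∂F comes from the background expansion of the incoming normal acting on the
angular part of the outgoing one. The rest is the ∂_s-component of ∇L̲, paired with L' through 2Ω².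
-/
lemma torsion (J : LeafJet r₀ u f b F H) {Lb Lp : ℝ → Chart → Fin 4 → ℝ} {A B' : Chart → ℝ}
    (Nb : NormalJet (r₀ + u) 1 0 Lb A (fun _ => 0) H)
    (Np : NormalJet (r₀ + u) 0 1 Lp (fun _ => 0) B' F) (i : Fin 2) :
    HasJet (fun ε y => torsion r₀ (graphSurface (f ε) (b ε)) (Lp ε) (Lb ε) i y) (fun _ => 0)
      (fun y => pd i A y - 1 / (r₀ + u) * pd i F y + u / (r₀ + u) ^ 2 * pd i H y) := by
  have hr := J.radius_pos.ne'
  simp only [CMAFoliation.torsion, ip_schwarzschild, graph_zero, graph_one, graph_two]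
  refine ((((J.lapseSq.const_mul 2).mul (((J.covD_zero Nb i).mul Np.comp1).add
    ((J.covD_one Nb i).mul Np.comp0))).add ((J.radius.pow 2).mul
      (((J.covD_two Nb i).mul Np.comp2).add ((hasJet_sin.pow 2).mul
        ((J.covD_three Nb i).mul Np.comp3))))).const_mul (1 / 2)).congr ?_ ?_
  · intro y _; simp
  · intro y hy
    have hs := sin_ne_zero_of_mem hy
    fin_cases i <;> simp <;> field_simp <;> ring

end LeafJet

/-! ### Linearity of the round Laplacian -/

section RoundLap

variable {F G : Chart → ℝ}

lemma pd_pd_add (hF : ∀ y ∈ chartDomain, ContDiffAt ℝ ∞ F y)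
    (hG : ∀ y ∈ chartDomain, ContDiffAt ℝ ∞ G y) {y : Chart} (hy : y ∈ chartDomain) (i j : Fin 2) :
    pd i (pd j (fun z => F z + G z)) y = pd i (pd j F) y + pd i (pd j G) y := by
  rw [pd_congr_on isOpen_chartDomain (G := fun z => pd j F z + pd j G z)
    (fun z hz => pd_add ((hF z hz).differentiableAt (by simp))
      ((hG z hz).differentiableAt (by simp)) j) hy]
  exact pd_add ((contDiffAt_pd (hF y hy) j).differentiableAt (by simp))
    ((contDiffAt_pd (hG y hy) j).differentiableAt (by simp)) i

lemma pd_pd_const_mul (c : ℝ) (hF : ∀ y ∈ chartDomain, ContDiffAt ℝ ∞ F y) {y : Chart}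
    (hy : y ∈ chartDomain) (i j : Fin 2) :
    pd i (pd j (fun z => c * F z)) y = c * pd i (pd j F) y := by
  rw [pd_congr_on isOpen_chartDomain (G := fun z => c * pd j F z)
    (fun z hz => pd_const_mul c ((hF z hz).differentiableAt (by simp)) j) hy]
  exact pd_const_mul c ((contDiffAt_pd (hF y hy) j).differentiableAt (by simp)) i

lemma roundLap_add (hF : ∀ y ∈ chartDomain, ContDiffAt ℝ ∞ F y)
    (hG : ∀ y ∈ chartDomain, ContDiffAt ℝ ∞ G y) {y : Chart} (hy : y ∈ chartDomain) :
    roundLap (fun z => F z + G z) y = roundLap F y + roundLap G y := by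
  simp only [roundLap_eq, pd_pd_add hF hG hy]
  rw [pd_add ((hF y hy).differentiableAt (by simp)) ((hG y hy).differentiableAt (by simp))]
  ring

lemma roundLap_const_mul (c : ℝ) (hF : ∀ y ∈ chartDomain, ContDiffAt ℝ ∞ F y) {y : Chart}
    (hy : y ∈ chartDomain) : roundLap (fun z => c * F z) y = c * roundLap F y := by
  simp only [roundLap_eq, pd_pd_const_mul c hF hy]
  rw [pd_const_mul c ((hF y hy).differentiableAt (by simp))]
  ring

lemma roundLap_const (c : ℝ) (y : Chart) : roundLap (fun _ => c) y = 0 := by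
  have h : ∀ i : Fin 2, pd i (fun _ : Chart => c) = fun _ => 0 := fun i => by
    funext z; exact pd_const c i z
  simp [roundLap_eq, h, pd_const]

end RoundLap

namespace LeafJet

variable {r₀ u : ℝ} {f b : ℝ → Chart → ℝ} {F H : Chart → ℝ} {Lb Lp : ℝ → Chart → Fin 4 → ℝ}
  {A : Chart → ℝ}

/-- The linearised mass aspect function. -/
lemma massAspect (J : LeafJet r₀ u f b F H) (hA : ∀ y ∈ chartDomain, ContDiffAt ℝ ∞ A y)
    (Nb : NormalJet (r₀ + u) 1 0 Lb A (fun _ => 0) H)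
    (Np : NormalJet (r₀ + u) 0 1 Lp (fun _ => 0) (fun y => -(r₀ / (r₀ + u) ^ 2 * H y) - A y) F) :
    HasJet (fun ε y => massAspect r₀ (graphSurface (f ε) (b ε)) (Lp ε) (Lb ε) y)
      (fun _ => r₀ / (r₀ + u) ^ 3)
      (fun y => -(3 * r₀ / (r₀ + u) ^ 4) * radiusPert r₀ u F H y
        - u / (r₀ + u) ^ 4 * roundLap H y + roundLap F y / (r₀ + u) ^ 3
        - roundLap A y / (r₀ + u) ^ 2) := by
  have hr := J.radius_pos.ne'
  have h := (J.metric.gaussCurvature.sub (((J.expansion Np).const_mul (1 / 4)).mul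
    (J.expansion Nb))).sub (J.metric.divergence (J.torsion Nb Np))
  refine h.congr ?_ ?_
  · intro y _
    simp [roundDiv, pd_const]
    field_simp
    ring
  · intro y hy
    have hF' : ∀ y ∈ chartDomain, ContDiffAt ℝ ∞ (fun z => -(1 / (r₀ + u)) * F z) y :=
      fun y hy => contDiffAt_const.mul (J.smoothF y hy)
    have hH' : ∀ y ∈ chartDomain, ContDiffAt ℝ ∞ (fun z => u / (r₀ + u) ^ 2 * H z) y :=
      fun y hy => contDiffAt_const.mul (J.smoothH y hy)
    have e0 : roundDiv (fun (_ : Fin 2) (_ : Chart) => (0 : ℝ)) y = 0 := by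
      simp [roundDiv, pd_const]
    have e1 : roundDiv (fun i y => pd i A y - 1 / (r₀ + u) * pd i F y
        + u / (r₀ + u) ^ 2 * pd i H y) y =
        roundLap A y - 1 / (r₀ + u) * roundLap F y + u / (r₀ + u) ^ 2 * roundLap H y := by
      have e2 : ∀ i : Fin 2, ∀ z ∈ chartDomain, pd i A z - 1 / (r₀ + u) * pd i F z
          + u / (r₀ + u) ^ 2 * pd i H z =
          pd i (fun z => (A z + -(1 / (r₀ + u)) * F z) + u / (r₀ + u) ^ 2 * H z) z := by
        intro i z hz
        rw [pd_add (((hA z hz).add (hF' z hz)).differentiableAt (by simp))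
          ((hH' z hz).differentiableAt (by simp)), pd_add ((hA z hz).differentiableAt (by simp))
          ((hF' z hz).differentiableAt (by simp)),
          pd_const_mul _ ((J.smoothF z hz).differentiableAt (by simp)),
          pd_const_mul _ ((J.smoothH z hz).differentiableAt (by simp))]
        ring
      have e3 : roundDiv (fun i y => pd i A y - 1 / (r₀ + u) * pd i F y
          + u / (r₀ + u) ^ 2 * pd i H y) y =
          roundLap (fun z => (A z + -(1 / (r₀ + u)) * F z) + u / (r₀ + u) ^ 2 * H z) y := by
        simp only [roundLap, roundDiv, pd_congr_on isOpen_chartDomain (e2 0) hy,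
          pd_congr_on isOpen_chartDomain (e2 1) hy, e2 0 y hy]
      rw [e3, roundLap_add (fun y hy => (hA y hy).add (hF' y hy)) hH' hy, roundLap_add hA hF' hy,
        roundLap_const_mul _ J.smoothF hy, roundLap_const_mul _ J.smoothH hy]
      ring
    have e4 : roundLap (fun y => radiusPert r₀ u F H y / (r₀ + u)) y =
        1 / (r₀ + u) * (roundLap F y + u / (r₀ + u) * roundLap H y) := by
      simp only [div_eq_inv_mul (radiusPert r₀ u F H _)]
      rw [roundLap_const_mul _ (fun y hy => J.smoothPert hy) hy]
      unfold radiusPert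
      rw [roundLap_add J.smoothF (fun y hy => contDiffAt_const.mul (J.smoothH y hy)) hy,
        roundLap_const_mul _ J.smoothH hy]
      simp
    rw [e0, e1, e4]
    field_simp
    ring

end LeafJet

/-! ### The curvature component `ρ` -/

/-- Product rule for contraction with a vector that equals a basis vector at ε = 0. Four successive
uses linearise the contraction defining ρ. -/
lemma hasDerivAt_contract {T : Fin 4 → ℝ → ℝ} {T' : Fin 4 → ℝ} {v : Fin 4 → ℝ → ℝ}
    {v' : Fin 4 → ℝ} {k : Fin 4} (hT : ∀ a, HasDerivAt (T a) (T' a) 0)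
    (hv : ∀ a, HasDerivAt (v a) (v' a) 0) (h0 : ∀ a, v a 0 = if a = k then 1 else 0) :
    HasDerivAt (fun ε => ∑ a, T a ε * v a ε) (T' k + ∑ a, T a 0 * v' a) 0 := by
  have h := HasDerivAt.fun_sum (u := Finset.univ) fun a _ => (hT a).fun_mul (hv a)
  refine h.congr_deriv ?_
  simp [Finset.sum_add_distrib, h0]

namespace LeafJet

variable {r₀ u : ℝ} {f b : ℝ → Chart → ℝ} {F H : Chart → ℝ} {Lb Lp : ℝ → Chart → Fin 4 → ℝ}
  {A : Chart → ℝ}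

lemma hasDerivAt_graph (J : LeafJet r₀ u f b F H) {y : Chart} (hy : y ∈ chartDomain) :
    HasDerivAt (fun ε => graphSurface (f ε) (b ε) y) ![F y, H y, 0, 0] 0 := by
  rw [hasDerivAt_pi]
  intro i
  fin_cases i
  · exact J.jf.hasDerivAt hy
  · exact J.jb.hasDerivAt hy
  · exact hasDerivAt_const _ _
  · exact hasDerivAt_const _ _

/-- All frame variations cancel. The rescalings of L' and L̲ are inverse to each other up to the
factor Ω⁻², which absorbs the variation of Ω⁴ in the curvature component, and the angular tilts are
killed by symmetry. What remains is the variation of -r₀/r³ under the change of radius. -/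
lemma rho (J : LeafJet r₀ u f b F H)
    (Nb : NormalJet (r₀ + u) 1 0 Lb A (fun _ => 0) H)
    (Np : NormalJet (r₀ + u) 0 1 Lp (fun _ => 0) (fun y => -(r₀ / (r₀ + u) ^ 2 * H y) - A y) F)
    {y : Chart} (hy : y ∈ chartDomain) :
    rhoComponent r₀ (graphSurface (f 0) (b 0)) (Lp 0) (Lb 0) y = -r₀ / (r₀ + u) ^ 3 ∧
    HasDerivAt (fun ε => rhoComponent r₀ (graphSurface (f ε) (b ε)) (Lp ε) (Lb ε) y)
      (3 * r₀ / (r₀ + u) ^ 4 * radiusPert r₀ u F H y) 0 := by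
  have hr := J.radius_pos.ne'
  set X : ℝ → Fin 4 → ℝ := fun ε => graphSurface (f ε) (b ε) y with hX
  have hmem : ∀ᶠ ε in 𝓝 (0 : ℝ), X ε ∈ domain4 r₀ := by
    have : Tendsto (fun ε : ℝ => (ε, y)) (𝓝 0) (𝓝 (0, y)) :=
      (Continuous.tendsto (by fun_prop) 0)
    exact this.eventually (J.eventually_mem_domain hy)
  have h0 : X 0 ∈ domain4 r₀ := hmem.self_of_nhds
  set Rm : Fin 4 → Fin 4 → Fin 4 → Fin 4 → ℝ → ℝ :=
    fun a b c d ε => riemann (schwarzschild r₀) (X ε) a b c d with hRm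
  have hd : ∀ a b c d, HasDerivAt (Rm a b c d) (deriv (Rm a b c d) 0) 0 := fun a b c d => by
    refine DifferentiableAt.hasDerivAt ?_
    exact DifferentiableAt.comp (g := fun z => riemann (schwarzschild r₀) z a b c d) (f := X) 0
      ((contDiffAt_riemann_schwarzschild J.pos h0 a b c d).differentiableAt (by simp))
      (J.hasDerivAt_graph hy).differentiableAt
  have hLp : ∀ a, HasDerivAt (fun ε => Lp ε y a) ((![0, -(r₀ / (r₀ + u) ^ 2 * H y) - A y,
      -2 / (r₀ + u) ^ 2 * pd 0 F y, -2 / (r₀ + u) ^ 2 * (pd 1 F y / sin (y 0) ^ 2)] :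
      Fin 4 → ℝ) a) 0 := fun a => by
    fin_cases a
    · exact Np.comp0.hasDerivAt hy
    · exact Np.comp1.hasDerivAt hy
    · exact Np.comp2.hasDerivAt hy
    · exact Np.comp3.hasDerivAt hy
  have hLb : ∀ a, HasDerivAt (fun ε => Lb ε y a) ((![A y, 0,
      -2 / (r₀ + u) ^ 2 * pd 0 H y, -2 / (r₀ + u) ^ 2 * (pd 1 H y / sin (y 0) ^ 2)] :
      Fin 4 → ℝ) a) 0 := fun a => by
    fin_cases a
    · exact Nb.comp0.hasDerivAt hy
    · exact Nb.comp1.hasDerivAt hy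
    · exact Nb.comp2.hasDerivAt hy
    · exact Nb.comp3.hasDerivAt hy
  have hLp0 : ∀ a, Lp 0 y a = if a = 1 then 1 else 0 := fun a => by
    fin_cases a
    · exact Np.comp0.value hy
    · exact Np.comp1.value hy
    · exact Np.comp2.value hy
    · exact Np.comp3.value hy
  have hLb0 : ∀ a, Lb 0 y a = if a = 0 then 1 else 0 := fun a => by
    fin_cases a
    · exact Nb.comp0.value hy
    · exact Nb.comp1.value hy
    · exact Nb.comp2.value hy
    · exact Nb.comp3.value hy
  have h1 := fun a b c => hasDerivAt_contract (hd a b c) hLp hLp0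
  have h2 := fun a b => hasDerivAt_contract (h1 a b) hLb hLb0
  have h3 := fun a => hasDerivAt_contract (h2 a) hLb hLb0
  have h4 := (hasDerivAt_contract h3 hLp hLp0).const_mul (1 / 4)
  have hrho : ∀ ε, rhoComponent r₀ (graphSurface (f ε) (b ε)) (Lp ε) (Lb ε) y =
      1 / 4 * ∑ a, (∑ b, (∑ c, (∑ d, Rm a b c d ε * Lp ε y d) * Lb ε y c) * Lb ε y b)
        * Lp ε y a := fun ε => by
    simp only [rhoComponent, hRm, hX, Finset.sum_mul]
    congr 1
    refine Finset.sum_congr rfl fun a _ => Finset.sum_congr rfl fun b _ =>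
      Finset.sum_congr rfl fun c _ => Finset.sum_congr rfl fun d _ => by ring
  have hval : (fun ε => Rm 1 0 0 1 ε) =ᶠ[𝓝 0] fun ε => -4 * r₀ * omegaSq r₀ (f ε y) (b ε y) ^ 2 /
      schwR r₀ (f ε y) (b ε y) ^ 3 := by
    filter_upwards [hmem] with ε hε using riemann_tsst J.pos hε
  have hjet := ((((HasJet.const (-4 * r₀)).mul (J.lapseSq.pow 2)).div (J.radius.pow 3)
    fun y _ => pow_ne_zero 3 hr))
  have hd1 := ((hjet.hasDerivAt hy).congr_of_eventuallyEq hval).deriv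
  have hv1 : Rm 1 0 0 1 0 = -4 * r₀ / (r₀ + u) ^ 3 := by
    have h5 : Rm 1 0 0 1 0 = _ := hval.self_of_nhds
    simp only [h5, J.lapseSq.value hy, J.radius.value hy]; ring
  have s2 := riemann_single_angular J.pos h0 (i := 2) (Or.inl rfl)
  have s3 := riemann_single_angular J.pos h0 (i := 3) (Or.inr rfl)
  constructor
  · rw [hrho]
    simp only [hLp0, hLb0]
    simp only [mul_ite, mul_one, mul_zero, Finset.sum_ite_eq', Finset.mem_univ, if_true, hv1]
    ring
  · refine (h4.congr_of_eventuallyEq (Filter.Eventually.of_forall hrho)).congr_deriv ?_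
    simp only [hLp0, hLb0, mul_ite, mul_one, mul_zero, Finset.sum_ite_eq', Finset.mem_univ,
      if_true, Fin.sum_univ_four]
    have t1 : Rm 2 0 0 1 0 = 0 := s2.1
    have t2 : Rm 1 2 0 1 0 = 0 := s2.2.1
    have t3 : Rm 1 0 2 1 0 = 0 := s2.2.2.1
    have t4 : Rm 1 0 0 2 0 = 0 := s2.2.2.2
    have t5 : Rm 3 0 0 1 0 = 0 := s3.1
    have t6 : Rm 1 3 0 1 0 = 0 := s3.2.1
    have t7 : Rm 1 0 3 1 0 = 0 := s3.2.2.1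
    have t8 : Rm 1 0 0 3 0 = 0 := s3.2.2.2
    have hd1' : deriv (Rm 1 0 0 1) 0 = _ := hd1
    rw [hd1', hv1, t1, t2, t3, t4, t5, t6, t7, t8]
    simp
    field_simp
    ring

end LeafJet

/-! ### Jets of the geometry of the leaves of a varied foliation -/

/-- The function `δ_u` in the chart. -/
def slice (δ : ℝ → S2 → ℝ) (u : ℝ) (y : Chart) : ℝ := δ u (sph y)

/-- The function `∂_u δ_u` in the chart. -/
def rate (δ : ℝ → S2 → ℝ) (u : ℝ) (y : Chart) : ℝ := deriv (fun v => δ v (sph y)) u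

lemma SmoothOnRS2.contDiff_slice {δ : ℝ → S2 → ℝ} (h : SmoothOnRS2 δ) (u : ℝ) :
    ContDiff ℝ ∞ (slice δ u) :=
  ContDiff.comp (g := fun p : ℝ × Chart => δ p.1 (sph p.2)) (f := fun y => (u, y)) h.contDiff
    (contDiff_const.prodMk contDiff_id)

lemma SmoothOnRS2.contDiff_rate {δ : ℝ → S2 → ℝ} (h : SmoothOnRS2 δ) (u : ℝ) :
    ContDiff ℝ ∞ (rate δ u) :=
  ContDiff.comp (g := fun p : ℝ × Chart => deriv (fun v => δ v (sph p.2)) p.1)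
    (f := fun y => (u, y)) h.contDiff_deriv (contDiff_const.prodMk contDiff_id)

section Foliation

variable {r₀ u : ℝ} {δh δf : ℝ → S2 → ℝ}

lemma leafJet (hr₀ : 0 < r₀) (hu : 0 ≤ u) (hh : SmoothOnRS2 δh) (hf : SmoothOnRS2 δf) :
    LeafJet r₀ u (fun ε y => varF δf ε u (sph y))
      (fun ε y => varH δh ε (varF δf ε u (sph y)) (sph y)) (slice δf u) (slice δh u) where
  pos := hr₀
  nonneg := hu
  jf := by
    refine ((HasJet.const u).add (HasJet.eps_mul fun y _ =>
      (hf.contDiff_slice u).contDiffAt)).congr ?_ ?_ <;> intro y _ <;> simp [slice]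
  jb := fun y _ => by
    have hc : ContDiff ℝ ∞ (fun p : ℝ × Chart => δh (u + p.1 * δf u (sph p.2)) (sph p.2)) := by
      have h1 : ContDiff ℝ ∞ (fun p : ℝ × Chart => (u + p.1 * δf u (sph p.2), p.2)) :=
        (contDiff_const.add (contDiff_fst.mul ((hf.contDiff_slice u).comp contDiff_snd))).prodMk
          contDiff_snd
      exact hh.contDiff.comp h1
    refine ⟨(contDiff_fst.mul hc).contDiffAt, by simp [varH], ?_⟩
    have hd : DifferentiableAt ℝ (fun ε : ℝ => δh (u + ε * δf u (sph y)) (sph y)) 0 :=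
      ((hc.comp (contDiff_id.prodMk contDiff_const)).differentiable (by simp)) 0
    -- The shift of the argument of δh is multiplied by the prefactor ε, so it is of second order
    -- and δh is read at the unperturbed u.
    have h2 := (hasDerivAt_id (0 : ℝ)).fun_mul hd.hasDerivAt
    simpa [varH, varF, slice] using h2
  smoothF y _ := (hf.contDiff_slice u).contDiffAt
  smoothH y _ := (hh.contDiff_slice u).contDiffAt

/-- The tangential term in the denominator is a product of two first-order quantities, so the lapse
varies by ∂_u δf only. -/
lemma lapse_jet (hr₀ : 0 < r₀) (hu : 0 ≤ u) (hh : SmoothOnRS2 δh) (hf : SmoothOnRS2 δf) :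
    HasJet (fun ε y => lapse r₀ (varH δh ε) (varF δf ε) u y) (fun _ => 1) (rate δf u) := by
  have J := leafJet hr₀ hu hh hf
  have hd : ∀ ε y, deriv (fun v => varF δf ε v (sph y)) u = 1 + ε * rate δf u y := fun ε y =>
    ((hasDerivAt_id u).add ((hf.differentiableAt u y).hasDerivAt.const_mul ε)).deriv
  have hn : HasJet (fun ε y => deriv (fun v => varF δf ε v (sph y)) u) (fun _ => 1)
      (rate δf u) := by
    simp only [hd]
    refine ((HasJet.const 1).add (HasJet.eps_mul fun y _ =>
      (hf.contDiff_rate u).contDiffAt)).congr ?_ ?_ <;> intro y _ <;> simp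
  have hden := (HasJet.const 1).sub ((J.incoming.comp2.mul (J.df 0)).add
    (J.incoming.comp3.mul (J.df 1)))
  refine (hn.div hden fun y _ => by norm_num).congr ?_ ?_ <;> intro y _ <;> simp

lemma folLb_jet (hr₀ : 0 < r₀) (hu : 0 ≤ u) (hh : SmoothOnRS2 δh) (hf : SmoothOnRS2 δf) :
    NormalJet (r₀ + u) 1 0 (fun ε => folLb r₀ (varH δh ε) (varF δf ε) u)
      (rate δf u) (fun _ => 0) (slice δh u) := by
  have := (leafJet hr₀ hu hh hf).incoming.smul (lapse_jet hr₀ hu hh hf)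
  simp only [zero_mul, zero_add, add_zero, one_mul] at this
  exact this

lemma folLp_jet (hr₀ : 0 < r₀) (hu : 0 ≤ u) (hh : SmoothOnRS2 δh) (hf : SmoothOnRS2 δf) :
    NormalJet (r₀ + u) 0 1 (fun ε => folLp r₀ (varH δh ε) (varF δf ε) u)
      (fun _ => 0) (fun y => -(r₀ / (r₀ + u) ^ 2 * slice δh u y) - rate δf u y) (slice δf u) := by
  have hl := ((lapse_jet hr₀ hu hh hf).inv fun y _ => one_ne_zero).congr
    (p := fun _ => 1) (dp := fun y => -rate δf u y) (fun _ _ => by norm_num) (fun _ _ => by ring)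
  have := (leafJet hr₀ hu hh hf).conjugate.smul hl
  simp only [zero_mul, zero_add, one_mul, ← sub_eq_add_neg] at this
  exact this

lemma folMassAspect_jet (hr₀ : 0 < r₀) (hu : 0 ≤ u) (hh : SmoothOnRS2 δh) (hf : SmoothOnRS2 δf) :
    HasJet (fun ε y => folMassAspect r₀ (varH δh ε) (varF δf ε) u y)
      (fun _ => r₀ / (r₀ + u) ^ 3)
      (fun y => -(3 * r₀ / (r₀ + u) ^ 4) * radiusPert r₀ u (slice δf u) (slice δh u) y
        - u / (r₀ + u) ^ 4 * roundLap (slice δh u) y + roundLap (slice δf u) y / (r₀ + u) ^ 3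
        - roundLap (rate δf u) y / (r₀ + u) ^ 2) :=
  (leafJet hr₀ hu hh hf).massAspect (fun _ _ => (hf.contDiff_rate u).contDiffAt)
    (folLb_jet hr₀ hu hh hf) (folLp_jet hr₀ hu hh hf)

/-- The linearised null condition. -/
lemma nullity_hasDerivAt (hr₀ : 0 < r₀) {s : ℝ} (hs : 0 ≤ s) (hh : SmoothOnRS2 δh) {y : Chart}
    (hy : y ∈ chartDomain) :
    HasDerivAt (fun ε => nullity r₀ (varH δh ε) s y) (-rate δh s y) 0 := by
  have J : LeafJet r₀ s (fun _ _ => s) (fun ε y => ε * slice δh s y) (fun _ => 0) (slice δh s) :=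
    { pos := hr₀
      nonneg := hs
      jf := HasJet.const s
      jb := HasJet.eps_mul fun y _ => (hh.contDiff_slice s).contDiffAt
      smoothF := fun _ _ => contDiffAt_const
      smoothH := fun y _ => (hh.contDiff_slice s).contDiffAt }
  have hr := J.radius_pos.ne'
  have hR := J.radius
  have hW := J.lapseSq
  have hd : ∀ ε, deriv (fun σ => varH δh ε σ (sph y)) s = ε * rate δh s y := fun ε =>
    ((hh.differentiableAt s y).hasDerivAt.const_mul ε).deriv
  have hpd : ∀ (ε : ℝ) (i : Fin 2), pd i (fun z => varH δh ε s (sph z)) y =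
      ε * pd i (slice δh s) y := fun ε i =>
    pd_const_mul ε ((hh.contDiff_slice s).differentiable (by simp) y) i
  have h := (((HasJet.eps_mul fun y _ => (hh.contDiff_rate s).contDiffAt).neg.div hW
    fun _ _ => one_ne_zero).add
      (((HasJet.eps_mul fun y _ => (contDiff_pd (hh.contDiff_slice s) 0).contDiffAt).pow 2).div
        (hR.pow 2) fun _ _ => pow_ne_zero 2 hr)).add
      (((HasJet.eps_mul fun y _ => (contDiff_pd (hh.contDiff_slice s) 1).contDiffAt).pow 2).div
        ((hR.pow 2).mul (hasJet_sin.pow 2)) fun y hy =>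
          mul_ne_zero (pow_ne_zero 2 hr) (pow_ne_zero 2 (sin_ne_zero_of_mem hy)))
  have h' := h.hasDerivAt hy
  refine (h'.congr_of_eventuallyEq ?_).congr_deriv (by simp)
  have hmem : ∀ᶠ ε in 𝓝 (0 : ℝ), graphSurface (fun _ => s) (fun y => ε * slice δh s y) y ∈
      domain4 r₀ := by
    have : Tendsto (fun ε : ℝ => (ε, y)) (𝓝 0) (𝓝 (0, y)) :=
      (Continuous.tendsto (by fun_prop) 0)
    exact this.eventually (J.eventually_mem_domain hy)
  filter_upwards [hmem] with ε hε
  have hε' : ![s, varH δh ε s (sph y), y 0, y 1] ∈ domain4 r₀ := hε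
  simp only [nullity, schwarzschild_inv hr₀ hε', hd, hpd, Fin.sum_univ_four]
  have hsin := sin_ne_zero_of_mem hy
  have hW0 := (omegaSq_pos hr₀ hε'.1).ne'
  have hR0 := (schwR_pos hr₀ hε'.1).ne'
  simp only [varH, slice] at hW0 hR0 ⊢
  simp at hW0 hR0 ⊢
  field_simp
  ring

end Foliation

/-! ### Linear functions on the sphere -/

/-- The linear function `ϑ ↦ ⟨w, ϑ⟩` in the chart. -/
def zeta (w : E3) (y : Chart) : ℝ := inner ℝ w (sph y : E3)

lemma zeta_eq (w : E3) (y : Chart) : zeta w y =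
    w 0 * (sin (y 0) * cos (y 1)) + w 1 * (sin (y 0) * sin (y 1)) + w 2 * cos (y 0) := by
  simp [zeta, sph, PiLp.inner_apply, Fin.sum_univ_three]
  ring

lemma contDiff_zeta (w : E3) : ContDiff ℝ ∞ (zeta w) := by
  have : zeta w = fun y => w 0 * (sin (y 0) * cos (y 1)) + w 1 * (sin (y 0) * sin (y 1))
    + w 2 * cos (y 0) := funext (zeta_eq w)
  rw [this]; fun_prop

lemma pd_zero_zeta (w : E3) (y : Chart) : pd 0 (zeta w) y =
    w 0 * (cos (y 0) * cos (y 1)) + w 1 * (cos (y 0) * sin (y 1)) - w 2 * sin (y 0) := by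
  have h : HasDerivAt (fun t => w 0 * (sin t * cos (y 1)) + w 1 * (sin t * sin (y 1))
      + w 2 * cos t) (w 0 * (cos (y 0) * cos (y 1)) + w 1 * (cos (y 0) * sin (y 1))
      + w 2 * -sin (y 0)) (y 0) :=
    ((((hasDerivAt_sin (y 0)).mul_const _).const_mul _).add
      (((hasDerivAt_sin (y 0)).mul_const _).const_mul _)).add ((hasDerivAt_cos (y 0)).const_mul _)
  have h2 := h.deriv
  simp only [pd, zeta_eq]
  simp only [Function.update_self, ne_eq, one_ne_zero, not_false_eq_true, Function.update_of_ne]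
  rw [h2]; ring

lemma pd_one_zeta (w : E3) (y : Chart) : pd 1 (zeta w) y =
    sin (y 0) * (w 1 * cos (y 1) - w 0 * sin (y 1)) := by
  have h : HasDerivAt (fun t => w 0 * (sin (y 0) * cos t) + w 1 * (sin (y 0) * sin t)
      + w 2 * cos (y 0)) (w 0 * (sin (y 0) * -sin (y 1)) + w 1 * (sin (y 0) * cos (y 1))) (y 1) :=
    ((((hasDerivAt_cos (y 1)).const_mul _).const_mul _).add
      (((hasDerivAt_sin (y 1)).const_mul _).const_mul _)).add_const _
  have h2 := h.deriv
  simp only [pd, zeta_eq]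
  simp only [Function.update_self, ne_eq, zero_ne_one, not_false_eq_true, Function.update_of_ne]
  rw [h2]; ring

lemma pd_zero_zero_zeta (w : E3) (y : Chart) : pd 0 (pd 0 (zeta w)) y = -zeta w y := by
  have e : pd 0 (zeta w) = fun y => w 0 * (cos (y 0) * cos (y 1)) + w 1 * (cos (y 0) * sin (y 1))
    - w 2 * sin (y 0) := funext (pd_zero_zeta w)
  have h : HasDerivAt (fun t => w 0 * (cos t * cos (y 1)) + w 1 * (cos t * sin (y 1))
      - w 2 * sin t) (w 0 * (-sin (y 0) * cos (y 1)) + w 1 * (-sin (y 0) * sin (y 1))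
      - w 2 * cos (y 0)) (y 0) :=
    ((((hasDerivAt_cos (y 0)).mul_const _).const_mul _).add
      (((hasDerivAt_cos (y 0)).mul_const _).const_mul _)).sub ((hasDerivAt_sin (y 0)).const_mul _)
  have h2 := h.deriv
  rw [e, zeta_eq]
  simp only [pd]
  simp only [Function.update_self, ne_eq, one_ne_zero, not_false_eq_true, Function.update_of_ne]
  rw [h2]; ring

lemma pd_zero_one_zeta (w : E3) (y : Chart) : pd 0 (pd 1 (zeta w)) y =
    cos (y 0) * (w 1 * cos (y 1) - w 0 * sin (y 1)) := by
  have e : pd 1 (zeta w) = fun y => sin (y 0) * (w 1 * cos (y 1) - w 0 * sin (y 1)) :=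
    funext (pd_one_zeta w)
  have h2 := ((hasDerivAt_sin (y 0)).mul_const (w 1 * cos (y 1) - w 0 * sin (y 1))).deriv
  rw [e]
  simp only [pd]
  simp only [Function.update_self, ne_eq, one_ne_zero, not_false_eq_true, Function.update_of_ne]
  rw [h2]

lemma pd_one_one_zeta (w : E3) (y : Chart) : pd 1 (pd 1 (zeta w)) y =
    -(sin (y 0) ^ 2 * zeta w y + sin (y 0) * cos (y 0) * pd 0 (zeta w) y) := by
  have e : pd 1 (zeta w) = fun y => sin (y 0) * (w 1 * cos (y 1) - w 0 * sin (y 1)) :=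
    funext (pd_one_zeta w)
  have h : HasDerivAt (fun t => sin (y 0) * (w 1 * cos t - w 0 * sin t))
      (sin (y 0) * (w 1 * -sin (y 1) - w 0 * cos (y 1))) (y 1) :=
    (((hasDerivAt_cos (y 1)).const_mul _).sub ((hasDerivAt_sin (y 1)).const_mul _)).const_mul _
  have h2 := h.deriv
  rw [e, zeta_eq, pd_zero_zeta]
  simp only [pd]
  simp only [Function.update_self, ne_eq, zero_ne_one, not_false_eq_true, Function.update_of_ne]
  rw [h2]
  linear_combination (w 0 * sin (y 0) * cos (y 1) + w 1 * sin (y 0) * sin (y 1)) *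
    sin_sq_add_cos_sq (y 0)

/-- The Hessian of a linear function restricted to the unit sphere comes entirely from the second
fundamental form of the sphere. That it is pure trace makes the linearised shears vanish and keeps
the zonal tensors below in the span of g and dζ ⊗ dζ. -/
lemma roundHess_zeta (w : E3) {y : Chart} (hy : y ∈ chartDomain) (i j : Fin 2) :
    roundHess (zeta w) y i j = -zeta w y * roundMetric y i j := by
  have hs := sin_ne_zero_of_mem hy
  have hc : pd 1 (pd 0 (zeta w)) y = pd 0 (pd 1 (zeta w)) y :=
    pd_comm (contDiff_zeta w).contDiffAt 1 0
  fin_cases i <;> fin_cases j <;> simp [roundHess, roundGamma, roundMetric, pd_zero_zero_zeta,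
    hc, pd_zero_one_zeta, pd_one_one_zeta, pd_one_zeta] <;> field_simp <;> ring

lemma roundLap_zeta (w : E3) {y : Chart} (hy : y ∈ chartDomain) :
    roundLap (zeta w) y = -2 * zeta w y := by
  have hs := sin_ne_zero_of_mem hy
  rw [← LeafJet.roundHess_trace, roundHess_zeta w hy, roundHess_zeta w hy]
  simp [roundMetric]
  field_simp
  ring

/-- The gradient of ⟨w, ·⟩ at ϑ is the tangential projection w - ⟨w, ϑ⟩ϑ. -/
lemma gradient_zeta (w v : E3) {y : Chart} (hy : y ∈ chartDomain) :
    pd 0 (zeta w) y * pd 0 (zeta v) y + pd 1 (zeta w) y * pd 1 (zeta v) y / sin (y 0) ^ 2 =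
      inner ℝ w v - zeta w y * zeta v y := by
  have hs := sin_ne_zero_of_mem hy
  have e : inner ℝ w v = w 0 * v 0 + w 1 * v 1 + w 2 * v 2 := by
    simp [PiLp.inner_apply, Fin.sum_univ_three]; ring
  rw [e, pd_zero_zeta, pd_zero_zeta, pd_one_zeta, pd_one_zeta, zeta_eq, zeta_eq]
  have h0 := sin_sq_add_cos_sq (y 0)
  have h1 := sin_sq_add_cos_sq (y 1)
  have e2 : sin (y 0) * (w 1 * cos (y 1) - w 0 * sin (y 1)) *
      (sin (y 0) * (v 1 * cos (y 1) - v 0 * sin (y 1))) / sin (y 0) ^ 2 =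
      (w 1 * cos (y 1) - w 0 * sin (y 1)) * (v 1 * cos (y 1) - v 0 * sin (y 1)) := by
    field_simp
  rw [e2]
  linear_combination ((w 0 * cos (y 1) + w 1 * sin (y 1)) * (v 0 * cos (y 1) + v 1 * sin (y 1))
    + w 2 * v 2) * h0 + (w 0 * v 0 + w 1 * v 1) * h1

lemma abs_zeta_le (w : E3) (y : Chart) : |zeta w y| ≤ ‖w‖ := by
  have h := abs_real_inner_le_norm w (sph y : E3)
  have h1 : ‖(sph y : E3)‖ = 1 := by simp
  rwa [h1, mul_one] at h

/-! ### Zonal families -/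

/-- The family `Q ε` depends only on `ε` and on the linear function of `w`, smoothly near `ε = 0`;
for `ε = 0` it is `q` of the linear function. -/
def Zonal (w : E3) (Q : ℝ → Chart → ℝ) (q : ℝ → ℝ) : Prop :=
  ∃ φ : ℝ × ℝ → ℝ, (∀ z, ContDiffAt ℝ ∞ φ (0, z)) ∧ (∀ z, φ (0, z) = q z) ∧
    ∀ᶠ ε in 𝓝 (0 : ℝ), ∀ y ∈ chartDomain, Q ε y = φ (ε, zeta w y)

/-- The values of `zeta w` fill at most the compact interval [-‖w‖, ‖w‖], so pointwise smallness of
ε becomes uniform over the sphere, up to and including the poles. -/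
lemma eventually_forall_zeta (w : E3) {P : ℝ → ℝ → Prop}
    (h : ∀ z, ∀ᶠ p : ℝ × ℝ in 𝓝 (0, z), P p.1 p.2) :
    ∀ᶠ ε in 𝓝 (0 : ℝ), ∀ y, P ε (zeta w y) := by
  have h1 := (isCompact_Icc (a := -‖w‖) (b := ‖w‖)).eventually_forall_of_forall_eventually
    (x₀ := (0 : ℝ)) (P := P) fun z _ => h z
  filter_upwards [h1] with ε hε y using hε _ (abs_le.1 (abs_zeta_le w y))

namespace Zonal

variable {w : E3} {Q P : ℝ → Chart → ℝ} {q p : ℝ → ℝ}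

lemma congr_fun (h : Zonal w Q q) (hP : ∀ᶠ ε in 𝓝 (0 : ℝ), ∀ y ∈ chartDomain, P ε y = Q ε y) :
    Zonal w P q := by
  obtain ⟨φ, h1, h2, h3⟩ := h
  refine ⟨φ, h1, h2, ?_⟩
  filter_upwards [h3, hP] with ε h4 h5 y hy using (h5 y hy).trans (h4 y hy)

lemma congr (h : Zonal w Q q) (hq : ∀ z, q z = p z) : Zonal w Q p := by
  obtain ⟨φ, h1, h2, h3⟩ := h
  exact ⟨φ, h1, fun z => (h2 z).trans (hq z), h3⟩

lemma const (c : ℝ) : Zonal w (fun _ _ => c) (fun _ => c) :=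
  ⟨fun _ => c, fun _ => contDiffAt_const, fun _ => rfl, Eventually.of_forall fun _ _ _ => rfl⟩

lemma zeta : Zonal w (fun _ y => zeta w y) (fun z => z) :=
  ⟨fun p => p.2, fun _ => contDiffAt_snd, fun _ => rfl, Eventually.of_forall fun _ _ _ => rfl⟩

lemma eps : Zonal w (fun ε _ => ε) (fun _ => 0) :=
  ⟨fun p => p.1, fun _ => contDiffAt_fst, fun _ => rfl, Eventually.of_forall fun _ _ _ => rfl⟩

lemma comp₂ {G : ℝ × ℝ → ℝ} (hQ : Zonal w Q q) (hP : Zonal w P p)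
    (hG : ∀ z, ContDiffAt ℝ ∞ G (q z, p z)) :
    Zonal w (fun ε y => G (Q ε y, P ε y)) (fun z => G (q z, p z)) := by
  obtain ⟨φ, h1, h2, h3⟩ := hQ
  obtain ⟨ψ, k1, k2, k3⟩ := hP
  refine ⟨fun x => G (φ x, ψ x), fun z => ?_, fun z => by simp only [h2, k2], ?_⟩
  · have : ContDiffAt ℝ ∞ G (φ (0, z), ψ (0, z)) := by rw [h2, k2]; exact hG z
    exact this.comp (0, z) ((h1 z).prodMk (k1 z))
  · filter_upwards [h3, k3] with ε h4 k4 y hy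
    simp only [h4 y hy, k4 y hy]

lemma comp {g : ℝ → ℝ} (hQ : Zonal w Q q) (hg : ∀ z, ContDiffAt ℝ ∞ g (q z)) :
    Zonal w (fun ε y => g (Q ε y)) (fun z => g (q z)) :=
  hQ.comp₂ (G := fun x => g x.1) hQ fun z =>
    ContDiffAt.comp (g := g) (f := Prod.fst) (q z, q z) (hg z) contDiffAt_fst

lemma add (hQ : Zonal w Q q) (hP : Zonal w P p) :
    Zonal w (fun ε y => Q ε y + P ε y) (fun z => q z + p z) :=
  hQ.comp₂ (G := fun x => x.1 + x.2) hP fun _ => contDiffAt_fst.add contDiffAt_snd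

lemma sub (hQ : Zonal w Q q) (hP : Zonal w P p) :
    Zonal w (fun ε y => Q ε y - P ε y) (fun z => q z - p z) :=
  hQ.comp₂ (G := fun x => x.1 - x.2) hP fun _ => contDiffAt_fst.sub contDiffAt_snd

lemma mul (hQ : Zonal w Q q) (hP : Zonal w P p) :
    Zonal w (fun ε y => Q ε y * P ε y) (fun z => q z * p z) :=
  hQ.comp₂ (G := fun x => x.1 * x.2) hP fun _ => contDiffAt_fst.mul contDiffAt_snd

lemma neg (hQ : Zonal w Q q) : Zonal w (fun ε y => -Q ε y) (fun z => -q z) :=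
  hQ.comp (g := fun x => -x) fun _ => contDiffAt_id.neg

lemma pow (hQ : Zonal w Q q) (n : ℕ) : Zonal w (fun ε y => Q ε y ^ n) (fun z => q z ^ n) :=
  hQ.comp (g := fun x => x ^ n) fun _ => contDiffAt_id.pow n

lemma inv (hQ : Zonal w Q q) (h0 : ∀ z, q z ≠ 0) :
    Zonal w (fun ε y => (Q ε y)⁻¹) (fun z => (q z)⁻¹) :=
  hQ.comp (g := fun x => x⁻¹) fun z => contDiffAt_inv ℝ (h0 z)

lemma div (hQ : Zonal w Q q) (hP : Zonal w P p) (h0 : ∀ z, p z ≠ 0) :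
    Zonal w (fun ε y => Q ε y / P ε y) (fun z => q z / p z) := by
  simpa only [div_eq_mul_inv] using hQ.mul (hP.inv h0)

lemma sqrt (hQ : Zonal w Q q) (h0 : ∀ z, 0 < q z) :
    Zonal w (fun ε y => √(Q ε y)) (fun z => √(q z)) :=
  hQ.comp (g := Real.sqrt) fun z => Real.contDiffAt_sqrt (h0 z).ne'

lemma eventually_mem (hQ : Zonal w Q q) {U : Set ℝ} (hU : IsOpen U) (h : ∀ z, q z ∈ U) :
    ∀ᶠ ε in 𝓝 (0 : ℝ), ∀ y ∈ chartDomain, Q ε y ∈ U := by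
  obtain ⟨φ, h1, h2, h3⟩ := hQ
  have h4 := eventually_forall_zeta w (P := fun ε z => φ (ε, z) ∈ U) fun z =>
    (h1 z).continuousAt.eventually_mem (hU.mem_nhds (by rw [h2]; exact h z))
  filter_upwards [h3, h4] with ε h5 h6 y hy
  rw [h5 y hy]; exact h6 y

lemma eventually_mem₂ (hQ : Zonal w Q q) (hP : Zonal w P p) {U : Set (ℝ × ℝ)} (hU : IsOpen U)
    (h : ∀ z, (q z, p z) ∈ U) :
    ∀ᶠ ε in 𝓝 (0 : ℝ), ∀ y ∈ chartDomain, (Q ε y, P ε y) ∈ U := by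
  obtain ⟨φ, h1, h2, h3⟩ := hQ
  obtain ⟨ψ, k1, k2, k3⟩ := hP
  have h4 := eventually_forall_zeta w (P := fun ε z => (φ (ε, z), ψ (ε, z)) ∈ U) fun z =>
    ((h1 z).continuousAt.prodMk (k1 z).continuousAt).eventually_mem
      (hU.mem_nhds (by rw [h2, k2]; exact h z))
  filter_upwards [h3, k3, h4] with ε h5 k5 h6 y hy
  rw [h5 y hy, k5 y hy]; exact h6 y

/-- Chain rule: the differential of a zonal family is a zonal multiple of dζ. Although dζ itself is
not zonal, its squared length is. -/
lemma pd (hQ : Zonal w Q q) : ∃ Q', Zonal w Q' (deriv q) ∧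
    ∀ᶠ ε in 𝓝 (0 : ℝ), ∀ y ∈ chartDomain, DifferentiableAt ℝ (Q ε) y ∧
      ∀ i, CMAFoliation.pd i (Q ε) y = Q' ε y * CMAFoliation.pd i (CMAFoliation.zeta w) y := by
  obtain ⟨φ, h1, h2, h3⟩ := hQ
  refine ⟨fun ε y => fderiv ℝ φ (ε, CMAFoliation.zeta w y) (0, 1),
    ⟨fun x => fderiv ℝ φ x (0, 1), fun z => ?_, fun z => ?_, Eventually.of_forall fun _ _ _ => rfl⟩,
    ?_⟩
  · exact ((h1 z).fderiv_right (m := ∞) (by simp)).clm_apply contDiffAt_const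
  · have hc : HasDerivAt (fun t : ℝ => ((0 : ℝ), t)) (0, 1) z :=
      (hasDerivAt_const _ _).prodMk (hasDerivAt_id _)
    have hd : HasFDerivAt φ (fderiv ℝ φ (0, z)) (0, z) :=
      ((h1 z).differentiableAt (by simp)).hasFDerivAt
    have e : q = fun t => φ (0, t) := funext fun t => (h2 t).symm
    rw [e]
    exact ((hd.comp_hasDerivAt z hc).deriv).symm
  · have h4 := eventually_forall_zeta w (P := fun ε z => ContDiffAt ℝ 1 φ (ε, z)) fun z =>
      ((h1 z).of_le (by simp)).eventually (by simp)
    filter_upwards [h3, h4] with ε h5 h6 y hy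
    have hd : HasFDerivAt φ (fderiv ℝ φ (ε, CMAFoliation.zeta w y)) (ε, CMAFoliation.zeta w y) :=
      ((h6 y).differentiableAt (by simp)).hasFDerivAt
    have hc : HasDerivAt (fun t : ℝ => (ε, t)) (0, 1) (CMAFoliation.zeta w y) :=
      (hasDerivAt_const _ _).prodMk (hasDerivAt_id _)
    have hg := hd.comp_hasDerivAt (CMAFoliation.zeta w y) hc
    have hz : DifferentiableAt ℝ (CMAFoliation.zeta w) y :=
      (contDiff_zeta w).differentiable (by simp) y
    have heq : Q ε =ᶠ[𝓝 y] fun z => φ (ε, CMAFoliation.zeta w z) :=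
      Filter.eventuallyEq_of_mem (isOpen_chartDomain.mem_nhds hy) h5
    refine ⟨?_, fun i => ?_⟩
    · refine DifferentiableAt.congr_of_eventuallyEq ?_ heq
      exact hg.differentiableAt.comp y hz
    · rw [pd_congr heq]
      exact pd_comp (g := fun t => φ (ε, t)) hg hz i

end Zonal

/-! ### Zonal leaves -/

/-- With s = sin θ and (a, b) = dζ the matrix is p g + q dζ ⊗ dζ for the round metric g. Relative to
g its eigenvalues are p and p + q |∇ζ|². -/
lemma mat2_det_rankOne {h : Mat2} {p q a b s : ℝ} (hs : s ≠ 0) (h00 : h 0 0 = p + q * (a * a))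
    (h01 : h 0 1 = q * (a * b)) (h10 : h 1 0 = q * (b * a))
    (h11 : h 1 1 = p * s ^ 2 + q * (b * b)) :
    h.det = s ^ 2 * (p * (p + q * (a * a + b * b / s ^ 2))) := by
  rw [Matrix.det_fin_two, h00, h01, h10, h11]
  field_simp
  ring

/-- Both tensors are diagonal in the directions across and along ∇ζ, so the trace is the sum of the
two ratios of eigenvalues. In particular it involves dζ only through |∇ζ|², which is a function of
ζ. -/
lemma trace2_rankOne {h k : Mat2} {p q P Q a b s : ℝ} (hs : s ≠ 0) (hp : p ≠ 0)
    (hq : p + q * (a * a + b * b / s ^ 2) ≠ 0)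
    (h00 : h 0 0 = p + q * (a * a)) (h01 : h 0 1 = q * (a * b)) (h10 : h 1 0 = q * (b * a))
    (h11 : h 1 1 = p * s ^ 2 + q * (b * b))
    (k00 : k 0 0 = P + Q * (a * a)) (k01 : k 0 1 = Q * (a * b)) (k10 : k 1 0 = Q * (b * a))
    (k11 : k 1 1 = P * s ^ 2 + Q * (b * b)) :
    trace2 h k = P / p + (P + Q * (a * a + b * b / s ^ 2)) /
      (p + q * (a * a + b * b / s ^ 2)) := by
  obtain ⟨e1, e2, e3, e4⟩ := mat2_inv_apply h
  simp only [trace2, Fin.sum_univ_two, e1, e2, e3, e4,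
    mat2_det_rankOne hs h00 h01 h10 h11, h00, h01, h10, h11, k00, k01, k10, k11]
  set D := p + q * (a * a + b * b / s ^ 2) with hD
  have e : b * b = s ^ 2 * (b * b / s ^ 2) := by field_simp
  set B := b * b / s ^ 2 with hB
  rw [show q * (a * b) = q * a * b by ring, show q * (b * a) = q * a * b by ring]
  have e2 : ∀ x y : ℝ, -(q * a * b) / (s ^ 2 * (p * D)) * (x * (a * b)) =
    -(q * a * a * x * B) / (p * D) := fun x _ => by rw [hB]; field_simp
  have e3 : ∀ x y : ℝ, -(q * a * b) / (s ^ 2 * (p * D)) * (x * (b * a)) =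
    -(q * a * a * x * B) / (p * D) := fun x _ => by rw [hB]; field_simp
  rw [e2 Q 0, e3 Q 0, e]
  field_simp
  rw [hD]
  ring

/-- A family of graphs `s = f ε, s̲ = b ε` near the leaf `s = u, s̲ = 0` which depends on the angle
only through the linear function of `w`. -/
structure ZonalLeaf (w : E3) (r₀ u : ℝ) (f b : ℝ → Chart → ℝ) : Prop where
  pos : 0 < r₀
  nonneg : 0 ≤ u
  zf : Zonal w f (fun _ => u)
  zb : Zonal w b (fun _ => 0)

/-- The vector fields `V ε` are `A ∂_s + B ∂_s̲ + C ∇ζ` with zonal coefficients. -/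
def ZonalNormal (w : E3) (a c : ℝ) (V : ℝ → Chart → Fin 4 → ℝ) : Prop :=
  ∃ A B C : ℝ → Chart → ℝ, Zonal w A (fun _ => a) ∧ Zonal w B (fun _ => c) ∧
    Zonal w C (fun _ => 0) ∧ ∀ᶠ ε in 𝓝 (0 : ℝ), ∀ y ∈ chartDomain,
      V ε y 0 = A ε y ∧ V ε y 1 = B ε y ∧ V ε y 2 = C ε y * pd 0 (zeta w) y ∧
      V ε y 3 = C ε y * (pd 1 (zeta w) y / sin (y 0) ^ 2)

lemma ZonalNormal.smul {w : E3} {a c : ℝ} {V : ℝ → Chart → Fin 4 → ℝ} (N : ZonalNormal w a c V)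
    {l : ℝ → Chart → ℝ} (hl : Zonal w l (fun _ => 1)) :
    ZonalNormal w a c (fun ε y => l ε y • V ε y) := by
  obtain ⟨A, B, C, hA, hB, hC, h⟩ := N
  refine ⟨_, _, _, (hl.mul hA).congr fun _ => one_mul _, (hl.mul hB).congr fun _ => one_mul _,
    (hl.mul hC).congr fun _ => one_mul _, ?_⟩
  filter_upwards [h] with ε hε y hy
  obtain ⟨h0, h1, h2, h3⟩ := hε y hy
  simp only [Pi.smul_apply, smul_eq_mul, h0, h1, h2, h3, mul_assoc, and_self]

lemma pd_raised_zeta (w : E3) {y : Chart} (hy : y ∈ chartDomain) (i : Fin 2) :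
    pd i (fun z => pd 1 (zeta w) z / sin (z 0) ^ 2) y =
      (pd i (pd 1 (zeta w)) y - if i = 0 then 2 * (cos (y 0) / sin (y 0)) * pd 1 (zeta w) y else 0)
        / sin (y 0) ^ 2 := by
  have hs := sin_ne_zero_of_mem hy
  have hd : DifferentiableAt ℝ (pd 1 (zeta w)) y :=
    (contDiff_pd (contDiff_zeta w) 1).differentiable (by simp) y
  have hsin : DifferentiableAt ℝ (fun z : Chart => (sin (z 0) ^ 2)⁻¹) y := by
    refine DifferentiableAt.inv ?_ (pow_ne_zero 2 hs)
    fun_prop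
  simp only [div_eq_mul_inv]
  rw [pd_mul hd hsin]
  fin_cases i
  · have h := pd_coord_self (fun t => (sin t ^ 2)⁻¹) 0 y
    have h2 : HasDerivAt (fun t => (sin t ^ 2)⁻¹) (-(2 * sin (y 0) * cos (y 0)) /
        (sin (y 0) ^ 2) ^ 2) (y 0) := by
      refine HasDerivAt.inv (((hasDerivAt_sin (y 0)).pow 2).congr_deriv (by simp)) (pow_ne_zero 2 hs)
    simp only [Fin.zero_eta, h, h2.deriv, if_true]
    field_simp
    ring
  · have h := pd_coord_ne (fun t => (sin t ^ 2)⁻¹) (i := 1) (j := 0) (by decide) y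
    simp [h]

namespace ZonalLeaf

variable {w : E3} {r₀ u : ℝ} {f b : ℝ → Chart → ℝ}

lemma mem_region (Z : ZonalLeaf w r₀ u f b) : (u, 0) ∈ region r₀ :=
  mem_region_of_nonneg Z.pos Z.nonneg 0

lemma radius_pos (Z : ZonalLeaf w r₀ u f b) : 0 < r₀ + u := by
  have := Z.pos; have := Z.nonneg; linarith

lemma eventually_mem_region (Z : ZonalLeaf w r₀ u f b) :
    ∀ᶠ ε in 𝓝 (0 : ℝ), ∀ y ∈ chartDomain, (f ε y, b ε y) ∈ region r₀ :=
  Z.zf.eventually_mem₂ Z.zb (isOpen_region r₀) fun _ => Z.mem_region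

lemma radius (Z : ZonalLeaf w r₀ u f b) :
    Zonal w (fun ε y => schwR r₀ (f ε y) (b ε y)) (fun _ => r₀ + u) :=
  (Z.zf.comp₂ (G := fun q : ℝ × ℝ => schwR r₀ q.1 q.2) Z.zb
    fun _ => contDiffAt_schwR Z.pos Z.mem_region).congr fun _ =>
      schwR_zero Z.pos (by have := Z.pos; have := Z.nonneg; linarith)

lemma lapseSq (Z : ZonalLeaf w r₀ u f b) :
    Zonal w (fun ε y => omegaSq r₀ (f ε y) (b ε y)) (fun _ => 1) :=
  (Z.zf.comp₂ (G := fun q : ℝ × ℝ => omegaSq r₀ q.1 q.2) Z.zb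
    fun _ => contDiffAt_omegaSq Z.pos Z.mem_region).congr fun _ =>
      omegaSq_zero Z.pos (by have := Z.pos; have := Z.nonneg; linarith)

lemma logOmegaS (Z : ZonalLeaf w r₀ u f b) :
    ∃ q, Zonal w (fun ε y => logOmegaS r₀ (f ε y) (b ε y)) q :=
  ⟨_, Z.zf.comp₂ (G := fun q : ℝ × ℝ => CMAFoliation.logOmegaS r₀ q.1 q.2) Z.zb
    fun _ => contDiffAt_logOmegaS Z.pos Z.mem_region⟩

end ZonalLeaf

/-- The squared length of the gradient of a linear function, as a zonal family. -/
lemma zonal_gradient (w : E3) : Zonal w (fun _ y => pd 0 (zeta w) y * pd 0 (zeta w) y +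
    pd 1 (zeta w) y * pd 1 (zeta w) y / sin (y 0) ^ 2) (fun z => ‖w‖ ^ 2 - z * z) :=
  ((Zonal.const (‖w‖ ^ 2)).sub (Zonal.zeta.mul Zonal.zeta)).congr_fun
    (Eventually.of_forall fun ε y hy => by
      rw [gradient_zeta w w hy, real_inner_self_eq_norm_sq])

lemma Zonal.pd_of_const {w : E3} {Q : ℝ → Chart → ℝ} {c : ℝ} (hQ : Zonal w Q (fun _ => c)) :
    ∃ Q', Zonal w Q' (fun _ => 0) ∧ ∀ᶠ ε in 𝓝 (0 : ℝ), ∀ y ∈ chartDomain,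
      DifferentiableAt ℝ (Q ε) y ∧ ∀ i, CMAFoliation.pd i (Q ε) y =
        Q' ε y * CMAFoliation.pd i (CMAFoliation.zeta w) y := by
  obtain ⟨Q', h1, h2⟩ := hQ.pd
  exact ⟨Q', h1.congr fun z => by simp, h2⟩

namespace ZonalLeaf

variable {w : E3} {r₀ u : ℝ} {f b : ℝ → Chart → ℝ}

/-- The induced metric is exactly r² g + 4Ω² f' f̲' dζ ⊗ dζ for the zonal factors f', f̲' of the
gradients. Dividing the area element by sin θ removes the degeneration of the chart at the poles. -/
lemma det (Z : ZonalLeaf w r₀ u f b) : Zonal w (fun ε y =>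
    √((inducedMetric r₀ (graphSurface (f ε) (b ε)) y).det) / sin (y 0))
      (fun _ => (r₀ + u) ^ 2) := by
  have hr := Z.radius_pos
  obtain ⟨f', hf, hf'⟩ := Z.zf.pd_of_const
  obtain ⟨b', hb, hb'⟩ := Z.zb.pd_of_const
  have hp := Z.radius.pow 2
  have hq := ((Zonal.const (w := w) 4).mul Z.lapseSq).mul (hf.mul hb)
  have h := (hp.mul (hp.add (hq.mul (zonal_gradient w))))
  refine ((h.sqrt fun z => ?_).congr_fun ?_).congr fun z => ?_
  · simp only [mul_zero, zero_mul, add_zero]; positivity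
  · filter_upwards [hf', hb'] with ε h1 h2 y hy
    have hs := sin_pos_of_mem hy
    have e := mat2_det_rankOne (h := inducedMetric r₀ (graphSurface (f ε) (b ε)) y)
      (p := schwR r₀ (f ε y) (b ε y) ^ 2)
      (q := 4 * omegaSq r₀ (f ε y) (b ε y) * (f' ε y * b' ε y))
      (a := pd 0 (zeta w) y) (b := pd 1 (zeta w) y) hs.ne'
      (by simp [inducedMetric_graph, (h1 y hy).2, (h2 y hy).2, roundMetric]; ring)
      (by simp [inducedMetric_graph, (h1 y hy).2, (h2 y hy).2, roundMetric]; ring)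
      (by simp [inducedMetric_graph, (h1 y hy).2, (h2 y hy).2, roundMetric]; ring)
      (by simp [inducedMetric_graph, (h1 y hy).2, (h2 y hy).2, roundMetric]; ring)
    rw [e, Real.sqrt_mul (sq_nonneg _), Real.sqrt_sq hs.le, mul_div_cancel_left₀ _ hs.ne']
  · simp only [mul_zero, zero_mul, add_zero]
    rw [← sq, Real.sqrt_sq (by positivity)]

/-- The second fundamental form is again P g + Q dζ ⊗ dζ with zonal P and Q, since Hess ζ = -ζ g.
The trace of such a pair is zonal by `trace2_rankOne`. Only smooth dependence matters here, as the
first-order values are known from the jets. -/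
lemma expansion (Z : ZonalLeaf w r₀ u f b) {a c : ℝ} {V : ℝ → Chart → Fin 4 → ℝ}
    (N : ZonalNormal w a c V) :
    ∃ q, Zonal w (fun ε y => expansion r₀ (graphSurface (f ε) (b ε)) (V ε) y) q := by
  have hr := Z.radius_pos
  obtain ⟨f', hf, hf'⟩ := Z.zf.pd_of_const
  obtain ⟨b', hb, hb'⟩ := Z.zb.pd_of_const
  obtain ⟨A, B, C, hA, hB, hC, hV⟩ := N
  obtain ⟨A', zA, hA'⟩ := hA.pd_of_const
  obtain ⟨B', zB, hB'⟩ := hB.pd_of_const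
  obtain ⟨C', zC, hC'⟩ := hC.pd_of_const
  obtain ⟨l, hl⟩ := Z.logOmegaS
  have hR := Z.radius
  have hW := Z.lapseSq
  have hp := hR.pow 2
  have hq := ((Zonal.const (w := w) 4).mul hW).mul (hf.mul hb)
  have hWR := hW.div hR fun _ => hr.ne'
  have hqR := (hR.sub (Zonal.const r₀)).div hp fun _ => pow_ne_zero 2 hr.ne'
  -- The coefficient of the identity in the angular part of ∇V; the summand -Cζ comes from the
  -- Hessian of ζ.
  have hD := ((hC.mul Zonal.zeta).neg.add (hWR.mul hA)).add (hqR.mul hB)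
  -- The coefficient of dζ ⊗ ∇ζ in the same angular part.
  have hE := (zC.add (hWR.mul (hf.mul hC))).add (hqR.mul (hb.mul hC))
  have hX0 := (zA.add (hl.mul (hf.mul hA))).add
    (((hR.sub (Zonal.const r₀)).neg.div ((Zonal.const 2).mul hW) fun _ => by norm_num).mul hC)
  have hX1 := (zB.add (((Zonal.const r₀).div hp fun _ => pow_ne_zero 2 hr.ne').mul
    (hb.mul hB))).add ((hR.neg.div (Zonal.const 2) fun _ => two_ne_zero).mul hC)
  have hP := hp.mul hD
  have hQ := (hp.mul hE).add (((Zonal.const 2).mul hW).mul ((hX0.mul hb).add (hX1.mul hf)))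
  have hn := zonal_gradient w
  have hden := hp.add (hq.mul hn)
  have hden0 : ∀ z : ℝ, (r₀ + u) ^ 2 + 4 * 1 * (0 * 0) * (‖w‖ ^ 2 - z * z) ≠ 0 := fun z => by
    simp only [mul_zero, zero_mul, add_zero]; positivity
  have hfin := (hP.div hp fun _ => pow_ne_zero 2 hr.ne').add
    ((hP.add (hQ.mul hn)).div hden hden0)
  refine ⟨_, hfin.congr_fun ?_⟩
  have hne1 := hp.eventually_mem isOpen_ne fun _ => pow_ne_zero 2 hr.ne'
  -- The gradient factors f', f̲' vanish at ε = 0, so the denominator starts at the positive value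
  -- (r₀ + u)² and stays nonzero uniformly.
  have hne2 := hden.eventually_mem isOpen_ne hden0
  filter_upwards [hf', hb', hV, hA', hB', hC', Z.eventually_mem_region, hne1, hne2] with
    ε h1 h2 h3 h4 h5 h6 h7 h8 h9 y hy
  have hs := sin_ne_zero_of_mem hy
  have hdom : graphSurface (f ε) (b ε) y ∈ domain4 r₀ := ⟨h7 y hy, hs⟩
  have hW0 := (omegaSq_pos Z.pos (h7 y hy)).ne'
  have hR0 := (schwR_pos Z.pos (h7 y hy)).ne'
  have v0 : ∀ i, pd i (fun z => V ε z 0) y = A' ε y * pd i (zeta w) y := fun i => by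
    rw [pd_congr_on isOpen_chartDomain (fun z hz => (h3 z hz).1) hy i]; exact (h4 y hy).2 i
  have v1 : ∀ i, pd i (fun z => V ε z 1) y = B' ε y * pd i (zeta w) y := fun i => by
    rw [pd_congr_on isOpen_chartDomain (fun z hz => (h3 z hz).2.1) hy i]; exact (h5 y hy).2 i
  have hz : ∀ j, DifferentiableAt ℝ (pd j (zeta w)) y := fun j =>
    (contDiff_pd (contDiff_zeta w) j).differentiable (by simp) y
  have v2 : ∀ i, pd i (fun z => V ε z 2) y = C' ε y * pd i (zeta w) y * pd 0 (zeta w) y +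
      C ε y * pd i (pd 0 (zeta w)) y := fun i => by
    rw [pd_congr_on isOpen_chartDomain (fun z hz => (h3 z hz).2.2.1) hy i,
      pd_mul (h6 y hy).1 (hz 0), (h6 y hy).2 i]
  have hg : DifferentiableAt ℝ (fun z : Chart => pd 1 (zeta w) z / sin (z 0) ^ 2) y := by
    have h : DifferentiableAt ℝ (fun z : Chart => sin (z 0) ^ 2) y := by fun_prop
    simpa only [div_eq_mul_inv] using (hz 1).fun_mul (h.fun_inv (pow_ne_zero 2 hs))
  have v3 : ∀ i, pd i (fun z => V ε z 3) y =
      C' ε y * pd i (zeta w) y * (pd 1 (zeta w) y / sin (y 0) ^ 2) +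
      C ε y * pd i (fun z => pd 1 (zeta w) z / sin (z 0) ^ 2) y := fun i => by
    rw [pd_congr_on isOpen_chartDomain (fun z hz => (h3 z hz).2.2.2) hy i,
      pd_mul (h6 y hy).1 hg, (h6 y hy).2 i]
  have hcomm : pd 1 (pd 0 (zeta w)) y = pd 0 (pd 1 (zeta w)) y :=
    pd_comm (contDiff_zeta w).contDiffAt 1 0
  have h01 : pd 0 (pd 1 (zeta w)) y = cos (y 0) / sin (y 0) * pd 1 (zeta w) y := by
    rw [pd_zero_one_zeta, pd_one_zeta]; field_simp
  obtain ⟨c0, c1, c2, c3⟩ := covD_graph Z.pos (f ε) (b ε) (V ε) hdom 0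
  obtain ⟨d0, d1, d2, d3⟩ := covD_graph Z.pos (f ε) (b ε) (V ε) hdom 1
  obtain ⟨w0, w1, w2, w3⟩ := h3 y hy
  simp only [v0, v1, v2, v3, w0, w1, w2, w3, (h1 y hy).2, (h2 y hy).2, pd_raised_zeta w hy, hcomm,
    h01, pd_zero_zero_zeta, pd_one_one_zeta, if_true, one_ne_zero, if_false] at c0 c1 c2 c3 d0 d1 d2 d3
  refine trace2_rankOne (a := pd 0 (zeta w) y) (b := pd 1 (zeta w) y) hs (h8 y hy) (h9 y hy)
    (by simp [inducedMetric_graph, (h1 y hy).2, (h2 y hy).2, roundMetric]; ring)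
    (by simp [inducedMetric_graph, (h1 y hy).2, (h2 y hy).2, roundMetric]; ring)
    (by simp [inducedMetric_graph, (h1 y hy).2, (h2 y hy).2, roundMetric]; ring)
    (by simp [inducedMetric_graph, (h1 y hy).2, (h2 y hy).2, roundMetric]; ring) ?_ ?_ ?_ ?_
  · rw [secondForm_graph, c0, c1, c2, (h1 y hy).2, (h2 y hy).2]
    simp only [if_true]
    generalize schwR r₀ (f ε y) (b ε y) = R at *
    generalize omegaSq r₀ (f ε y) (b ε y) = W at *
    ring
  · rw [secondForm_graph, c0, c1, c3, (h1 y hy).2, (h2 y hy).2]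
    simp only [one_ne_zero, if_false]
    generalize schwR r₀ (f ε y) (b ε y) = R at *
    generalize omegaSq r₀ (f ε y) (b ε y) = W at *
    field_simp
    ring
  · rw [secondForm_graph, d0, d1, d2, (h1 y hy).2, (h2 y hy).2]
    simp only [if_true]
    generalize schwR r₀ (f ε y) (b ε y) = R at *
    generalize omegaSq r₀ (f ε y) (b ε y) = W at *
    field_simp
    ring
  · rw [secondForm_graph, d0, d1, d3, (h1 y hy).2, (h2 y hy).2]
    simp only [one_ne_zero, if_false]
    generalize schwR r₀ (f ε y) (b ε y) = R at *
    generalize omegaSq r₀ (f ε y) (b ε y) = W at *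
    field_simp
    ring

end ZonalLeaf

lemma Zonal.nullRoot {w : E3} {p m q : ℝ → Chart → ℝ} (hp : Zonal w p (fun _ => 0))
    (hm : Zonal w m (fun _ => 0)) (hq : Zonal w q (fun _ => 0)) :
    Zonal w (fun ε y => nullRoot (p ε y) (m ε y) (q ε y)) (fun _ => 0) := by
  unfold CMAFoliation.nullRoot
  have h1 := (Zonal.const (w := w) 1).add ((Zonal.const 2).mul hm)
  have h2 := (h1.pow 2).sub (((Zonal.const 4).mul hp).mul hq)
  have h3 := h1.add (h2.sqrt fun _ => by norm_num)
  exact (((Zonal.const (-2)).mul hq).div h3 fun _ => by norm_num).congr fun _ => by simp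

namespace ZonalLeaf

variable {w : E3} {r₀ u : ℝ} {f b : ℝ → Chart → ℝ}

lemma covecIp (Z : ZonalLeaf w r₀ u f b) {α β : ℝ → Chart → Fin 2 → ℝ} {α' β' : ℝ → Chart → ℝ}
    (zα : Zonal w α' (fun _ => 0)) (zβ : Zonal w β' (fun _ => 0))
    (hα : ∀ᶠ ε in 𝓝 (0 : ℝ), ∀ y ∈ chartDomain, ∀ i, α ε y i = α' ε y * pd i (zeta w) y)
    (hβ : ∀ᶠ ε in 𝓝 (0 : ℝ), ∀ y ∈ chartDomain, ∀ i, β ε y i = β' ε y * pd i (zeta w) y) :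
    Zonal w (fun ε y => covecIp r₀ (graphSurface (f ε) (b ε) y) (α ε y) (β ε y))
      (fun _ => 0) := by
  have hr := Z.radius_pos.ne'
  simp only [CMAFoliation.covecIp, graph_zero, graph_one, graph_two]
  refine (((Z.lapseSq.div (Z.radius.pow 2) fun _ => pow_ne_zero 2 hr).mul
    ((zα.mul zβ).mul (zonal_gradient w))).congr_fun ?_).congr fun z => by simp
  filter_upwards [hα, hβ] with ε h1 h2 y hy
  rw [h1 y hy, h1 y hy, h2 y hy, h2 y hy]
  ring

lemma exists_pd (Z : ZonalLeaf w r₀ u f b) : ∃ f' b', Zonal w f' (fun _ => 0) ∧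
    Zonal w b' (fun _ => 0) ∧
    (∀ᶠ ε in 𝓝 (0 : ℝ), ∀ y ∈ chartDomain, ∀ i, pd i (f ε) y = f' ε y * pd i (zeta w) y) ∧
    ∀ᶠ ε in 𝓝 (0 : ℝ), ∀ y ∈ chartDomain, ∀ i, pd i (b ε) y = b' ε y * pd i (zeta w) y := by
  obtain ⟨f', hf, hf'⟩ := Z.zf.pd_of_const
  obtain ⟨b', hb, hb'⟩ := Z.zb.pd_of_const
  exact ⟨f', b', hf, hb, hf'.mono fun ε h y hy => (h y hy).2,
    hb'.mono fun ε h y hy => (h y hy).2⟩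

lemma graphNormal (Z : ZonalLeaf w r₀ u f b) {A B : ℝ → Chart → ℝ} {a c : ℝ}
    (hA : Zonal w A (fun _ => a)) (hB : Zonal w B (fun _ => c)) :
    ZonalNormal w a c (fun ε y => graphNormal r₀ (graphSurface (f ε) (b ε)) y (A ε y) (B ε y)) := by
  have hr := Z.radius_pos.ne'
  obtain ⟨f', b', hf, hb, hf', hb'⟩ := Z.exists_pd
  refine ⟨A, B, _, hA, hB, ((((Zonal.const (-2)).mul Z.lapseSq).div (Z.radius.pow 2)
    fun _ => pow_ne_zero 2 hr).mul ((hA.mul hb).add (hB.mul hf))).congr fun _ => by simp, ?_⟩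
  filter_upwards [hf', hb'] with ε h1 h2 y hy
  refine ⟨rfl, rfl, ?_, ?_⟩
  · change _ * (A ε y * pd 0 (b ε) y + B ε y * pd 0 (f ε) y) = _
    rw [h1 y hy, h2 y hy]
    simp only [graph_zero, graph_one]
    ring
  · change _ * (A ε y * pd 1 (b ε) y + B ε y * pd 1 (f ε) y) / sin (y 0) ^ 2 = _
    rw [h1 y hy, h2 y hy]
    simp only [graph_zero, graph_one]
    ring

lemma incoming (Z : ZonalLeaf w r₀ u f b) :
    ZonalNormal w 1 0 (fun ε => incoming r₀ (graphSurface (f ε) (b ε))) := by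
  obtain ⟨f', b', hf, hb, hf', hb'⟩ := Z.exists_pd
  exact Z.graphNormal (Zonal.const 1) (Zonal.nullRoot (Z.covecIp hf hf hf' hf')
    (Z.covecIp hf hb hf' hb') (Z.covecIp hb hb hb' hb'))

lemma outgoing (Z : ZonalLeaf w r₀ u f b) :
    ZonalNormal w 0 1 (fun ε => outgoing r₀ (graphSurface (f ε) (b ε))) := by
  obtain ⟨f', b', hf, hb, hf', hb'⟩ := Z.exists_pd
  exact Z.graphNormal (Zonal.nullRoot (Z.covecIp hb hb hb' hb')
    (Z.covecIp hf hb hf' hb') (Z.covecIp hf hf hf' hf')) (Zonal.const 1)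

lemma conjugate (Z : ZonalLeaf w r₀ u f b) :
    ZonalNormal w 0 1 (fun ε => conjugate r₀ (graphSurface (f ε) (b ε))) := by
  refine Z.outgoing.smul (l := fun ε y => 2 / ip (schwarzschild r₀) (graphSurface (f ε) (b ε) y)
    (CMAFoliation.incoming r₀ (graphSurface (f ε) (b ε)) y)
    (CMAFoliation.outgoing r₀ (graphSurface (f ε) (b ε)) y)) ?_
  obtain ⟨A, B, C, hA, hB, hC, h⟩ := Z.incoming
  obtain ⟨A', B', C', hA', hB', hC', h'⟩ := Z.outgoing
  have hip := (((Zonal.const 2).mul Z.lapseSq).mul ((hA.mul hB').add (hB.mul hA'))).add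
    ((Z.radius.pow 2).mul ((hC.mul hC').mul (zonal_gradient w)))
  refine (((Zonal.const 2).div hip fun _ => by simp).congr_fun ?_).congr fun _ => by simp
  filter_upwards [h, h'] with ε h1 h2 y hy
  obtain ⟨a0, a1, a2, a3⟩ := h1 y hy
  obtain ⟨b0, b1, b2, b3⟩ := h2 y hy
  have hs := sin_ne_zero_of_mem hy
  congr 1
  simp only [ip_schwarzschild, a0, a1, a2, a3, b0, b1, b2, b3, graph_zero, graph_one, graph_two]
  field_simp

end ZonalLeaf

/-! ### Zonal foliations -/

/-- At the label `u` the linearised foliation is `δf = α + β ζ`, `∂_u δf = α' + β' ζ`, inside the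
linearised hypersurface `δh = c₀ + r₀ ζ`. -/
structure ZonalFoliation (w : E3) (r₀ c₀ u α β α' β' : ℝ) (δh δf : ℝ → S2 → ℝ) : Prop where
  pos : 0 < r₀
  nonneg : 0 ≤ u
  smooth_h : SmoothOnRS2 δh
  smooth_f : SmoothOnRS2 δf
  eq_h : ∀ s, 0 ≤ s → ∀ y, slice δh s y = c₀ + r₀ * zeta w y
  eq_f : ∀ y, slice δf u y = α + β * zeta w y
  eq_rate : ∀ y, rate δf u y = α' + β' * zeta w y
  init : u = 0 → α = 0 ∧ β = 0

namespace ZonalFoliation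

variable {w : E3} {r₀ c₀ u α β α' β' : ℝ} {δh δf : ℝ → S2 → ℝ}

lemma radius_pos (Z : ZonalFoliation w r₀ c₀ u α β α' β' δh δf) : 0 < r₀ + u := by
  have := Z.pos; have := Z.nonneg; linarith

lemma zonal_f (Z : ZonalFoliation w r₀ c₀ u α β α' β' δh δf) :
    Zonal w (fun ε y => varF δf ε u (sph y)) (fun _ => u) := by
  have h := (Zonal.const (w := w) u).add (Zonal.eps.mul ((Zonal.const α).add
    ((Zonal.const β).mul Zonal.zeta)))
  refine (h.congr_fun (Eventually.of_forall fun ε y _ => ?_)).congr fun z => by simp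
  rw [← Z.eq_f y]; rfl

/-- The hypersurface is known to be c₀ + r₀ζ only for s ≥ 0, so the perturbed leaf must not enter s
< 0. For u > 0 this holds for small ε, and for u = 0 the leaf does not move at all. -/
lemma eventually_nonneg (Z : ZonalFoliation w r₀ c₀ u α β α' β' δh δf) :
    ∀ᶠ ε in 𝓝 (0 : ℝ), ∀ y ∈ chartDomain, 0 ≤ varF δf ε u (sph y) := by
  rcases Z.nonneg.eq_or_lt with h | h
  · obtain ⟨h1, h2⟩ := Z.init h.symm
    refine Eventually.of_forall fun ε y _ => ?_
    have : δf u (sph y) = 0 := by have := Z.eq_f y; simpa [h1, h2, slice] using this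
    simp only [varF, this, mul_zero, add_zero]
    exact Z.nonneg
  · filter_upwards [Z.zonal_f.eventually_mem isOpen_Ioi fun _ => h] with ε hε y hy
    exact le_of_lt (hε y hy)

lemma leaf (Z : ZonalFoliation w r₀ c₀ u α β α' β' δh δf) :
    ZonalLeaf w r₀ u (fun ε y => varF δf ε u (sph y))
      (fun ε y => varH δh ε (varF δf ε u (sph y)) (sph y)) where
  pos := Z.pos
  nonneg := Z.nonneg
  zf := Z.zonal_f
  zb := by
    have h := (Zonal.eps (w := w)).mul ((Zonal.const c₀).add ((Zonal.const r₀).mul Zonal.zeta))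
    refine (h.congr_fun ?_).congr fun z => by simp
    filter_upwards [Z.eventually_nonneg] with ε hε y hy
    rw [← Z.eq_h _ (hε y hy) y]; rfl

lemma lapse (Z : ZonalFoliation w r₀ c₀ u α β α' β' δh δf) :
    Zonal w (fun ε y => lapse r₀ (varH δh ε) (varF δf ε) u y) (fun _ => 1) := by
  obtain ⟨f', b', hf, -, hf', -⟩ := Z.leaf.exists_pd
  obtain ⟨A, B, C, -, -, hC, hV⟩ := Z.leaf.incoming
  have h1 := (Zonal.const (w := w) 1).add (Zonal.eps.mul ((Zonal.const α').add
    ((Zonal.const β').mul Zonal.zeta)))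
  have h2 := (Zonal.const (w := w) 1).sub ((hC.mul hf).mul (zonal_gradient w))
  refine ((h1.div h2 fun z => by simp).congr_fun ?_).congr fun z => by simp
  filter_upwards [hf', hV] with ε hε hε' y hy
  have hd : deriv (fun v => varF δf ε v (sph y)) u = 1 + ε * (α' + β' * zeta w y) := by
    rw [← Z.eq_rate y]
    exact ((hasDerivAt_id u).add
      ((Z.smooth_f.differentiableAt u y).hasDerivAt.const_mul ε)).deriv
  obtain ⟨-, -, w2, w3⟩ := hε' y hy
  have e0 : tangent (CMAFoliation.leaf (varH δh ε) (varF δf ε) u) 0 y 0 = f' ε y * pd 0 (zeta w) y :=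
    hε y hy 0
  have e1 : tangent (CMAFoliation.leaf (varH δh ε) (varF δf ε) u) 1 y 0 = f' ε y * pd 1 (zeta w) y :=
    hε y hy 1
  have e2 : CMAFoliation.incoming r₀ (CMAFoliation.leaf (varH δh ε) (varF δf ε) u) y 2 = _ := w2
  have e3 : CMAFoliation.incoming r₀ (CMAFoliation.leaf (varH δh ε) (varF δf ε) u) y 3 = _ := w3
  rw [CMAFoliation.lapse, hd, e0, e1, e2, e3]
  congr 2
  ring

lemma expansion_in (Z : ZonalFoliation w r₀ c₀ u α β α' β' δh δf) :
    ∃ q, Zonal w (fun ε y => expansion r₀ (CMAFoliation.leaf (varH δh ε) (varF δf ε) u)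
      (folLb r₀ (varH δh ε) (varF δf ε) u) y) q :=
  Z.leaf.expansion (Z.leaf.incoming.smul Z.lapse)

lemma expansion_out (Z : ZonalFoliation w r₀ c₀ u α β α' β' δh δf) :
    ∃ q, Zonal w (fun ε y => expansion r₀ (CMAFoliation.leaf (varH δh ε) (varF δf ε) u)
      (folLp r₀ (varH δh ε) (varF δf ε) u) y) q :=
  Z.leaf.expansion (Z.leaf.conjugate.smul
    ((Z.lapse.inv fun _ => one_ne_zero).congr fun _ => inv_one))

end ZonalFoliation

/-! ### Integration over the sphere in the chart -/

/-- The open coordinate rectangle of the sphere. -/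
def box : Set (ℝ × ℝ) := Ioo (0 : ℝ) π ×ˢ Ioo (0 : ℝ) (2 * π)

/-- The integral over the unit round sphere. -/
def sphereInt (F : Chart → ℝ) : ℝ := ∫ p in box, F ![p.1, p.2] * sin p.1

lemma measurableSet_box : MeasurableSet box := measurableSet_Ioo.prod measurableSet_Ioo

lemma mem_chartDomain_of_box {p : ℝ × ℝ} (hp : p ∈ box) : ![p.1, p.2] ∈ chartDomain := hp.1

lemma continuous_chart : Continuous (fun p : ℝ × ℝ => (![p.1, p.2] : Chart)) := by
  refine continuous_pi fun i => ?_
  fin_cases i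
  · exact continuous_fst
  · exact continuous_snd

lemma box_subset : box ⊆ Icc 0 π ×ˢ Icc 0 (2 * π) :=
  Set.prod_mono Ioo_subset_Icc_self Ioo_subset_Icc_self

lemma integrableOn_box {f : ℝ × ℝ → ℝ} (hf : Continuous f) : IntegrableOn f box :=
  (hf.locallyIntegrable.integrableOn_isCompact (isCompact_Icc.prod isCompact_Icc)).mono_set
    box_subset

lemma integrableOn_sphere {F : Chart → ℝ} (hF : Continuous F) :
    IntegrableOn (fun p : ℝ × ℝ => F ![p.1, p.2] * sin p.1) box :=
  integrableOn_box ((hF.comp continuous_chart).mul (continuous_sin.comp continuous_fst))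

lemma sphereInt_congr {F G : Chart → ℝ} (h : ∀ y ∈ chartDomain, F y = G y) :
    sphereInt F = sphereInt G :=
  setIntegral_congr_fun measurableSet_box fun p hp => by
    simp only [h _ (mem_chartDomain_of_box hp)]

lemma sphereInt_add {F G : Chart → ℝ} (hF : Continuous F) (hG : Continuous G) :
    sphereInt (fun y => F y + G y) = sphereInt F + sphereInt G := by
  simp only [sphereInt, add_mul]
  exact integral_add (integrableOn_sphere hF) (integrableOn_sphere hG)

lemma sphereInt_const_mul (c : ℝ) (F : Chart → ℝ) :
    sphereInt (fun y => c * F y) = c * sphereInt F := by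
  simp only [sphereInt, mul_assoc]
  exact integral_const_mul _ _

lemma surfaceIntegral_eq (h : Chart → Mat2) (F : Chart → ℝ) :
    surfaceIntegral h F = sphereInt (fun y => F y * (√((h y).det) / sin (y 0))) := by
  refine setIntegral_congr_fun measurableSet_box fun p hp => ?_
  have := sin_ne_zero_of_mem (mem_chartDomain_of_box hp)
  simp only [Matrix.cons_val_zero] at this ⊢
  field_simp

/-- Differentiation under the integral sign for zonal families. -/
lemma hasDerivAt_sphereInt_of_zonal {w : E3} {Q : ℝ → Chart → ℝ} {q : ℝ → ℝ} {δ : Chart → ℝ}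
    (hQ : Zonal w Q q) (hδ : ∀ y ∈ chartDomain, HasDerivAt (fun ε => Q ε y) (δ y) 0) :
    HasDerivAt (fun ε => sphereInt (Q ε)) (sphereInt δ) 0 := by
  obtain ⟨φ, h1, h2, h3⟩ := hQ
  have hcont : ∀ z, ContinuousAt (fun x => fderiv ℝ φ x (1, 0)) (0, z) := fun z =>
    (((h1 z).fderiv_right (m := ∞) (by simp)).clm_apply contDiffAt_const).continuousAt
  obtain ⟨M, hM⟩ := (isCompact_Icc (a := -‖w‖) (b := ‖w‖)).exists_bound_of_continuousOn
    (f := fun z => fderiv ℝ φ (0, z) (1, 0)) fun z _ =>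
      (ContinuousAt.comp (f := fun z : ℝ => ((0 : ℝ), z)) (g := fun x => fderiv ℝ φ x (1, 0))
        (hcont z) (by fun_prop)).continuousWithinAt
  -- One ball of ε serves all values of ζ: there φ is differentiable and its ε-derivative is below M
  -- + 1, where M bounds it at ε = 0. The constant M + 1 is the dominating function.
  have h4 := (isCompact_Icc (a := -‖w‖) (b := ‖w‖)).eventually_forall_of_forall_eventually
    (x₀ := (0 : ℝ)) (P := fun ε z => ContDiffAt ℝ 1 φ (ε, z) ∧ |fderiv ℝ φ (ε, z) (1, 0)| < M + 1)
    fun z hz => by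
      refine (((h1 z).of_le (by simp)).eventually (by simp)).and ?_
      refine (hcont z).abs.eventually_lt continuousAt_const ?_
      have := hM z hz
      rw [Real.norm_eq_abs] at this
      linarith
  obtain ⟨e, he, hball⟩ := Metric.eventually_nhds_iff_ball.1 h4
  have hz : ∀ y, zeta w y ∈ Icc (-‖w‖) ‖w‖ := fun y => abs_le.1 (abs_zeta_le w y)
  set F : ℝ → ℝ × ℝ → ℝ := fun ε p => φ (ε, zeta w ![p.1, p.2]) * sin p.1
  set F' : ℝ → ℝ × ℝ → ℝ := fun ε p => fderiv ℝ φ (ε, zeta w ![p.1, p.2]) (1, 0) * sin p.1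
  have hzc : Continuous fun p : ℝ × ℝ => zeta w ![p.1, p.2] :=
    (contDiff_zeta w).continuous.comp continuous_chart
  have hFc : ∀ ε ∈ Metric.ball (0 : ℝ) e, Continuous (F ε) := fun ε hε => by
    refine Continuous.mul ?_ (continuous_sin.comp continuous_fst)
    refine continuous_iff_continuousAt.2 fun p => ?_
    exact ContinuousAt.comp (f := fun p : ℝ × ℝ => (ε, zeta w ![p.1, p.2])) (g := φ)
      (hball ε hε _ (hz _)).1.continuousAt (continuousAt_const.prodMk hzc.continuousAt)
  have hF'c : Continuous (F' 0) := by
    refine Continuous.mul ?_ (continuous_sin.comp continuous_fst)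
    refine continuous_iff_continuousAt.2 fun p => ?_
    exact ContinuousAt.comp (f := fun p : ℝ × ℝ => ((0 : ℝ), zeta w ![p.1, p.2]))
      (g := fun x => fderiv ℝ φ x (1, 0)) (hcont _) (continuousAt_const.prodMk hzc.continuousAt)
  have hderiv : ∀ p, ∀ ε ∈ Metric.ball (0 : ℝ) e, HasDerivAt (fun ε => F ε p) (F' ε p) ε := by
    intro p ε hε
    have hd : HasFDerivAt φ (fderiv ℝ φ (ε, zeta w ![p.1, p.2])) (ε, zeta w ![p.1, p.2]) :=
      ((hball ε hε _ (hz _)).1.differentiableAt (by simp)).hasFDerivAt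
    have hc : HasDerivAt (fun t : ℝ => (t, zeta w ![p.1, p.2])) (1, 0) ε :=
      (hasDerivAt_id _).prodMk (hasDerivAt_const _ _)
    exact (hd.comp_hasDerivAt ε hc).mul_const _
  have hmain := (hasDerivAt_integral_of_dominated_loc_of_deriv_le (μ := volume.restrict box)
    (F := F) (F' := F') (x₀ := 0) (s := Metric.ball (0 : ℝ) e) (bound := fun _ => M + 1)
    (Metric.ball_mem_nhds _ he)
    (by
      filter_upwards [Metric.ball_mem_nhds (0 : ℝ) he] with ε hε
      exact (hFc ε hε).aestronglyMeasurable)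
    (integrableOn_box (hFc 0 (Metric.mem_ball_self he)))
    hF'c.aestronglyMeasurable
    (Eventually.of_forall fun p ε hε => by
      have := (hball ε hε _ (hz ![p.1, p.2])).2
      simp only [F', norm_mul, Real.norm_eq_abs]
      calc _ ≤ |(fderiv ℝ φ (ε, zeta w ![p.1, p.2])) (1, 0)| * 1 := by
            gcongr; exact abs_sin_le_one _
        _ ≤ M + 1 := by linarith)
    (integrableOn_box continuous_const)
    (Eventually.of_forall hderiv)).2
  refine (hmain.congr_of_eventuallyEq ?_).congr_deriv ?_
  · filter_upwards [h3] with ε hε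
    exact setIntegral_congr_fun measurableSet_box fun p hp => by
      simp only [F, hε _ (mem_chartDomain_of_box hp)]
  · refine setIntegral_congr_fun measurableSet_box fun p hp => ?_
    have hy := mem_chartDomain_of_box hp
    have k1 : HasDerivAt (fun ε => F ε p) (δ ![p.1, p.2] * sin p.1) 0 := by
      refine ((hδ _ hy).mul_const _).congr_of_eventuallyEq ?_
      filter_upwards [h3] with ε hε
      simp only [F, hε _ hy]
    exact (hderiv p 0 (Metric.mem_ball_self he)).unique k1

/-! ### Green's identity on the sphere -/

lemma restrict_box : (volume : Measure (ℝ × ℝ)).restrict box =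
    (volume.restrict (Ioo (0 : ℝ) π)).prod (volume.restrict (Ioo (0 : ℝ) (2 * π))) := by
  rw [Measure.prod_restrict]; rfl

lemma integral_box {f : ℝ × ℝ → ℝ} (hf : Continuous f) :
    ∫ p in box, f p = ∫ a in Ioo (0 : ℝ) π, ∫ b in (0 : ℝ)..(2 * π), f (a, b) := by
  have h := integrableOn_box hf
  rw [IntegrableOn, restrict_box] at h
  rw [restrict_box, integral_prod _ h]
  simp only [intervalIntegral.integral_of_le two_pi_pos.le, integral_Ioc_eq_integral_Ioo]

lemma integral_box_symm {f : ℝ × ℝ → ℝ} (hf : Continuous f) :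
    ∫ p in box, f p = ∫ b in Ioo (0 : ℝ) (2 * π), ∫ a in (0 : ℝ)..π, f (a, b) := by
  have h := integrableOn_box hf
  rw [IntegrableOn, restrict_box] at h
  rw [restrict_box, integral_prod_symm _ h]
  simp only [intervalIntegral.integral_of_le pi_pos.le, integral_Ioc_eq_integral_Ioo]

lemma hasDerivAt_chart_zero {F : Chart → ℝ} (hF : ContDiff ℝ ∞ F) (a b : ℝ) :
    HasDerivAt (fun t => F ![t, b]) (pd 0 F ![a, b]) a := by
  have h := hasDerivAt_pd (hF.differentiable (by simp) ![a, b]) 0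
  have e : ∀ t : ℝ, Function.update (![a, b] : Chart) 0 t = ![t, b] := fun t => by
    ext i; fin_cases i <;> simp
  simpa only [e, Matrix.cons_val_zero] using h

lemma hasDerivAt_chart_one {F : Chart → ℝ} (hF : ContDiff ℝ ∞ F) (a b : ℝ) :
    HasDerivAt (fun t => F ![a, t]) (pd 1 F ![a, b]) b := by
  have h := hasDerivAt_pd (hF.differentiable (by simp) ![a, b]) 1
  have e : ∀ t : ℝ, Function.update (![a, b] : Chart) 1 t = ![a, t] := fun t => by
    ext i; fin_cases i <;> simp
  simpa only [e, Matrix.cons_val_one, Matrix.cons_val_fin_one] using h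

/-- The divergence theorem in the chart. For fixed θ the azimuthal term is integrated in φ first and
vanishes by periodicity, so the singular factor 1/sin θ never has to be integrable. The polar term
then integrates to boundary values of sin θ · η₀, which are zero at the poles. -/
lemma sphereInt_eq_zero_of_divergence {η₀ η₁ k : Chart → ℝ} (h0 : ContDiff ℝ ∞ η₀)
    (h1 : ContDiff ℝ ∞ η₁) (hper : ∀ a, η₁ ![a, 2 * π] = η₁ ![a, 0]) (hk : Continuous k)
    (h : ∀ y ∈ chartDomain, k y * sin (y 0) =
      pd 0 (fun z => sin (z 0) * η₀ z) y + pd 1 η₁ y / sin (y 0)) :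
    sphereInt k = 0 := by
  have hs : ContDiff ℝ ∞ fun z : Chart => sin (z 0) * η₀ z := ContDiff.mul (by fun_prop) h0
  have hc0 : Continuous fun p : ℝ × ℝ => pd 0 (fun z : Chart => sin (z 0) * η₀ z) ![p.1, p.2] :=
    (contDiff_pd hs 0).continuous.comp continuous_chart
  have hc1 : Continuous fun p : ℝ × ℝ => pd 1 η₁ ![p.1, p.2] :=
    (contDiff_pd h1 1).continuous.comp continuous_chart
  have hck : Continuous fun p : ℝ × ℝ => k ![p.1, p.2] * sin p.1 :=
    (hk.comp continuous_chart).mul (continuous_sin.comp continuous_fst)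
  have e1 : sphereInt k = ∫ p in box, pd 0 (fun z : Chart => sin (z 0) * η₀ z) ![p.1, p.2] := by
    rw [sphereInt, integral_box hck, integral_box hc0]
    refine setIntegral_congr_fun measurableSet_Ioo fun a ha => ?_
    have hm : ∀ b, ![a, b] ∈ chartDomain := fun b => ha
    have e : ∀ b, k ![a, b] * sin a = pd 0 (fun z => sin (z 0) * η₀ z) ![a, b] +
        pd 1 η₁ ![a, b] / sin a := fun b => h _ (hm b)
    have i0 : Continuous fun b : ℝ => pd 0 (fun z : Chart => sin (z 0) * η₀ z) ![a, b] :=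
      hc0.comp (continuous_const.prodMk continuous_id)
    have i1 : Continuous fun b : ℝ => pd 1 η₁ ![a, b] :=
      hc1.comp (continuous_const.prodMk continuous_id)
    simp only [e]
    rw [intervalIntegral.integral_add (i0.intervalIntegrable _ _)
      ((i1.div_const _).intervalIntegrable _ _), intervalIntegral.integral_div,
      intervalIntegral.integral_eq_sub_of_hasDerivAt (fun b _ => hasDerivAt_chart_one h1 a b)
        (i1.intervalIntegrable _ _), hper a]
    simp
  rw [e1, integral_box_symm hc0]
  refine integral_eq_zero_of_ae (Eventually.of_forall fun b => ?_)
  have i0 : Continuous fun a : ℝ => pd 0 (fun z : Chart => sin (z 0) * η₀ z) ![a, b] :=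
    hc0.comp (continuous_id.prodMk continuous_const)
  simp only [Pi.zero_apply]
  rw [intervalIntegral.integral_eq_sub_of_hasDerivAt (fun a _ => hasDerivAt_chart_zero hs a b)
    (i0.intervalIntegrable _ _)]
  simp

/-- The function on the chart is `2π`-periodic in the second variable. -/
def AzimuthPeriodic (F : Chart → ℝ) : Prop := ∀ a b, F ![a, b + 2 * π] = F ![a, b]

lemma azimuthPeriodic_comp_sph (F : S2 → ℝ) : AzimuthPeriodic (fun y => F (sph y)) := fun a b => by
  simp [sph, sin_add_two_pi, cos_add_two_pi]

lemma AzimuthPeriodic.pd_one {F : Chart → ℝ} (h : AzimuthPeriodic F) (hF : ContDiff ℝ ∞ F)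
    (a b : ℝ) : pd 1 F ![a, b + 2 * π] = pd 1 F ![a, b] := by
  have h1 := (hasDerivAt_chart_one hF a (b + 2 * π)).comp_add_const b (2 * π)
  simp only [h a] at h1
  exact h1.unique (hasDerivAt_chart_one hF a b)

/-- The field G∇F - F∇G has divergence GΔF - FΔG. The functions f and g are continuous stand-ins for
the Laplacians, whose chart formula is singular at the poles. -/
lemma sphereInt_green {F G f g : Chart → ℝ} (hF : ContDiff ℝ ∞ F) (hG : ContDiff ℝ ∞ G)
    (pF : AzimuthPeriodic F) (pG : AzimuthPeriodic G) (hf : Continuous f) (hg : Continuous g)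
    (ef : ∀ y ∈ chartDomain, roundLap F y = f y) (eg : ∀ y ∈ chartDomain, roundLap G y = g y) :
    sphereInt (fun y => G y * f y) = sphereInt (fun y => F y * g y) := by
  have hd : sphereInt (fun y => G y * f y + -1 * (F y * g y)) = 0 := by
    refine sphereInt_eq_zero_of_divergence (η₀ := fun y => G y * pd 0 F y - F y * pd 0 G y)
      (η₁ := fun y => G y * pd 1 F y - F y * pd 1 G y)
      ((hG.mul (contDiff_pd hF 0)).sub (hF.mul (contDiff_pd hG 0)))
      ((hG.mul (contDiff_pd hF 1)).sub (hF.mul (contDiff_pd hG 1))) (fun a => ?_)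
      ((hG.continuous.mul hf).add (continuous_const.mul (hF.continuous.mul hg))) fun y hy => ?_
    · have h1 := pF a 0
      have h2 := pG a 0
      have h3 := pF.pd_one hF a 0
      have h4 := pG.pd_one hG a 0
      simp only [zero_add] at h1 h2 h3 h4
      simp only [h1, h2, h3, h4]
    · have hs := sin_ne_zero_of_mem hy
      have dF := hF.differentiable (by simp) y
      have dG := hG.differentiable (by simp) y
      have dF' := fun i => (contDiff_pd hF i).differentiable (by simp) y
      have dG' := fun i => (contDiff_pd hG i).differentiable (by simp) y
      have hsin : pd 0 (fun z : Chart => sin (z 0)) y = cos (y 0) := by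
        rw [pd_coord_self]; simp
      have dsin : DifferentiableAt ℝ (fun z : Chart => sin (z 0)) y := by fun_prop
      have e : ∀ i, pd i (fun y => G y * pd i F y - F y * pd i G y) y =
          G y * pd i (pd i F) y - F y * pd i (pd i G) y := fun i => by
        rw [pd_sub (dG.fun_mul (dF' i)) (dF.fun_mul (dG' i)), pd_mul dG (dF' i), pd_mul dF (dG' i)]
        ring
      rw [pd_mul dsin ((dG.fun_mul (dF' 0)).fun_sub (dF.fun_mul (dG' 0))), e, e, hsin, ← ef y hy,
        ← eg y hy, roundLap_eq, roundLap_eq]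
      field_simp
      ring
  have cF := hF.continuous
  have cG := hG.continuous
  rw [sphereInt_add (F := fun y => G y * f y) (G := fun y => -1 * (F y * g y)) (by fun_prop)
    (by fun_prop), sphereInt_const_mul] at hd
  linarith

lemma sphereInt_laplacian {F f : Chart → ℝ} (hF : ContDiff ℝ ∞ F) (pF : AzimuthPeriodic F)
    (hf : Continuous f) (ef : ∀ y ∈ chartDomain, roundLap F y = f y) : sphereInt f = 0 := by
  have h := sphereInt_green (G := fun _ => 1) (g := fun _ => 0) hF contDiff_const pF
    (fun _ _ => rfl) hf continuous_const ef fun y _ => roundLap_const 1 y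
  simpa [sphereInt] using h

lemma sphereInt_one : sphereInt (fun _ => 1) = 4 * π := by
  rw [sphereInt, integral_box (f := fun p => 1 * sin p.1) (by fun_prop)]
  simp only [one_mul, intervalIntegral.integral_const, sub_zero, smul_eq_mul]
  rw [integral_const_mul, ← integral_Ioc_eq_integral_Ioo,
    ← intervalIntegral.integral_of_le pi_pos.le, integral_sin]
  norm_num
  ring

lemma sphereInt_const (c : ℝ) : sphereInt (fun _ => c) = 4 * π * c := by
  have := sphereInt_const_mul c (fun _ => 1)
  rw [sphereInt_one] at this
  simpa [mul_comm] using this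

/-! ### Integrals of products of linear functions. -/

lemma roundLap_mul {F G : Chart → ℝ} (hF : ContDiff ℝ ∞ F) (hG : ContDiff ℝ ∞ G) (y : Chart) :
    roundLap (fun z => F z * G z) y = F y * roundLap G y + G y * roundLap F y +
      2 * (pd 0 F y * pd 0 G y + pd 1 F y * pd 1 G y / sin (y 0) ^ 2) := by
  have dF := fun y => hF.differentiable (by simp) y
  have dG := fun y => hG.differentiable (by simp) y
  have dF' := fun i y => (contDiff_pd hF i).differentiable (by simp) y
  have dG' := fun i y => (contDiff_pd hG i).differentiable (by simp) y
  have e1 : ∀ i, pd i (fun z => F z * G z) = fun z => pd i F z * G z + F z * pd i G z :=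
    fun i => funext fun z => pd_mul (dF z) (dG z) i
  have e2 : ∀ i, pd i (pd i (fun z => F z * G z)) y =
      pd i (pd i F) y * G y + 2 * (pd i F y * pd i G y) + F y * pd i (pd i G) y := fun i => by
    rw [e1, pd_add ((dF' i y).fun_mul (dG y)) ((dF y).fun_mul (dG' i y)), pd_mul (dF' i y) (dG y),
      pd_mul (dF y) (dG' i y)]
    ring
  rw [roundLap_eq, e2, e2, e1, roundLap_eq, roundLap_eq]
  ring

lemma azimuthPeriodic_zeta (w : E3) : AzimuthPeriodic (zeta w) :=
  azimuthPeriodic_comp_sph fun ϑ => inner ℝ w (ϑ : E3)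

lemma AzimuthPeriodic.mul {F G : Chart → ℝ} (hF : AzimuthPeriodic F) (hG : AzimuthPeriodic G) :
    AzimuthPeriodic (fun y => F y * G y) := fun a b => by simp only [hF a b, hG a b]

@[fun_prop]
lemma continuous_zeta (w : E3) : Continuous (zeta w) := (contDiff_zeta w).continuous

lemma sphereInt_zeta (w : E3) : sphereInt (zeta w) = 0 := by
  have h := sphereInt_laplacian (contDiff_zeta w) (azimuthPeriodic_zeta w)
    (f := fun y => -2 * zeta w y) (by fun_prop) fun y hy => roundLap_zeta w hy
  rw [sphereInt_const_mul] at h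
  linarith

lemma roundLap_zeta_mul_zeta (w v : E3) {y : Chart} (hy : y ∈ chartDomain) :
    roundLap (fun z => zeta w z * zeta v z) y =
      2 * inner ℝ w v + -6 * (zeta w y * zeta v y) := by
  rw [roundLap_mul (contDiff_zeta w) (contDiff_zeta v), roundLap_zeta w hy, roundLap_zeta v hy,
    gradient_zeta w v hy]
  ring

/-- Integrating Δ(ζ_w ζ_v) = 2⟨w, v⟩ - 6 ζ_w ζ_v over the sphere gives the second moments. -/
lemma sphereInt_zeta_mul_zeta (w v : E3) :
    sphereInt (fun y => zeta w y * zeta v y) = 4 * π / 3 * inner ℝ w v := by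
  have h := sphereInt_laplacian ((contDiff_zeta w).mul (contDiff_zeta v))
    ((azimuthPeriodic_zeta w).mul (azimuthPeriodic_zeta v))
    (f := fun y => 2 * inner ℝ w v + -6 * (zeta w y * zeta v y)) (by fun_prop)
    fun y hy => roundLap_zeta_mul_zeta w v hy
  rw [sphereInt_add (F := fun _ => 2 * inner ℝ w v) (G := fun y => -6 * (zeta w y * zeta v y))
    (by fun_prop) (by fun_prop), sphereInt_const, sphereInt_const_mul] at h
  linarith

/-- Green's identity gives -2I = -6I for this integral I: a linear function has eigenvalue -2, and
the non-constant part of a product of two has -6. -/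
lemma sphereInt_zeta_mul_zeta_mul_zeta (w v x : E3) :
    sphereInt (fun y => zeta w y * (zeta v y * zeta x y)) = 0 := by
  have hg := sphereInt_green (F := zeta w) (G := fun y => zeta v y * zeta x y) (contDiff_zeta w)
    ((contDiff_zeta v).mul (contDiff_zeta x)) (azimuthPeriodic_zeta w)
    ((azimuthPeriodic_zeta v).mul (azimuthPeriodic_zeta x))
    (f := fun y => -2 * zeta w y) (g := fun y => 2 * inner ℝ v x + -6 * (zeta v y * zeta x y))
    (by fun_prop) (by fun_prop)
    (fun y hy => roundLap_zeta w hy) fun y hy => roundLap_zeta_mul_zeta v x hy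
  have e1 : sphereInt (fun y => zeta v y * zeta x y * (-2 * zeta w y)) =
      -2 * sphereInt (fun y => zeta w y * (zeta v y * zeta x y)) := by
    rw [← sphereInt_const_mul]; congr 1; ext y; ring
  have e2 : sphereInt (fun y => zeta w y * (2 * inner ℝ v x + -6 * (zeta v y * zeta x y))) =
      -6 * sphereInt (fun y => zeta w y * (zeta v y * zeta x y)) := by
    have : (fun y => zeta w y * (2 * inner ℝ v x + -6 * (zeta v y * zeta x y))) =
        fun y => 2 * inner ℝ v x * zeta w y + -6 * (zeta w y * (zeta v y * zeta x y)) := by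
      ext y; ring
    rw [this, sphereInt_add (F := fun y => 2 * inner ℝ v x * zeta w y)
      (G := fun y => -6 * (zeta w y * (zeta v y * zeta x y))) (by fun_prop) (by fun_prop),
      sphereInt_const_mul, sphereInt_const_mul, sphereInt_zeta]
    ring
  rw [e1, e2] at hg
  linarith

/-! ### Area radius and Hawking mass of zonal foliations -/

namespace ConformalJet

variable {h : ℝ → Chart → Mat2} {r : ℝ} {φ : Chart → ℝ} {y : Chart}

lemma areaElement (H : ConformalJet h r φ) (hy : y ∈ chartDomain) :
    √((h 0 y).det) / sin (y 0) = r ^ 2 ∧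
      HasDerivAt (fun ε => √((h ε y).det) / sin (y 0)) (2 * r ^ 2 * φ y) 0 := by
  have hs := sin_pos_of_mem hy
  have hr := H.pos
  have hv := H.det.value hy
  have e : √(r ^ 4 * sin (y 0) ^ 2) = r ^ 2 * sin (y 0) := by
    rw [show r ^ 4 * sin (y 0) ^ 2 = (r ^ 2 * sin (y 0)) ^ 2 by ring, Real.sqrt_sq (by positivity)]
  refine ⟨?_, ?_⟩
  · rw [hv, e, mul_div_cancel_right₀ _ hs.ne']
  · have hd := ((H.det.hasDerivAt hy).sqrt (by rw [hv]; positivity)).div_const (sin (y 0))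
    refine hd.congr_deriv ?_
    rw [hv, e]
    field_simp
    ring

end ConformalJet

lemma roundLap_affine (w : E3) (a b : ℝ) {y : Chart} (hy : y ∈ chartDomain) :
    roundLap (fun y => a + b * zeta w y) y = -2 * b * zeta w y := by
  rw [roundLap_add (F := fun _ => a) (G := fun y => b * zeta w y) (fun _ _ => contDiffAt_const)
    (fun _ _ => (contDiff_const.mul (contDiff_zeta w)).contDiffAt) hy, roundLap_const,
    roundLap_const_mul b (fun _ _ => (contDiff_zeta w).contDiffAt) hy, roundLap_zeta w hy]
  ring

namespace ZonalFoliation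

variable {w : E3} {r₀ c₀ u α β α' β' : ℝ} {δh δf : ℝ → S2 → ℝ}

lemma leafJet (Z : ZonalFoliation w r₀ c₀ u α β α' β' δh δf) :
    LeafJet r₀ u (fun ε y => varF δf ε u (sph y))
      (fun ε y => varH δh ε (varF δf ε u (sph y)) (sph y)) (slice δf u) (slice δh u) :=
  CMAFoliation.leafJet Z.pos Z.nonneg Z.smooth_h Z.smooth_f

lemma metric (Z : ZonalFoliation w r₀ c₀ u α β α' β' δh δf) :
    ConformalJet (fun ε => leafMetric r₀ (varH δh ε) (varF δf ε) u) (r₀ + u)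
      (fun y => radiusPert r₀ u (slice δf u) (slice δh u) y / (r₀ + u)) :=
  Z.leafJet.metric

lemma radiusPert_eq (Z : ZonalFoliation w r₀ c₀ u α β α' β' δh δf) (y : Chart) :
    radiusPert r₀ u (slice δf u) (slice δh u) y =
      (α + u / (r₀ + u) * c₀) + (β + u / (r₀ + u) * r₀) * zeta w y := by
  rw [radiusPert, Z.eq_f, Z.eq_h u Z.nonneg]
  ring

lemma sphereInt_affine (a b : ℝ) : sphereInt (fun y => a + b * zeta w y) = 4 * π * a := by
  rw [sphereInt_add (F := fun _ => a) (G := fun y => b * zeta w y) (by fun_prop) (by fun_prop),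
    sphereInt_const, sphereInt_const_mul, sphereInt_zeta]
  ring

lemma folRadius_zero (Z : ZonalFoliation w r₀ c₀ u α β α' β' δh δf) :
    folRadius r₀ (varH δh 0) (varF δf 0) u = r₀ + u := by
  have hr := Z.radius_pos
  rw [folRadius, areaRadius, surfaceIntegral_eq,
    sphereInt_congr (G := fun _ => (r₀ + u) ^ 2) fun y hy => by
      rw [one_mul]; exact (Z.metric.areaElement hy).1,
    sphereInt_const, mul_div_cancel_left₀ _ (by positivity), Real.sqrt_sq hr.le]

/-- The ζ-part of the area variation integrates to zero, so the area radius feels only the mean of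
the radius perturbation. -/
lemma hasDerivAt_folRadius (Z : ZonalFoliation w r₀ c₀ u α β α' β' δh δf) :
    HasDerivAt (fun ε => folRadius r₀ (varH δh ε) (varF δf ε) u) (α + u / (r₀ + u) * c₀) 0 := by
  have hr := Z.radius_pos
  have h0 : surfaceIntegral (leafMetric r₀ (varH δh 0) (varF δf 0) u) (fun _ => 1) / (4 * π) =
      (r₀ + u) ^ 2 := by
    rw [surfaceIntegral_eq, sphereInt_congr (G := fun _ => (r₀ + u) ^ 2) fun y hy => by
      rw [one_mul]; exact (Z.metric.areaElement hy).1,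
      sphereInt_const, mul_div_cancel_left₀ _ (by positivity)]
  have hA : HasDerivAt (fun ε => surfaceIntegral (leafMetric r₀ (varH δh ε) (varF δf ε) u)
      (fun _ => 1)) (4 * π * (2 * (r₀ + u) * (α + u / (r₀ + u) * c₀))) 0 := by
    simp only [surfaceIntegral_eq, one_mul]
    have hz : Zonal w (fun ε y => √((leafMetric r₀ (varH δh ε) (varF δf ε) u y).det) / sin (y 0))
      (fun _ => (r₀ + u) ^ 2) := Z.leaf.det
    refine (hasDerivAt_sphereInt_of_zonal hz fun y hy =>
      (Z.metric.areaElement hy).2).congr_deriv ?_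
    rw [← sphereInt_affine (w := w) _ (2 * (r₀ + u) * (β + u / (r₀ + u) * r₀))]
    congr 1; ext y
    rw [Z.radiusPert_eq]
    field_simp
  have hs := (hA.div_const (4 * π)).sqrt (by rw [h0]; positivity)
  refine hs.congr_deriv ?_
  rw [h0, Real.sqrt_sq hr.le]
  field_simp

/-- The labelling of the leaves by their area radius. -/
lemma labelling_iff (Z : ZonalFoliation w r₀ c₀ u α β α' β' δh δf) {α₁ β₁ : ℝ}
    (Z0 : ZonalFoliation w r₀ c₀ 0 0 0 α₁ β₁ δh δf) : HasDerivAt (fun ε =>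
      folRadius r₀ (varH δh ε) (varF δf ε) u - (folRadius r₀ (varH δh ε) (varF δf ε) 0 + u)) 0 0 ↔
      α = -(u / (r₀ + u) * c₀) := by
  have h := Z.hasDerivAt_folRadius.sub (Z0.hasDerivAt_folRadius.add_const u)
  have hr := Z.radius_pos.ne'
  constructor
  · intro h'
    have := h'.unique h
    simp only [zero_div, zero_mul, add_zero, sub_zero] at this
    linarith
  · intro e
    refine h.congr_deriv ?_
    rw [e]; simp

lemma surfaceIntegral_expansions_zero (Z : ZonalFoliation w r₀ c₀ u α β α' β' δh δf) :
    surfaceIntegral (leafMetric r₀ (varH δh 0) (varF δf 0) u) (fun y =>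
      expansion r₀ (CMAFoliation.leaf (varH δh 0) (varF δf 0) u)
        (folLp r₀ (varH δh 0) (varF δf 0) u) y *
      expansion r₀ (CMAFoliation.leaf (varH δh 0) (varF δf 0) u)
        (folLb r₀ (varH δh 0) (varF δf 0) u) y) = 16 * π * (u / (r₀ + u)) := by
  have hr := Z.radius_pos
  have J := Z.leafJet
  have e1 := J.expansion (folLp_jet Z.pos Z.nonneg Z.smooth_h Z.smooth_f)
  have e2 := J.expansion (folLb_jet Z.pos Z.nonneg Z.smooth_h Z.smooth_f)
  rw [surfaceIntegral_eq, sphereInt_congr (G := fun _ => 4 * (u / (r₀ + u))), sphereInt_const]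
  · ring
  · intro y hy
    have k1 := e1.value hy
    have k2 := e2.value hy
    have k3 := (Z.metric.areaElement hy).1
    simp only [CMAFoliation.leaf] at k1 k2 k3 ⊢
    rw [k1, k2, k3]
    field_simp
    ring

lemma folHawkingMass_zero (Z : ZonalFoliation w r₀ c₀ u α β α' β' δh δf) :
    folHawkingMass r₀ (varH δh 0) (varF δf 0) u = r₀ / 2 := by
  have hr := Z.radius_pos
  have h1 := Z.folRadius_zero
  have h2 := Z.surfaceIntegral_expansions_zero
  simp only [folRadius, leafMetric] at h1 h2
  rw [folHawkingMass, hawkingMass, h1, h2]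
  field_simp
  ring

/-- The first variation of the integrand tr χ' tr χ̲ dvol is affine in ζ. The prescribed α and α'
cancel its constant term and the ζ-term has zero mean; α also keeps the area radius fixed. -/
lemma hasDerivAt_folHawkingMass (Z : ZonalFoliation w r₀ c₀ u α β α' β' δh δf)
    (hα : α = -(u / (r₀ + u) * c₀)) (hα' : α' = -(r₀ / (r₀ + u) ^ 2 * c₀)) :
    HasDerivAt (fun ε => folHawkingMass r₀ (varH δh ε) (varF δf ε) u) 0 0 := by
  have hr := Z.radius_pos
  have J := Z.leafJet
  have e1 := J.expansion (folLp_jet Z.pos Z.nonneg Z.smooth_h Z.smooth_f)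
  have e2 := J.expansion (folLb_jet Z.pos Z.nonneg Z.smooth_h Z.smooth_f)
  obtain ⟨q1, z1⟩ := Z.expansion_out
  obtain ⟨q2, z2⟩ := Z.expansion_in
  have z3 : Zonal w (fun ε y => √((leafMetric r₀ (varH δh ε) (varF δf ε) u y).det) / sin (y 0))
      (fun _ => (r₀ + u) ^ 2) := Z.leaf.det
  have hS : HasDerivAt (fun ε => surfaceIntegral (leafMetric r₀ (varH δh ε) (varF δf ε) u)
      (fun y => expansion r₀ (CMAFoliation.leaf (varH δh ε) (varF δf ε) u)
        (folLp r₀ (varH δh ε) (varF δf ε) u) y *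
      expansion r₀ (CMAFoliation.leaf (varH δh ε) (varF δf ε) u)
        (folLb r₀ (varH δh ε) (varF δf ε) u) y)) 0 0 := by
    simp only [surfaceIntegral_eq]
    refine (hasDerivAt_sphereInt_of_zonal ((z1.mul z2).mul z3) fun y hy =>
      ((e1.hasDerivAt hy).fun_mul (e2.hasDerivAt hy)).fun_mul
        (Z.metric.areaElement hy).2).congr_deriv ?_
    have hF : slice δf u = fun y => α + β * zeta w y := funext Z.eq_f
    have hH : slice δh u = fun y => c₀ + r₀ * zeta w y := funext (Z.eq_h u Z.nonneg)
    -- Only the vanishing constant term 0 matters; the long expression is the coefficient of ζ,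
    -- whose value is immaterial.
    refine Eq.trans ?_ ((sphereInt_affine (w := w) 0
      ((2 * ((β + u / (r₀ + u) * r₀) - u * (r₀ ^ 2 / (r₀ + u) ^ 2 + β') + 2 * β
          - 2 * u * (β + u / (r₀ + u) * r₀) / (r₀ + u)) / (r₀ + u) ^ 2 * (2 / (r₀ + u))
        + 2 * u / (r₀ + u) ^ 2 * (2 * (-(β + u / (r₀ + u) * r₀) + (r₀ + u) * β' +
          r₀ ^ 2 / (r₀ + u) + 2 * r₀) / (r₀ + u) ^ 2)) * (r₀ + u) ^ 2
        + 8 * u / (r₀ + u) ^ 2 * (β + u / (r₀ + u) * r₀))).trans (mul_zero _))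
    refine sphereInt_congr fun y hy => ?_
    have k1 := e1.value hy
    have k2 := e2.value hy
    have k3 := (Z.metric.areaElement hy).1
    rw [k1, k2, k3, Z.radiusPert_eq, Z.eq_rate, hF, hH, roundLap_affine w _ _ hy,
      roundLap_affine w _ _ hy, hα, hα']
    field_simp
    ring
  have hR := Z.hasDerivAt_folRadius
  rw [hα, neg_add_cancel] at hR
  have h := (hR.div_const 2).mul ((hS.const_mul (1 / (16 * π))).const_sub 1)
  refine h.congr_deriv (by simp)

end ZonalFoliation

/-! ### Moments of solutions of the linearised mass aspect equation -/

/-- Here the integrand is smooth on the whole plane, so compactness of the closed rectangle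
dominates its derivative and no zonal structure is needed. -/
lemma hasDerivAt_sphereInt_of_contDiff {Φ : ℝ × Chart → ℝ} (hΦ : ContDiff ℝ ∞ Φ) (u : ℝ) :
    HasDerivAt (fun v => sphereInt fun y => Φ (v, y))
      (sphereInt fun y => deriv (fun v => Φ (v, y)) u) u := by
  have hpart : ∀ v y, HasDerivAt (fun v => Φ (v, y)) (fderiv ℝ Φ (v, y) (1, 0)) v := fun v y => by
    have hd : HasFDerivAt Φ (fderiv ℝ Φ (v, y)) (v, y) :=
      (hΦ.differentiable (by simp) _).hasFDerivAt
    have hc : HasDerivAt (fun t : ℝ => (t, y)) (1, 0) v :=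
      (hasDerivAt_id _).prodMk (hasDerivAt_const _ _)
    exact hd.comp_hasDerivAt v hc
  have hcont : Continuous fun x : ℝ × Chart => fderiv ℝ Φ x (1, 0) :=
    (hΦ.continuous_fderiv (by simp)).clm_apply continuous_const
  have hchart : Continuous fun x : ℝ × ℝ × ℝ => (x.1, (![x.2.1, x.2.2] : Chart)) :=
    continuous_fst.prodMk (continuous_chart.comp continuous_snd)
  obtain ⟨M, hM⟩ := (isCompact_Icc (a := u - 1) (b := u + 1)).prod
    ((isCompact_Icc (a := (0 : ℝ)) (b := π)).prod (isCompact_Icc (a := (0 : ℝ)) (b := 2 * π)))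
    |>.exists_bound_of_continuousOn (hcont.comp hchart).continuousOn
  have hslice : ∀ v, Continuous fun p : ℝ × ℝ => Φ (v, ![p.1, p.2]) * sin p.1 := fun v =>
    (hΦ.continuous.comp (hchart.comp (continuous_const.prodMk continuous_id))).mul
      (continuous_sin.comp continuous_fst)
  have hslice' : Continuous fun p : ℝ × ℝ => fderiv ℝ Φ (u, ![p.1, p.2]) (1, 0) * sin p.1 :=
    (hcont.comp (hchart.comp (continuous_const.prodMk continuous_id))).mul
      (continuous_sin.comp continuous_fst)
  have hmain := (hasDerivAt_integral_of_dominated_loc_of_deriv_le (μ := volume.restrict box)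
    (F := fun v p => Φ (v, ![p.1, p.2]) * sin p.1)
    (F' := fun v p => fderiv ℝ Φ (v, ![p.1, p.2]) (1, 0) * sin p.1) (x₀ := u)
    (s := Icc (u - 1) (u + 1)) (bound := fun _ => M) (Icc_mem_nhds (by linarith) (by linarith))
    (Eventually.of_forall fun v => (hslice v).aestronglyMeasurable)
    (integrableOn_box (hslice u)) hslice'.aestronglyMeasurable
    ((ae_restrict_iff' measurableSet_box).2 (Eventually.of_forall fun p hp v hv => by
      have := hM (v, p) ⟨hv, box_subset hp⟩
      simp only [Function.comp_apply] at this
      rw [norm_mul]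
      calc _ ≤ ‖(fderiv ℝ Φ (v, ![p.1, p.2])) (1, 0)‖ * 1 := by
            gcongr; exact abs_sin_le_one _
        _ ≤ M := by rw [mul_one]; exact this))
    (integrableOn_box continuous_const)
    (Eventually.of_forall fun p v _ => (hpart v _).mul_const _)).2
  refine hmain.congr_deriv ?_
  rw [sphereInt]
  simp only [(hpart u _).deriv]

lemma eq_zero_of_linear_ode {m m' k : ℝ → ℝ} {K : ℝ} (h0 : m 0 = 0)
    (hd : ∀ u, 0 ≤ u → HasDerivAt m (m' u) u) (he : ∀ u, 0 ≤ u → m' u = k u * m u)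
    (hk : ∀ u, 0 ≤ u → |k u| ≤ K) {u : ℝ} (hu : 0 ≤ u) : m u = 0 := by
  have h := norm_le_gronwallBound_of_norm_deriv_right_le (f := m) (f' := m') (δ := 0) (K := K)
    (ε := 0) (a := 0) (b := u) (fun x hx => (hd x hx.1).continuousAt.continuousWithinAt)
    (fun x hx => (hd x hx.1).hasDerivWithinAt) (by simp [h0])
    (fun x hx => by
      rw [he x hx.1, norm_mul, add_zero]
      gcongr
      exact hk x hx.1) u ⟨hu, le_rfl⟩
  rw [gronwallBound_ε0_δ0] at h
  exact norm_le_zero_iff.1 h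

/-- From Δ(ζ · ζ^{n-1}) and |∇ζ|² = ‖a‖² - ζ². The truncated exponent n - 2 is harmless, since its
coefficient n(n - 1) vanishes for n = 0 and n = 1. -/
lemma roundLap_zeta_pow (a : E3) (n : ℕ) {y : Chart} (hy : y ∈ chartDomain) :
    roundLap (fun z => zeta a z ^ n) y = -(n * (n + 1)) * zeta a y ^ n
      + n * (n - 1) * ‖a‖ ^ 2 * zeta a y ^ (n - 2) := by
  induction n using Nat.strong_induction_on with
  | _ n ih =>
    match n with
    | 0 => simp [roundLap_const]
    | 1 => simp [roundLap_zeta a hy]; ring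
    | k + 2 =>
      have hz := contDiff_zeta a
      have hpd : ∀ i, pd i (fun z => zeta a z ^ (k + 1)) y =
          ((k : ℝ) + 1) * zeta a y ^ k * pd i (zeta a) y := fun i => by
        have := pd_comp (g := fun t => t ^ (k + 1)) (hasDerivAt_pow (k + 1) (zeta a y))
          (hz.differentiable (by simp) y) i
        simpa using this
      have e : (fun z => zeta a z ^ (k + 2)) = fun z => zeta a z * zeta a z ^ (k + 1) := by
        ext z; ring
      have hg := gradient_zeta a a hy
      rw [real_inner_self_eq_norm_sq] at hg
      rw [e, roundLap_mul hz (hz.pow (k + 1)), ih (k + 1) (by omega), roundLap_zeta a hy, hpd, hpd]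
      have hg2 : pd 0 (zeta a) y * (((k : ℝ) + 1) * zeta a y ^ k * pd 0 (zeta a) y) +
          pd 1 (zeta a) y * (((k : ℝ) + 1) * zeta a y ^ k * pd 1 (zeta a) y) / sin (y 0) ^ 2 =
          ((k : ℝ) + 1) * zeta a y ^ k * (‖a‖ ^ 2 - zeta a y * zeta a y) := by
        rw [← hg]; ring
      rw [hg2]
      rcases k with _ | j
      · simp; ring
      · rw [show j + 1 + 1 - 2 = j by omega, show j + 1 + 2 - 2 = j + 1 by omega]
        push_cast
        ring

lemma azimuthPeriodic_zeta_pow (a : E3) (n : ℕ) : AzimuthPeriodic (fun y => zeta a y ^ n) :=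
  fun b c => by simp only [azimuthPeriodic_zeta a b c]

/-- Families of functions `D u` on the sphere, with `u`-derivatives `D' u`, of zero mean and zero
initial value, with `Δ (D' - D / r) = -(3 r₀ / r²) D`. -/
structure MeanFreeSolution (r₀ : ℝ) (D D' : ℝ → Chart → ℝ) : Prop where
  pos : 0 < r₀
  smooth : ∀ u, ContDiff ℝ ∞ (D u)
  smooth' : ∀ u, ContDiff ℝ ∞ (D' u)
  periodic : ∀ u, AzimuthPeriodic (D u)
  periodic' : ∀ u, AzimuthPeriodic (D' u)
  mean : ∀ u, sphereInt (D u) = 0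
  init : ∀ y, D 0 y = 0
  equation : ∀ u, 0 ≤ u → ∀ y ∈ chartDomain, roundLap (fun z => D' u z + -(1 / (r₀ + u)) * D u z) y =
    -(3 * r₀ / (r₀ + u) ^ 2) * D u y
  moment : ∀ (G : Chart → ℝ), ContDiff ℝ ∞ G → ∀ u, 0 ≤ u →
    HasDerivAt (fun v => sphereInt fun y => G y * D v y) (sphereInt fun y => G y * D' u y) u

namespace MeanFreeSolution

variable {r₀ : ℝ} {D D' : ℝ → Chart → ℝ}

/-- The equation is tested with ζⁿ and the Laplacian is moved onto ζⁿ by Green's identity. The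
result couples the n-th moment only to the moment of order n - 2. -/
lemma moment_equation (S : MeanFreeSolution r₀ D D') (a : E3) (n : ℕ) {u : ℝ} (hu : 0 ≤ u) :
    -(3 * r₀ / (r₀ + u) ^ 2) * sphereInt (fun y => zeta a y ^ n * D u y) =
      -(n * (n + 1)) * (sphereInt (fun y => zeta a y ^ n * D' u y)
        - 1 / (r₀ + u) * sphereInt (fun y => zeta a y ^ n * D u y))
      + n * (n - 1) * ‖a‖ ^ 2 * (sphereInt (fun y => zeta a y ^ (n - 2) * D' u y)
        - 1 / (r₀ + u) * sphereInt (fun y => zeta a y ^ (n - 2) * D u y)) := by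
  have hz := contDiff_zeta a
  have c := (S.smooth u).continuous
  have c' := (S.smooth' u).continuous
  have h := sphereInt_green (F := fun z => D' u z + -(1 / (r₀ + u)) * D u z)
    (G := fun y => zeta a y ^ n) (f := fun y => -(3 * r₀ / (r₀ + u) ^ 2) * D u y)
    (g := fun y => -(n * (n + 1)) * zeta a y ^ n + n * (n - 1) * ‖a‖ ^ 2 * zeta a y ^ (n - 2))
    ((S.smooth' u).add (contDiff_const.mul (S.smooth u))) (hz.pow n)
    (fun b c => by simp only [S.periodic u b c, S.periodic' u b c])
    (azimuthPeriodic_zeta_pow a n) (by fun_prop) (by fun_prop) (S.equation u hu)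
    fun y hy => roundLap_zeta_pow a n hy
  have e1 : sphereInt (fun y => zeta a y ^ n * (-(3 * r₀ / (r₀ + u) ^ 2) * D u y)) =
      -(3 * r₀ / (r₀ + u) ^ 2) * sphereInt (fun y => zeta a y ^ n * D u y) := by
    rw [← sphereInt_const_mul]; congr 1; ext y; ring
  have e2 : ∀ k : ℕ, sphereInt (fun y => zeta a y ^ k * (D' u y + -(1 / (r₀ + u)) * D u y)) =
      sphereInt (fun y => zeta a y ^ k * D' u y)
        - 1 / (r₀ + u) * sphereInt (fun y => zeta a y ^ k * D u y) := fun k => by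
    have : (fun y => zeta a y ^ k * (D' u y + -(1 / (r₀ + u)) * D u y)) = fun y =>
      zeta a y ^ k * D' u y + -(1 / (r₀ + u)) * (zeta a y ^ k * D u y) := by ext y; ring
    rw [this, sphereInt_add (F := fun y => zeta a y ^ k * D' u y)
      (G := fun y => -(1 / (r₀ + u)) * (zeta a y ^ k * D u y)) (by fun_prop) (by fun_prop),
      sphereInt_const_mul]
    ring
  have e3 : sphereInt (fun y => (D' u y + -(1 / (r₀ + u)) * D u y) *
      (-(n * (n + 1)) * zeta a y ^ n + n * (n - 1) * ‖a‖ ^ 2 * zeta a y ^ (n - 2))) =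
      -(n * (n + 1)) * sphereInt (fun y => zeta a y ^ n * (D' u y + -(1 / (r₀ + u)) * D u y)) +
      n * (n - 1) * ‖a‖ ^ 2 *
        sphereInt (fun y => zeta a y ^ (n - 2) * (D' u y + -(1 / (r₀ + u)) * D u y)) := by
    rw [← sphereInt_const_mul, ← sphereInt_const_mul, ← sphereInt_add (by fun_prop) (by fun_prop)]
    congr 1; ext y; ring
  rw [e1, e3, e2, e2] at h
  exact h

/-- Strong induction on the degree. Once the lower moments vanish, the n-th one solves a homogeneous
linear ODE with bounded coefficient and zero initial value. Degree 0 is the zero-mean condition,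
where the ODE would degenerate. -/
lemma moment_eq_zero (S : MeanFreeSolution r₀ D D') (a : E3) (n : ℕ) :
    ∀ u, 0 ≤ u → sphereInt (fun y => zeta a y ^ n * D u y) = 0 := by
  have hr₀ := S.pos
  induction n using Nat.strong_induction_on with
  | _ n ih =>
    rcases Nat.eq_zero_or_pos n with rfl | hn
    · intro u _; simpa using S.mean u
    have hz := contDiff_zeta a
    have hn' : (0 : ℝ) < n := by exact_mod_cast hn
    -- The moment of order n - 2 is zero for u ≥ 0, hence so is its derivative, at u = 0 by
    -- uniqueness of one-sided derivatives. For n = 1 the coefficient vanishes instead.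
    have hlow : ∀ u, 0 ≤ u → (n : ℝ) * (n - 1) * ‖a‖ ^ 2 *
        (sphereInt (fun y => zeta a y ^ (n - 2) * D' u y)
          - 1 / (r₀ + u) * sphereInt (fun y => zeta a y ^ (n - 2) * D u y)) = 0 := by
      intro u hu
      rcases Nat.eq_or_lt_of_le (Nat.succ_le_of_lt hn) with h1 | h2
      · rw [← h1]; simp
      have hm := ih (n - 2) (by omega)
      have hd := (S.moment _ (hz.pow (n - 2)) u hu).hasDerivWithinAt (s := Ici 0)
      have h0 : HasDerivWithinAt (fun v => sphereInt fun y => zeta a y ^ (n - 2) * D v y) 0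
          (Ici 0) u := (hasDerivWithinAt_const u (Ici 0) (0 : ℝ)).congr_of_mem
            (fun v hv => hm v hv) hu
      have := (uniqueDiffOn_Ici (0 : ℝ) u hu).eq_deriv _ hd h0
      rw [this, hm u hu]; ring
    intro u hu
    refine eq_zero_of_linear_ode (m := fun v => sphereInt fun y => zeta a y ^ n * D v y)
      (m' := fun v => sphereInt fun y => zeta a y ^ n * D' v y)
      -- This is n(n + 1)(m' - m/r) = (3r₀/r²) m solved for m'. The coefficient decreases in v, so K
      -- is its value at v = 0.
      (k := fun v => 1 / (r₀ + v) + 3 * r₀ / (r₀ + v) ^ 2 / (n * (n + 1)))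
      (K := 1 / r₀ + 3 * r₀ / r₀ ^ 2 / (n * (n + 1))) ?_
      (fun v hv => S.moment _ (hz.pow n) v hv) (fun v hv => ?_) (fun v hv => ?_) hu
    · simp [S.init, sphereInt]
    · have hr : 0 < r₀ + v := by linarith
      have h := S.moment_equation a n hv
      rw [hlow v hv, add_zero] at h
      have hnn : (n : ℝ) * (n + 1) ≠ 0 := by positivity
      generalize sphereInt (fun y => zeta a y ^ n * D' v y) = X at *
      generalize sphereInt (fun y => zeta a y ^ n * D v y) = Y at *
      have : (n : ℝ) * (n + 1) * X = (n * (n + 1)) *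
          ((1 / (r₀ + v) + 3 * r₀ / (r₀ + v) ^ 2 / (n * (n + 1))) * Y) := by
        have e : (n : ℝ) * (n + 1) * ((1 / (r₀ + v) + 3 * r₀ / (r₀ + v) ^ 2 / (n * (n + 1))) * Y) =
          n * (n + 1) * (1 / (r₀ + v)) * Y + 3 * r₀ / (r₀ + v) ^ 2 * Y := by field_simp
        rw [e]; linarith
      exact mul_left_cancel₀ hnn this
    · have hr : 0 < r₀ + v := by linarith
      rw [abs_of_nonneg (by positivity)]
      have : r₀ ≤ r₀ + v := by linarith
      gcongr

end MeanFreeSolution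

/-! ### Functions on the sphere are determined by their moments -/

lemma exists_sph_eq (ϑ : S2) : ∃ p ∈ Icc (0 : ℝ) π ×ˢ Icc (0 : ℝ) (2 * π),
    sph ![p.1, p.2] = ϑ := by
  obtain ⟨x, hx⟩ := ϑ
  have hn : x 0 ^ 2 + x 1 ^ 2 + x 2 ^ 2 = 1 := by
    rw [mem_sphere_zero_iff_norm, EuclideanSpace.norm_eq, Real.sqrt_eq_one] at hx
    simpa [Fin.sum_univ_three] using hx
  set z : ℂ := ⟨x 0, x 1⟩
  have hz : ‖z‖ = √(1 - x 2 ^ 2) := by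
    rw [Complex.norm_eq_sqrt_sq_add_sq]; congr 1; simp only [z]; linarith
  have hre : ‖z‖ * cos z.arg = x 0 := Complex.norm_mul_cos_arg z
  have him : ‖z‖ * sin z.arg = x 1 := Complex.norm_mul_sin_arg z
  have h2 : x 2 ^ 2 ≤ 1 := by nlinarith [sq_nonneg (x 0), sq_nonneg (x 1)]
  have h2' := abs_le.1 (sq_le_one_iff_abs_le_one _ |>.1 h2)
  -- The argument lies in (-π, π]; negative values are shifted by 2π into the coordinate range.
  obtain ⟨φ, hφ, hc, hs⟩ : ∃ φ ∈ Icc (0 : ℝ) (2 * π), cos φ = cos z.arg ∧ sin φ = sin z.arg := by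
    have l1 := Complex.neg_pi_lt_arg z
    have l2 := Complex.arg_le_pi z
    have := pi_pos
    rcases le_or_gt 0 z.arg with h | h
    · exact ⟨z.arg, ⟨h, by linarith⟩, rfl, rfl⟩
    · exact ⟨z.arg + 2 * π, ⟨by linarith, by linarith⟩, cos_add_two_pi _, sin_add_two_pi _⟩
  refine ⟨(arccos (x 2), φ), ⟨⟨arccos_nonneg _, arccos_le_pi _⟩, hφ⟩, ?_⟩
  apply Subtype.ext
  ext i
  fin_cases i
  · simp [sph, sin_arccos, hc, ← hz, hre]
  · simp [sph, sin_arccos, hs, ← hz, him]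
  · simp [sph, cos_arccos h2'.1 h2'.2]

lemma closure_box : closure box = Icc (0 : ℝ) π ×ˢ Icc (0 : ℝ) (2 * π) := by
  rw [box, closure_prod_eq, closure_Ioo pi_pos.ne, closure_Ioo two_pi_pos.ne]

lemma continuous_sph : Continuous sph := contMDiff_sph.continuous

lemma eq_of_eq_on_box {F G : S2 → ℝ} (hF : Continuous F) (hG : Continuous G)
    (h : ∀ p ∈ box, F (sph ![p.1, p.2]) = G (sph ![p.1, p.2])) : F = G := by
  have hs := continuous_sph.comp continuous_chart
  have he : EqOn (fun p : ℝ × ℝ => F (sph ![p.1, p.2])) (fun p => G (sph ![p.1, p.2]))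
      (closure box) := Set.EqOn.closure h (hF.comp hs) (hG.comp hs)
  ext ϑ
  obtain ⟨p, hp, rfl⟩ := exists_sph_eq ϑ
  exact he (closure_box ▸ hp)

lemma eq_of_eq_on_chartDomain {F G : S2 → ℝ} (hF : Continuous F) (hG : Continuous G)
    (h : ∀ y ∈ chartDomain, F (sph y) = G (sph y)) : F = G :=
  eq_of_eq_on_box hF hG fun _ hp => h _ (mem_chartDomain_of_box hp)

/-- The linear function of `a` as a continuous function. -/
def linearMap (a : E3) : C(S2, ℝ) := ⟨fun ϑ => inner ℝ a (ϑ : E3), by fun_prop⟩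

/-- Integration against a continuous function on the sphere. -/
def integralAgainst {D : Chart → ℝ} (hD : Continuous D) : C(S2, ℝ) →L[ℝ] ℝ :=
  LinearMap.mkContinuous
    { toFun := fun G => sphereInt fun y => G (sph y) * D y
      map_add' := fun G G' => by
        have c := G.continuous.comp continuous_sph
        have c' := G'.continuous.comp continuous_sph
        rw [← sphereInt_add (F := fun y => G (sph y) * D y) (G := fun y => G' (sph y) * D y)
          (c.mul hD) (c'.mul hD)]
        congr 1; ext y; simp [add_mul]
      map_smul' := fun c G => by
        rw [smul_eq_mul, RingHom.id_apply, ← sphereInt_const_mul]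
        congr 1; ext y; simp [mul_assoc] }
    (∫ p in box, ‖D ![p.1, p.2] * sin p.1‖) fun G => by
      rw [mul_comm, ← integral_const_mul]
      refine norm_integral_le_of_norm_le ((integrableOn_sphere hD).norm.const_mul _)
        (Eventually.of_forall fun p => ?_)
      simp only [mul_assoc]
      rw [norm_mul]
      gcongr
      exact G.norm_coe_le_norm _

lemma exp_linearMap_apply (a : E3) (ϑ : S2) :
    NormedSpace.exp (linearMap a) ϑ = Real.exp (inner ℝ a (ϑ : E3)) := by
  have h := NormedSpace.map_exp (f := ContinuousMap.evalAlgHom ℝ ℝ ϑ)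
    (continuous_eval_const ϑ) (linearMap a)
  rw [Real.exp_eq_exp_ℝ]
  exact h

/-- Vanishing moments kill the exponential series of every linear function. These exponentials are
closed under products and separate points, so their span is a dense algebra by Stone-Weierstrass.
Hence D is orthogonal to every continuous function, itself included. -/
lemma eq_zero_of_moments {D : S2 → ℝ} (hD : Continuous D)
    (h : ∀ (a : E3) (n : ℕ), sphereInt (fun y => zeta a y ^ n * D (sph y)) = 0) : D = 0 := by
  set Λ := integralAgainst (hD.comp continuous_sph)
  have hexp : ∀ a, Λ (NormedSpace.exp (linearMap a)) = 0 := fun a => by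
    have hs := (NormedSpace.exp_series_hasSum_exp' (𝕂 := ℝ) (linearMap a)).mapL Λ
    have hz : ∀ n : ℕ, Λ (((n.factorial : ℝ)⁻¹) • linearMap a ^ n) = 0 := fun n => by
      rw [map_smul]
      have : Λ (linearMap a ^ n) = 0 := h a n
      rw [this, smul_zero]
    simp only [hz] at hs
    exact hs.unique hasSum_zero
  set s : Set C(S2, ℝ) := Set.range fun a => NormedSpace.exp (linearMap a)
  have hmul : ∀ a b, NormedSpace.exp (linearMap a) * NormedSpace.exp (linearMap b) =
      NormedSpace.exp (linearMap (a + b)) := fun a b => by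
    ext ϑ
    simp only [ContinuousMap.mul_apply, exp_linearMap_apply, inner_add_left, Real.exp_add]
  have hclos : ∀ G ∈ Submonoid.closure s, G ∈ s := fun G hG => by
    induction hG using Submonoid.closure_induction with
    | mem x hx => exact hx
    | one => exact ⟨0, by ext ϑ; simp [exp_linearMap_apply]⟩
    | mul x y _ _ hx hy =>
      obtain ⟨a, rfl⟩ := hx
      obtain ⟨b, rfl⟩ := hy
      exact ⟨a + b, (hmul a b).symm⟩
  have hker : ∀ G ∈ Algebra.adjoin ℝ s, Λ G = 0 := fun G hG => by
    rw [← Subalgebra.mem_toSubmodule, Algebra.adjoin_eq_span] at hG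
    have : Submodule.span ℝ (Submonoid.closure s : Set C(S2, ℝ)) ≤ LinearMap.ker Λ.toLinearMap := by
      refine Submodule.span_le.2 fun x hx => ?_
      obtain ⟨a, rfl⟩ := hclos x hx
      exact hexp a
    exact this hG
  have hsep : (Algebra.adjoin ℝ s).SeparatesPoints := fun x y hxy => by
    -- The direction x - y separates x from y: equal values would give ‖x - y‖² = 0.
    refine ⟨_, ⟨NormedSpace.exp (linearMap ((x : E3) - y)), Algebra.subset_adjoin ⟨_, rfl⟩, rfl⟩, ?_⟩
    simp only [exp_linearMap_apply]
    intro he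
    have he' := Real.exp_injective he
    apply hxy
    apply Subtype.ext
    have : inner ℝ ((x : E3) - y) ((x : E3) - y) = 0 := by
      rw [inner_sub_right, he', sub_self]
    exact sub_eq_zero.1 (inner_self_eq_zero.1 this)
  have hdense := ContinuousMap.subalgebra_topologicalClosure_eq_top_of_separatesPoints _ hsep
  have hall : ∀ G : C(S2, ℝ), Λ G = 0 := fun G => by
    have hG : G ∈ (Algebra.adjoin ℝ s).topologicalClosure := hdense ▸ Algebra.mem_top
    have hcl : IsClosed {G : C(S2, ℝ) | Λ G = 0} := isClosed_eq Λ.continuous continuous_const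
    exact (closure_minimal (fun x hx => hker x hx) hcl) hG
  -- Testing against D gives D² = 0 almost everywhere on the open rectangle, and continuity removes
  -- the exceptional set.
  have hsq : sphereInt (fun y => D (sph y) * D (sph y)) = 0 := hall ⟨D, hD⟩
  have hc : Continuous fun p : ℝ × ℝ => D (sph ![p.1, p.2]) * D (sph ![p.1, p.2]) * sin p.1 := by
    have := hD.comp (continuous_sph.comp continuous_chart)
    exact (this.mul this).mul (continuous_sin.comp continuous_fst)
  have hae := (setIntegral_eq_zero_iff_of_nonneg_ae ((ae_restrict_iff' measurableSet_box).2
    (Eventually.of_forall fun p hp => mul_nonneg (mul_self_nonneg _)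
      (sin_pos_of_mem (mem_chartDomain_of_box hp)).le)) (integrableOn_box hc)).1 hsq
  have hopen : IsOpen box := isOpen_Ioo.prod isOpen_Ioo
  have heq := Measure.eqOn_open_of_ae_eq (μ := volume) hae hopen hc.continuousOn
    continuous_const.continuousOn
  refine eq_of_eq_on_box hD continuous_const fun p hp => ?_
  have h1 := heq hp
  have h2 : sin p.1 ≠ 0 := (sin_pos_of_mem (mem_chartDomain_of_box hp)).ne'
  simpa [h2] using h1

/-! ### Classification of the linearised foliations -/

/-- The amplitude of the linear part of the linearised foliation. -/
def profile (r₀ u : ℝ) : ℝ :=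
  (r₀ + u) * (8 / 3 - 2 / 3 * exp (3 / 2 * (1 - r₀ / (r₀ + u)))) - 3 * r₀ + r₀ ^ 2 / (r₀ + u)

/-- The derivative of `profile`. -/
def profileRate (r₀ u : ℝ) : ℝ :=
  profile r₀ u * (1 / (r₀ + u) + 3 * r₀ / (2 * (r₀ + u) ^ 2))
    + r₀ * u * (-1 / (r₀ + u) ^ 2 + 3 * r₀ / (2 * (r₀ + u) ^ 3))

lemma profile_zero {r₀ : ℝ} (hr₀ : 0 < r₀) : profile r₀ 0 = 0 := by
  simp [profile, hr₀.ne']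
  field_simp
  ring

/-- `profileRate` is the right side of the degree-one part of the mass aspect equation with source H
= r₀ζ, so this says that `profile` solves that ODE. With r = r₀ + u, the homogeneous solutions are
multiples of r exp(-3r₀/(2r)), a particular one is 8r/3 - 3r₀ + r₀²/r, and the coefficient -2/3 is
fixed by the value 0 at u = 0. -/
lemma hasDerivAt_profile {r₀ u : ℝ} (hr : 0 < r₀ + u) :
    HasDerivAt (profile r₀) (profileRate r₀ u) u := by
  have h1 : HasDerivAt (fun u => r₀ + u) 1 u := (hasDerivAt_id u).const_add r₀
  have h2 : HasDerivAt (fun u => r₀ / (r₀ + u)) (-r₀ / (r₀ + u) ^ 2) u :=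
    ((hasDerivAt_const u r₀).fun_div h1 hr.ne').congr_deriv (by ring)
  have h3 : HasDerivAt (fun u => r₀ ^ 2 / (r₀ + u)) (-r₀ ^ 2 / (r₀ + u) ^ 2) u :=
    ((hasDerivAt_const u (r₀ ^ 2)).fun_div h1 hr.ne').congr_deriv (by ring)
  have h4 := (((h2.const_sub 1).const_mul (3 / 2)).exp.const_mul (2 / 3)).const_sub (8 / 3)
  refine (((h1.fun_mul h4).sub_const (3 * r₀)).fun_add h3).congr_deriv ?_
  rw [profileRate, profile]
  generalize exp (3 / 2 * (1 - r₀ / (r₀ + u))) = E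
  obtain ⟨r, rfl⟩ : ∃ r, u = r - r₀ := ⟨r₀ + u, by ring⟩
  have hr' : r ≠ 0 := by have := hr.ne'; rwa [add_sub_cancel] at this
  rw [add_sub_cancel]
  field_simp
  ring

lemma SmoothOnRS2.continuous_slice {δ : ℝ → S2 → ℝ} (h : SmoothOnRS2 δ) (u : ℝ) :
    Continuous (δ u) :=
  h.continuous.comp (continuous_const.prodMk continuous_id)

/-- On the background s̲ = 0 the linearised null condition is just ∂_s δh = 0. -/
lemma IsLinearisedFoliation.eq_h {r₀ : ℝ} (hr₀ : 0 < r₀) {f₀ v : S2 → ℝ} {δh δf : ℝ → S2 → ℝ}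
    (L : IsLinearisedFoliation r₀ f₀ v δh δf) {s : ℝ} (hs : 0 ≤ s) : δh s = v := by
  have hv : δh 0 = v := funext L.init_h
  rw [← hv]
  refine eq_of_eq_on_chartDomain (L.smooth_h.continuous_slice s) (L.smooth_h.continuous_slice 0)
    fun y hy => ?_
  have h := eq_zero_of_linear_ode (m := fun t => δh t (sph y) - δh 0 (sph y))
    (m' := fun t => rate δh t y) (k := fun _ => 0) (K := 0) (sub_self _)
    (fun t _ => (L.smooth_h.differentiableAt t y).hasDerivAt.sub_const _)
    (fun t ht => by
      have := (L.null t ht y hy).unique (nullity_hasDerivAt hr₀ ht L.smooth_h hy)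
      linarith) (fun _ _ => by simp) hs
  exact sub_eq_zero.1 h

section Classification

variable {r₀ c₀ : ℝ} {w : E3} {δh δf : ℝ → S2 → ℝ}

/-- The mean-free part of the difference of a linearised foliation and the explicit one. -/
def remainder (r₀ : ℝ) (w : E3) (δf : ℝ → S2 → ℝ) (u : ℝ) (y : Chart) : ℝ :=
  slice δf u y + (-profile r₀ u * zeta w y + -(sphereInt (slice δf u) / (4 * π)))

/-- The derivative of `remainder`. -/
def remainderRate (r₀ : ℝ) (w : E3) (δf : ℝ → S2 → ℝ) (u : ℝ) (y : Chart) : ℝ :=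
  rate δf u y + (-profileRate r₀ u * zeta w y + -(sphereInt (rate δf u) / (4 * π)))

lemma hasDerivAt_moment (hf : SmoothOnRS2 δf) {G : Chart → ℝ} (hG : ContDiff ℝ ∞ G) (u : ℝ) :
    HasDerivAt (fun v => sphereInt fun y => G y * slice δf v y)
      (sphereInt fun y => G y * rate δf u y) u := by
  have h := hasDerivAt_sphereInt_of_contDiff (Φ := fun p : ℝ × Chart => G p.2 * δf p.1 (sph p.2))
    ((hG.comp contDiff_snd).mul hf.contDiff) u
  refine h.congr_deriv ?_
  congr 1; ext y
  exact ((hf.differentiableAt u y).hasDerivAt.const_mul (G y)).deriv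

lemma sphereInt_mul_affine {F G : Chart → ℝ} (hF : Continuous F) (hG : Continuous G) (a b : ℝ) :
    sphereInt (fun y => G y * (F y + (a * zeta w y + b))) =
      sphereInt (fun y => G y * F y) + (a * sphereInt (fun y => G y * zeta w y)
        + b * sphereInt G) := by
  have e : (fun y => G y * (F y + (a * zeta w y + b))) =
      fun y => G y * F y + (a * (G y * zeta w y) + b * G y) := by ext y; ring
  rw [e, sphereInt_add (F := fun y => G y * F y) (G := fun y => a * (G y * zeta w y) + b * G y)
    (by fun_prop) (by fun_prop), sphereInt_add (F := fun y => a * (G y * zeta w y))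
    (G := fun y => b * G y) (by fun_prop) (by fun_prop), sphereInt_const_mul, sphereInt_const_mul]

/-- Subtracting the explicit degree-one part removes the source ζ from the equation, and subtracting
the mean removes the constants. The initial value is zero because `profile` vanishes at u = 0. -/
lemma meanFreeSolution (hr₀ : 0 < r₀)
    (L : IsLinearisedFoliation r₀ 0 (fun ϑ => c₀ + r₀ * inner ℝ w (ϑ : E3)) δh δf) :
    MeanFreeSolution r₀ (remainder r₀ w δf) (remainderRate r₀ w δf) := by
  have sf := fun u => L.smooth_f.contDiff_slice u
  have sr := fun u => L.smooth_f.contDiff_rate u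
  have hz := contDiff_zeta w
  have smooth : ∀ u, ContDiff ℝ ∞ (remainder r₀ w δf u) := fun u =>
    (sf u).add ((contDiff_const.mul hz).add contDiff_const)
  have smooth' : ∀ u, ContDiff ℝ ∞ (remainderRate r₀ w δf u) := fun u =>
    (sr u).add ((contDiff_const.mul hz).add contDiff_const)
  have periodic : ∀ u, AzimuthPeriodic (remainder r₀ w δf u) := fun u =>
    azimuthPeriodic_comp_sph fun ϑ => δf u ϑ + (-profile r₀ u * inner ℝ w (ϑ : E3) +
      -(sphereInt (slice δf u) / (4 * π)))
  have periodic' : ∀ u, AzimuthPeriodic (remainderRate r₀ w δf u) := fun u =>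
    azimuthPeriodic_comp_sph fun ϑ => deriv (fun v => δf v ϑ) u +
      (-profileRate r₀ u * inner ℝ w (ϑ : E3) + -(sphereInt (rate δf u) / (4 * π)))
  have mean : ∀ u, sphereInt (remainder r₀ w δf u) = 0 := fun u => by
    have h := sphereInt_mul_affine (w := w) (sf u).continuous
      (continuous_const (y := (1 : ℝ))) (-profile r₀ u) (-(sphereInt (slice δf u) / (4 * π)))
    simp only [one_mul, sphereInt_one] at h
    have hz0 : sphereInt (fun y => zeta w y) = 0 := sphereInt_zeta w
    rw [hz0] at h
    refine h.trans ?_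
    have := pi_pos
    field_simp
    simp
  refine ⟨hr₀, smooth, smooth', periodic, periodic', mean, fun y => ?_, fun u hu => ?_,
    fun G hG u hu => ?_⟩
  · have h0 : slice δf 0 = fun _ => 0 := funext fun y => L.init_f (sph y)
    rw [remainder, h0, profile_zero hr₀, sphereInt_const]
    simp
  · have hr : 0 < r₀ + u := by linarith
    obtain ⟨c, hc⟩ := L.massAspect_const u hu
    set S := fun z => remainderRate r₀ w δf u z + -(1 / (r₀ + u)) * remainder r₀ w δf u z with hS
    -- All constant contributions on the leaf: the unknown variation c of the mass aspect, the
    -- constant part of H and the mean of δf.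
    set k : ℝ := -((r₀ + u) ^ 2 * c) - 3 * r₀ / (r₀ + u) ^ 2 * (u / (r₀ + u) * c₀ +
      sphereInt (slice δf u) / (4 * π)) with hk
    have hlap : ∀ y ∈ chartDomain, roundLap S y =
        -(3 * r₀ / (r₀ + u) ^ 2) * remainder r₀ w δf u y + k := fun y hy => by
      have e := (hc y hy).unique
        ((folMassAspect_jet hr₀ hu L.smooth_h L.smooth_f).hasDerivAt hy)
      have hH : slice δh u = fun y => c₀ + r₀ * zeta w y := funext fun y => by
        rw [slice, L.eq_h hr₀ hu]; rfl
      have e1 : roundLap (remainder r₀ w δf u) y =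
          roundLap (slice δf u) y + -2 * (-profile r₀ u) * zeta w y := by
        have := roundLap_affine w (-(sphereInt (slice δf u) / (4 * π))) (-profile r₀ u) hy
        rw [← this, ← roundLap_add (fun _ _ => (sf u).contDiffAt)
          (fun _ _ => (contDiff_const.add (contDiff_const.mul hz)).contDiffAt) hy]
        congr 1; ext z; simp only [remainder]; ring
      have e2 : roundLap (remainderRate r₀ w δf u) y =
          roundLap (rate δf u) y + -2 * (-profileRate r₀ u) * zeta w y := by
        have := roundLap_affine w (-(sphereInt (rate δf u) / (4 * π))) (-profileRate r₀ u) hy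
        rw [← this, ← roundLap_add (fun _ _ => (sr u).contDiffAt)
          (fun _ _ => (contDiff_const.add (contDiff_const.mul hz)).contDiffAt) hy]
        congr 1; ext z; simp only [remainderRate]; ring
      rw [hS, roundLap_add (fun _ _ => (smooth' u).contDiffAt)
        (fun _ _ => (contDiff_const.mul (smooth u)).contDiffAt) hy,
        roundLap_const_mul _ (fun _ _ => (smooth u).contDiffAt) hy, e1, e2, hk]
      rw [hH, roundLap_affine w _ _ hy, radiusPert] at e
      have e' : roundLap (rate δf u) y = -((r₀ + u) ^ 2 * c) - 3 * r₀ / (r₀ + u) ^ 2 *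
          (slice δf u y + u / (r₀ + u) * (c₀ + r₀ * zeta w y)) + 2 * u * r₀ / (r₀ + u) ^ 2 *
          zeta w y + roundLap (slice δf u) y / (r₀ + u) := by
        rw [e]; field_simp; ring
      rw [e', remainder, profileRate]
      field_simp
      ring
    have hcont : Continuous fun y => -(3 * r₀ / (r₀ + u) ^ 2) * remainder r₀ w δf u y + k :=
      (continuous_const.mul (smooth u).continuous).add continuous_const
    -- A Laplacian has zero integral and the remainder has zero mean, which forces k = 0 whatever c
    -- is.
    have h0 := sphereInt_laplacian ((smooth' u).add (contDiff_const.mul (smooth u)))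
      (fun a b => by simp only [periodic u a b, periodic' u a b]) hcont hlap
    rw [sphereInt_add (F := fun y => -(3 * r₀ / (r₀ + u) ^ 2) * remainder r₀ w δf u y)
      (G := fun _ => k) (continuous_const.mul (smooth u).continuous) continuous_const,
      sphereInt_const_mul, mean, sphereInt_const, mul_zero, zero_add] at h0
    have hk0 : k = 0 := by
      have := pi_pos
      simpa [this.ne'] using h0
    intro y hy
    rw [hlap y hy, hk0, add_zero]
  · have hr : 0 < r₀ + u := by linarith
    have hA := hasDerivAt_moment L.smooth_f hG u
    have hB := hasDerivAt_moment L.smooth_f (contDiff_const (c := (1 : ℝ))) u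
    simp only [one_mul] at hB
    have h := hA.fun_add (((hasDerivAt_profile hr).fun_neg.mul_const
      (sphereInt fun y => G y * zeta w y)).fun_add
        ((hB.div_const (4 * π)).fun_neg.mul_const (sphereInt G)))
    simp only [remainder, remainderRate]
    rw [sphereInt_mul_affine (sr u).continuous hG.continuous]
    refine h.congr_of_eventuallyEq (Eventually.of_forall fun v => ?_)
    exact sphereInt_mul_affine (sf v).continuous hG.continuous _ _

lemma slice_eq_of_isLinearisedFoliation (hr₀ : 0 < r₀)
    (L : IsLinearisedFoliation r₀ 0 (fun ϑ => c₀ + r₀ * inner ℝ w (ϑ : E3)) δh δf) {u : ℝ}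
    (hu : 0 ≤ u) (y : Chart) :
    slice δf u y = sphereInt (slice δf u) / (4 * π) + profile r₀ u * zeta w y := by
  have hc := L.smooth_f.continuous_slice u
  have h := eq_zero_of_moments (D := fun ϑ => δf u ϑ + (-profile r₀ u * inner ℝ w (ϑ : E3) +
    -(sphereInt (slice δf u) / (4 * π)))) (by fun_prop)
    fun a n => (meanFreeSolution hr₀ L).moment_eq_zero a n u hu
  have h1 := congrFun h (sph y)
  simp only [Pi.zero_apply] at h1
  have h2 : slice δf u y + (-profile r₀ u * zeta w y +
    -(sphereInt (slice δf u) / (4 * π))) = 0 := h1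
  linarith

/-- Identities are known only for u ≥ 0; at u = 0 a two-sided derivative is still determined by the
right half-line. -/
lemma eq_of_hasDerivAt_of_eqOn_Ici {f g : ℝ → ℝ} {f' g' u : ℝ} (hu : 0 ≤ u)
    (h : ∀ v, 0 ≤ v → f v = g v) (hf : HasDerivAt f f' u) (hg : HasDerivAt g g' u) : f' = g' :=
  (uniqueDiffOn_Ici (0 : ℝ) u hu).eq_deriv _ hf.hasDerivWithinAt
    (hg.hasDerivWithinAt.congr_of_mem (fun v hv => h v hv) hu)

/-- Every linearised foliation is the explicit one. -/
theorem zonalFoliation_of_isLinearisedFoliation (hr₀ : 0 < r₀)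
    (L : IsLinearisedFoliation r₀ 0 (fun ϑ => c₀ + r₀ * inner ℝ w (ϑ : E3)) δh δf) {u : ℝ}
    (hu : 0 ≤ u) : ZonalFoliation w r₀ c₀ u (-(u / (r₀ + u) * c₀)) (profile r₀ u)
      (-(r₀ / (r₀ + u) ^ 2 * c₀)) (profileRate r₀ u) δh δf := by
  have hmean : ∀ v, HasDerivAt (fun v => sphereInt (slice δf v) / (4 * π))
      (sphereInt (rate δf v) / (4 * π)) v := fun v => by
    have hB := hasDerivAt_moment L.smooth_f (contDiff_const (c := (1 : ℝ))) v
    simp only [one_mul] at hB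
    exact hB.div_const _
  have h0 : sphereInt (slice δf 0) / (4 * π) = 0 := by
    have h0 : slice δf 0 = fun _ => 0 := funext fun y => L.init_f (sph y)
    rw [h0, sphereInt_const]; simp
  have Z : ∀ u, 0 ≤ u → ZonalFoliation w r₀ c₀ u (sphereInt (slice δf u) / (4 * π))
      (profile r₀ u) (sphereInt (rate δf u) / (4 * π)) (profileRate r₀ u) δh δf := fun u hu =>
    { pos := hr₀
      nonneg := hu
      smooth_h := L.smooth_h
      smooth_f := L.smooth_f
      eq_h := fun s hs y => by rw [slice, L.eq_h hr₀ hs]; rfl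
      eq_f := slice_eq_of_isLinearisedFoliation hr₀ L hu
      eq_rate := fun y => eq_of_hasDerivAt_of_eqOn_Ici hu
        (fun v hv => slice_eq_of_isLinearisedFoliation hr₀ L hv y)
        (L.smooth_f.differentiableAt u y).hasDerivAt
        ((hmean u).add ((hasDerivAt_profile (by linarith)).mul_const _))
      init := by rintro rfl; exact ⟨h0, profile_zero hr₀⟩ }
  have Z0 := Z 0 le_rfl
  rw [h0, profile_zero hr₀] at Z0
  -- The mass aspect equation leaves the mean of δf free; the labelling by area radius determines
  -- it.
  have hα : ∀ u, 0 ≤ u → sphereInt (slice δf u) / (4 * π) = -(u / (r₀ + u) * c₀) := fun u hu =>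
    ((Z u hu).labelling_iff Z0).1 (L.labelling u hu)
  have hα' : sphereInt (rate δf u) / (4 * π) = -(r₀ / (r₀ + u) ^ 2 * c₀) := by
    have hr : r₀ + u ≠ 0 := by linarith
    have h1 : HasDerivAt (fun u => r₀ + u) 1 u := (hasDerivAt_id u).const_add r₀
    refine eq_of_hasDerivAt_of_eqOn_Ici hu hα (hmean u) (((((hasDerivAt_id' u).fun_div h1
      hr).mul_const c₀).fun_neg).congr_deriv ?_)
    field_simp
    ring
  have := Z u hu
  rwa [hα u hu, hα'] at this

end Classification

/-! ### Existence of the linearised foliation -/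

lemma contMDiff_inner (w : E3) : ContMDiff (𝓡 2) 𝓘(ℝ, ℝ) ∞ (fun ϑ : S2 => inner ℝ w (ϑ : E3)) :=
  (innerSL ℝ w).contDiff.contMDiff.comp contMDiff_coe_sphere

lemma smoothOnRS2_affine {a b : ℝ → ℝ} (ha : ContDiff ℝ ∞ a) (hb : ContDiff ℝ ∞ b) (w : E3) :
    SmoothOnRS2 (fun u ϑ => a u + b u * inner ℝ w (ϑ : E3)) := by
  have h1 : ContMDiff (𝓘(ℝ, ℝ).prod (𝓡 2)) 𝓘(ℝ, ℝ) ∞ (fun p : ℝ × S2 => a p.1) :=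
    ha.contMDiff.comp contMDiff_fst
  have h2 : ContMDiff (𝓘(ℝ, ℝ).prod (𝓡 2)) 𝓘(ℝ, ℝ) ∞ (fun p : ℝ × S2 => b p.1) :=
    hb.contMDiff.comp contMDiff_fst
  have h3 : ContMDiff (𝓘(ℝ, ℝ).prod (𝓡 2)) 𝓘(ℝ, ℝ) ∞
      (fun p : ℝ × S2 => inner ℝ w (p.2 : E3)) := (contMDiff_inner w).comp contMDiff_snd
  exact h1.add (h2.mul h3)

/-- A smooth function which is `1` for `u ≥ -r₀ / 4` and `0` for `u ≤ -r₀ / 2`. -/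
def cutoff (r₀ u : ℝ) : ℝ := Real.smoothTransition (4 * u / r₀ + 2)

/-- The explicit formulas are singular at u = -r₀, whereas smoothness is demanded for all real u.
The cutoff removes the singularity and equals 1 near every u ≥ 0, so values and derivatives there
are unaffected. -/
lemma contDiff_cutoff_mul {r₀ : ℝ} (hr₀ : 0 < r₀) {g : ℝ → ℝ}
    (hg : ∀ u, 0 < r₀ + u → ContDiffAt ℝ ∞ g u) : ContDiff ℝ ∞ (fun u => cutoff r₀ u * g u) := by
  rw [contDiff_iff_contDiffAt]
  intro u
  rcases lt_or_ge 0 (r₀ + u) with h | h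
  · refine ContDiffAt.mul ?_ (hg u h)
    exact Real.smoothTransition.contDiff.contDiffAt.comp u
      (f := fun u => 4 * u / r₀ + 2) (by fun_prop)
  · refine contDiffAt_const (c := (0 : ℝ)).congr_of_eventuallyEq ?_
    filter_upwards [Iio_mem_nhds (show u < -r₀ / 2 by linarith)] with v hv
    have : 4 * v / r₀ + 2 ≤ 0 := by
      have : 4 * v / r₀ ≤ -2 := by rw [div_le_iff₀ hr₀]; linarith [mem_Iio.1 hv]
      linarith
    rw [cutoff, Real.smoothTransition.zero_of_nonpos this, zero_mul]

lemma cutoff_mul_eventuallyEq {r₀ : ℝ} (hr₀ : 0 < r₀) (g : ℝ → ℝ) {u : ℝ} (hu : 0 ≤ u) :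
    (fun u => cutoff r₀ u * g u) =ᶠ[𝓝 u] g := by
  filter_upwards [Ioi_mem_nhds (show -r₀ / 4 < u by linarith)] with v hv
  have : 1 ≤ 4 * v / r₀ + 2 := by
    have : -1 ≤ 4 * v / r₀ := by rw [le_div_iff₀ hr₀]; linarith [mem_Ioi.1 hv]
    linarith
  rw [cutoff, Real.smoothTransition.one_of_one_le this, one_mul]

lemma contDiffAt_profile {r₀ u : ℝ} (hr : 0 < r₀ + u) : ContDiffAt ℝ ∞ (profile r₀) u := by
  have h1 : ContDiffAt ℝ ∞ (fun u => r₀ + u) u := by fun_prop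
  have h2 : ∀ c : ℝ, ContDiffAt ℝ ∞ (fun u => c / (r₀ + u)) u := fun c =>
    contDiffAt_const.div h1 hr.ne'
  exact ((h1.mul (contDiffAt_const.sub (contDiffAt_const.mul
    (contDiffAt_const.mul (contDiffAt_const.sub (h2 r₀))).exp))).sub contDiffAt_const).add
      (h2 (r₀ ^ 2))

/-- The linearised foliation. -/
def explicitF (r₀ c₀ : ℝ) (w : E3) (u : ℝ) (ϑ : S2) : ℝ :=
  cutoff r₀ u * -(u / (r₀ + u) * c₀) + cutoff r₀ u * profile r₀ u * inner ℝ w (ϑ : E3)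

/-- The linearised hypersurface. -/
def explicitH (r₀ c₀ : ℝ) (w : E3) (_ : ℝ) (ϑ : S2) : ℝ := c₀ + r₀ * inner ℝ w (ϑ : E3)

lemma zonalFoliation_explicit {r₀ : ℝ} (hr₀ : 0 < r₀) (c₀ : ℝ) (w : E3) {u : ℝ} (hu : 0 ≤ u) :
    ZonalFoliation w r₀ c₀ u (-(u / (r₀ + u) * c₀)) (profile r₀ u)
      (-(r₀ / (r₀ + u) ^ 2 * c₀)) (profileRate r₀ u) (explicitH r₀ c₀ w) (explicitF r₀ c₀ w) := by
  have hr : r₀ + u ≠ 0 := by linarith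
  have hα := cutoff_mul_eventuallyEq hr₀ (fun u => -(u / (r₀ + u) * c₀)) hu
  have hβ := cutoff_mul_eventuallyEq hr₀ (profile r₀) hu
  have h1 : HasDerivAt (fun u => r₀ + u) 1 u := (hasDerivAt_id u).const_add r₀
  have dα : HasDerivAt (fun u => -(u / (r₀ + u) * c₀)) (-(r₀ / (r₀ + u) ^ 2 * c₀)) u := by
    refine ((((hasDerivAt_id' u).fun_div h1 hr).mul_const c₀).fun_neg).congr_deriv ?_
    field_simp
    ring
  exact
    { pos := hr₀
      nonneg := hu
      smooth_h := smoothOnRS2_affine contDiff_const contDiff_const w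
      smooth_f := smoothOnRS2_affine (contDiff_cutoff_mul hr₀ fun v hv =>
          ((contDiffAt_id.div (contDiffAt_const.add contDiffAt_id) hv.ne').mul
            contDiffAt_const).neg)
        (contDiff_cutoff_mul hr₀ fun v hv => contDiffAt_profile hv) w
      eq_h := fun s _ y => rfl
      eq_f := fun y => by
        have e1 := hα.self_of_nhds
        have e2 := hβ.self_of_nhds
        simp only at e1 e2
        rw [slice, explicitF, e1, e2]; rfl
      eq_rate := fun y => ((dα.congr_of_eventuallyEq hα).add
        (((hasDerivAt_profile (by linarith)).congr_of_eventuallyEq hβ).mul_const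
          (zeta w y))).deriv
      init := by rintro rfl; simp [profile_zero hr₀] }

theorem isLinearisedFoliation_explicit {r₀ : ℝ} (hr₀ : 0 < r₀) (c₀ : ℝ) (w : E3) :
    IsLinearisedFoliation r₀ 0 (fun ϑ => c₀ + r₀ * inner ℝ w (ϑ : E3))
      (explicitH r₀ c₀ w) (explicitF r₀ c₀ w) := by
  have Z := fun u (hu : 0 ≤ u) => zonalFoliation_explicit hr₀ c₀ w hu
  have Z0 := Z 0 le_rfl
  have hh := Z0.smooth_h
  have hf := Z0.smooth_f
  -- The mass aspect variation is not merely constant but 0: the radius perturbation has no mean,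
  -- and the ζ-part cancels by the ODE for `profile`.
  refine ⟨hh, hf, fun ϑ => rfl, fun ϑ => ?_, fun s hs y hy => ?_, fun u hu => ⟨0, fun y hy => ?_⟩,
    fun u hu => ?_⟩
  · simp [explicitF, profile_zero hr₀]
  · refine (nullity_hasDerivAt hr₀ hs hh hy).congr_deriv ?_
    have : rate (explicitH r₀ c₀ w) s y = 0 := deriv_const _ _
    rw [this, neg_zero]
  · have hr : r₀ + u ≠ 0 := by linarith
    refine ((folMassAspect_jet hr₀ hu hh hf).hasDerivAt hy).congr_deriv ?_
    have e1 : slice (explicitF r₀ c₀ w) u = _ := funext (Z u hu).eq_f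
    have e2 : rate (explicitF r₀ c₀ w) u = _ := funext (Z u hu).eq_rate
    have e3 : slice (explicitH r₀ c₀ w) u = _ := funext ((Z u hu).eq_h u hu)
    rw [(Z u hu).radiusPert_eq, e1, e2, e3, roundLap_affine w _ _ hy, roundLap_affine w _ _ hy,
      roundLap_affine w _ _ hy, profileRate]
    field_simp
    ring
  · rw [zero_div, zero_mul, neg_zero, profile_zero hr₀] at Z0
    exact ((Z u hu).labelling_iff Z0).2 rfl

/-! ### The limits at null infinity -/

lemma hasAsymptoticJet_of {Q : ℝ → ℝ → ℝ} {q₀ dq : ℝ → ℝ} {q δq : ℝ}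
    (h0 : ∀ u, 0 ≤ u → Q u 0 = q₀ u) (h1 : ∀ u, 0 ≤ u → HasDerivAt (Q u) (dq u) 0)
    (l0 : Tendsto q₀ atTop (𝓝 q)) (l1 : Tendsto dq atTop (𝓝 δq)) : HasAsymptoticJet Q q δq := by
  refine ⟨fun u hu => (h1 u hu).differentiableAt, l0.congr' ?_, l1.congr' ?_⟩
  · filter_upwards [eventually_ge_atTop 0] with u hu using (h0 u hu).symm
  · filter_upwards [eventually_ge_atTop 0] with u hu using (h1 u hu).deriv.symm

/-- The limit of the amplitude of the linearised perturbation of the conformal factor. -/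
def kappa : ℝ := 8 / 3 - 2 / 3 * exp (3 / 2)

/-- The amplitude of the linearised perturbation of the conformal factor. -/
def amplitude (r₀ u : ℝ) : ℝ := (profile r₀ u + u / (r₀ + u) * r₀) / (r₀ + u)

/-- The amplitude is a continuous function of x = 1/(r₀ + u), so its limit is the value at x = 0. -/
lemma tendsto_amplitude {r₀ : ℝ} (hr₀ : 0 < r₀) :
    Tendsto (amplitude r₀) atTop (𝓝 kappa) := by
  have hi : Tendsto (fun u => (r₀ + u)⁻¹) atTop (𝓝 0) :=
    tendsto_inv_atTop_zero.comp (tendsto_atTop_add_const_left _ _ tendsto_id)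
  have hc : Continuous fun x : ℝ => 8 / 3 - 2 / 3 * exp (3 / 2 * (1 - r₀ * x)) - 2 * r₀ * x := by
    fun_prop
  have h := (hc.tendsto 0).comp hi
  have e : kappa = 8 / 3 - 2 / 3 * exp (3 / 2 * (1 - r₀ * 0)) - 2 * r₀ * 0 := by
    simp [kappa]
  rw [e]
  refine h.congr' ?_
  filter_upwards [eventually_ge_atTop 0] with u hu
  have hr : r₀ + u ≠ 0 := by linarith
  simp only [Function.comp_apply, amplitude, profile, ← div_eq_mul_inv]
  field_simp
  ring

lemma roundHess_affine (w : E3) (a b : ℝ) {y : Chart} (hy : y ∈ chartDomain) (i j : Fin 2) :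
    roundHess (fun y => a + b * zeta w y) y i j = -b * zeta w y * roundMetric y i j := by
  have hz := contDiff_zeta w
  have e1 : ∀ j, pd j (fun y => a + b * zeta w y) = fun y => b * pd j (zeta w) y := fun j => by
    ext z
    have hd := hz.differentiable (by simp) z
    rw [pd_add (differentiableAt_const a) (hd.const_mul b), pd_const, pd_const_mul b hd, zero_add]
  have e2 : pd i (fun y => b * pd j (zeta w) y) y = b * pd i (pd j (zeta w)) y :=
    pd_const_mul b ((contDiff_pd hz j).differentiable (by simp) y) i
  have h := roundHess_zeta w hy i j
  simp only [roundHess, Fin.sum_univ_two, e1, e2] at h ⊢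
  linear_combination b * h

/-- The asymptotic quantities of the spherically symmetric foliation. -/
def limitData (r₀ : ℝ) : AsymptoticData where
  P _ := -r₀
  Sig _ := 0
  Xi _ := 0
  g := roundMetric

/-- The linearised perturbations of the asymptotic quantities. -/
def limitPert (r₀ : ℝ) (w : E3) : AsymptoticData where
  P y := 3 * r₀ * (kappa * zeta w y)
  Sig _ := 0
  Xi _ := 0
  g y := (2 * (kappa * zeta w y)) • roundMetric y

section Limits

variable {r₀ c₀ : ℝ} {w : E3} {δh δf : ℝ → S2 → ℝ}

/-- The linearised foliation with the explicit profile. -/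
def IsProfileFoliation (r₀ c₀ : ℝ) (w : E3) (δh δf : ℝ → S2 → ℝ) : Prop :=
  ∀ u, 0 ≤ u → ZonalFoliation w r₀ c₀ u (-(u / (r₀ + u) * c₀)) (profile r₀ u)
    (-(r₀ / (r₀ + u) ^ 2 * c₀)) (profileRate r₀ u) δh δf

namespace IsProfileFoliation

lemma hasDerivAt_folRadius (Z : IsProfileFoliation r₀ c₀ w δh δf) {u : ℝ} (hu : 0 ≤ u) :
    HasDerivAt (fun ε => folRadius r₀ (varH δh ε) (varF δf ε) u) 0 0 :=
  (Z u hu).hasDerivAt_folRadius.congr_deriv (neg_add_cancel _)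

lemma radiusPert_eq (Z : IsProfileFoliation r₀ c₀ w δh δf) {u : ℝ} (hu : 0 ≤ u) (y : Chart) :
    radiusPert r₀ u (slice δf u) (slice δh u) y = (r₀ + u) * (amplitude r₀ u * zeta w y) := by
  have hr := (Z u hu).radius_pos.ne'
  rw [(Z u hu).radiusPert_eq, amplitude]
  field_simp
  ring

lemma metric (Z : IsProfileFoliation r₀ c₀ w δh δf) {u : ℝ} (hu : 0 ≤ u) :
    ConformalJet (fun ε => leafMetric r₀ (varH δh ε) (varF δf ε) u) (r₀ + u)
      (fun y => 0 + amplitude r₀ u * zeta w y) := by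
  have hr := (Z u hu).radius_pos.ne'
  have h := (Z u hu).metric
  have e : (fun y => radiusPert r₀ u (slice δf u) (slice δh u) y / (r₀ + u)) =
      fun y => 0 + amplitude r₀ u * zeta w y := by
    ext y; rw [Z.radiusPert_eq hu]; field_simp; ring
  rwa [e] at h

/-- The variation of K is proportional to 2φ + Δφ, which vanishes for φ of degree one. The area
radius is stationary, so r²K is stationary on every leaf and not only in the limit. -/
lemma isRoundJet (Z : IsProfileFoliation r₀ c₀ w δh δf) : IsRoundJet r₀ δh δf := by
  intro y hy
  refine hasAsymptoticJet_of (q₀ := fun _ => 1) (dq := fun _ => 0) (fun u hu => ?_)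
    (fun u hu => ?_) tendsto_const_nhds tendsto_const_nhds
  · have hr := (Z u hu).radius_pos.ne'
    have h := (Z.metric hu).gaussCurvature.value hy
    rw [(Z u hu).folRadius_zero, h]
    field_simp
  · have h := ((Z.hasDerivAt_folRadius hu).fun_pow 2).fun_mul
      ((Z.metric hu).gaussCurvature.hasDerivAt hy)
    refine h.congr_deriv ?_
    rw [roundLap_affine w _ _ hy]
    ring

lemma rho (Z : IsProfileFoliation r₀ c₀ w δh δf) {y : Chart} (hy : y ∈ chartDomain) :
    HasAsymptoticJet (fun u ε => folRadius r₀ (varH δh ε) (varF δf ε) u ^ 3 *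
      rhoComponent r₀ (leaf (varH δh ε) (varF δf ε) u) (folLp r₀ (varH δh ε) (varF δf ε) u)
        (folLb r₀ (varH δh ε) (varF δf ε) u) y) (-r₀) (3 * r₀ * (kappa * zeta w y)) := by
  have hr₀ := (Z 0 le_rfl).pos
  have J := fun u hu => (Z u hu).leafJet.rho
    (folLb_jet hr₀ hu (Z u hu).smooth_h (Z u hu).smooth_f)
    (folLp_jet hr₀ hu (Z u hu).smooth_h (Z u hu).smooth_f) hy
  refine hasAsymptoticJet_of (q₀ := fun _ => -r₀)
    (dq := fun u => 3 * r₀ * (amplitude r₀ u * zeta w y)) (fun u hu => ?_)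
    (fun u hu => ?_) tendsto_const_nhds
    (((tendsto_amplitude hr₀).mul_const _).const_mul _)
  · have hr := (Z u hu).radius_pos.ne'
    have h := (J u hu).1
    simp only [leaf] at h ⊢
    rw [(Z u hu).folRadius_zero, h]
    field_simp
  · have hr := (Z u hu).radius_pos.ne'
    have h := ((Z.hasDerivAt_folRadius hu).fun_pow 3).fun_mul (J u hu).2
    refine h.congr_deriv ?_
    rw [(Z u hu).folRadius_zero, Z.radiusPert_eq hu]
    field_simp
    ring

lemma shear_in (Z : IsProfileFoliation r₀ c₀ w δh δf) {y : Chart} (hy : y ∈ chartDomain)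
    {u : ℝ} (hu : 0 ≤ u) (i j : Fin 2) :
    shear r₀ (leaf (varH δh 0) (varF δf 0) u) (folLb r₀ (varH δh 0) (varF δf 0) u) y i j = 0 ∧
    HasDerivAt (fun ε => shear r₀ (leaf (varH δh ε) (varF δf ε) u)
      (folLb r₀ (varH δh ε) (varF δf ε) u) y i j) 0 0 := by
  have Zu := Z u hu
  have J := Zu.leafJet.shear (folLb_jet Zu.pos hu Zu.smooth_h Zu.smooth_f) i j
  refine ⟨J.value hy, (J.hasDerivAt hy).congr_deriv ?_⟩
  have e : slice δh u = _ := funext (Zu.eq_h u hu)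
  rw [e, roundLap_affine w _ _ hy, roundHess_affine w _ _ hy]
  ring

lemma shear_out (Z : IsProfileFoliation r₀ c₀ w δh δf) {y : Chart} (hy : y ∈ chartDomain)
    {u : ℝ} (hu : 0 ≤ u) (i j : Fin 2) :
    shear r₀ (leaf (varH δh 0) (varF δf 0) u) (folLp r₀ (varH δh 0) (varF δf 0) u) y i j = 0 ∧
    HasDerivAt (fun ε => shear r₀ (leaf (varH δh ε) (varF δf ε) u)
      (folLp r₀ (varH δh ε) (varF δf ε) u) y i j) 0 0 := by
  have Zu := Z u hu
  have J := Zu.leafJet.shear (folLp_jet Zu.pos hu Zu.smooth_h Zu.smooth_f) i j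
  refine ⟨J.value hy, (J.hasDerivAt hy).congr_deriv ?_⟩
  have e : slice δf u = _ := funext Zu.eq_f
  rw [e, roundLap_affine w _ _ hy, roundHess_affine w _ _ hy]
  ring

theorem isAsymptoticJet (Z : IsProfileFoliation r₀ c₀ w δh δf) :
    IsAsymptoticJet r₀ δh δf (limitData r₀) (limitPert r₀ w) where
  rho y hy := Z.rho hy
  shear_in y hy i j :=
    hasAsymptoticJet_of (q₀ := fun _ => 0) (dq := fun _ => 0)
      (fun u hu => (Z.shear_in hy hu i j).1) (fun u hu => (Z.shear_in hy hu i j).2)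
      tendsto_const_nhds tendsto_const_nhds
  shear_out y hy i j := by
    refine hasAsymptoticJet_of (q₀ := fun _ => 0) (dq := fun _ => 0)
      (fun u hu => ?_) (fun u hu => ?_) tendsto_const_nhds tendsto_const_nhds
    · rw [(Z.shear_out hy hu i j).1, mul_zero]
    · have hr := (Z u hu).radius_pos.ne'
      have h := ((Z.hasDerivAt_folRadius hu).fun_inv (by
        rw [(Z u hu).folRadius_zero]; exact hr)).fun_mul
        (Z.shear_out hy hu i j).2
      exact h.congr_deriv (by simp)
  metric y hy i j := by
    have hr₀ := (Z 0 le_rfl).pos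
    refine hasAsymptoticJet_of (q₀ := fun _ => roundMetric y i j)
      (dq := fun u => 2 * (amplitude r₀ u * zeta w y) * roundMetric y i j)
      (fun u hu => ?_) (fun u hu => ?_) tendsto_const_nhds
      ((((tendsto_amplitude hr₀).mul_const _).const_mul _).mul_const _)
    · have hr := (Z u hu).radius_pos.ne'
      have h := ((Z.metric hu).jet i j).value hy
      rw [(Z u hu).folRadius_zero, h]
      field_simp
    · have hr := (Z u hu).radius_pos.ne'
      have h := (((Z.hasDerivAt_folRadius hu).fun_pow 2).fun_inv (by
        rw [(Z u hu).folRadius_zero]; exact pow_ne_zero 2 hr)).fun_mul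
        (((Z.metric hu).jet i j).hasDerivAt hy)
      refine h.congr_deriv ?_
      rw [(Z u hu).folRadius_zero]
      field_simp
      ring

lemma hawkingMass (Z : IsProfileFoliation r₀ c₀ w δh δf) :
    HasAsymptoticJet (fun u ε => folHawkingMass r₀ (varH δh ε) (varF δf ε) u) (r₀ / 2) 0 :=
  hasAsymptoticJet_of (q₀ := fun _ => r₀ / 2) (dq := fun _ => 0)
    (fun u hu => (Z u hu).folHawkingMass_zero)
    (fun u hu => (Z u hu).hasDerivAt_folHawkingMass rfl rfl) tendsto_const_nhds tendsto_const_nhds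

end IsProfileFoliation

end Limits

/-! ### Energy, linear momentum and Bondi mass -/

lemma line_metric (r₀ : ℝ) (w : E3) (ε : ℝ) (y : Chart) (i j : Fin 2) :
    ((limitData r₀).line (limitPert r₀ w) ε).g y i j =
      (1 + ε * (2 * (kappa * zeta w y))) * roundMetric y i j := by
  simp only [AsymptoticData.line, limitData, limitPert, Matrix.add_apply, Matrix.smul_apply,
    smul_eq_mul]
  ring

lemma line_N (r₀ : ℝ) (w : E3) (ε : ℝ) :
    ((limitData r₀).line (limitPert r₀ w) ε).N = fun y => r₀ - ε * (3 * r₀ * (kappa * zeta w y)) := by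
  ext y
  simp [AsymptoticData.N, AsymptoticData.line, limitData, limitPert, tensorIp]
  ring

lemma conformalJet_line (r₀ : ℝ) (w : E3) :
    ConformalJet (fun ε => ((limitData r₀).line (limitPert r₀ w) ε).g) 1
      (fun y => kappa * zeta w y) where
  pos := one_pos
  smooth _ _ := (contDiff_const.mul (contDiff_zeta w)).contDiffAt
  jet i j := by
    simp only [line_metric]
    have h := ((HasJet.const 1).add (HasJet.eps_mul (g := fun y => 2 * (kappa * zeta w y)) fun _ _ =>
      (contDiff_const.mul (contDiff_const.mul (contDiff_zeta w))).contDiffAt)).mul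
      (HasJet.of_contDiff fun y _ => (contDiff_roundMetric i j).contDiffAt)
    refine h.congr ?_ ?_ <;> intro y _ <;> ring

/-- The line of metrics is exactly conformal to the round one, with a factor positive on the whole
sphere for small ε. The area density is then exactly this factor. -/
lemma eventually_surfaceIntegral_line (r₀ : ℝ) (w : E3) : ∀ᶠ ε in 𝓝 (0 : ℝ), ∀ F : Chart → ℝ,
    surfaceIntegral ((limitData r₀).line (limitPert r₀ w) ε).g F =
      sphereInt (fun y => F y * (1 + ε * (2 * (kappa * zeta w y)))) := by
  have h := ((Zonal.const (w := w) 1).add (Zonal.eps.mul ((Zonal.const 2).mul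
    ((Zonal.const kappa).mul Zonal.zeta)))).eventually_mem
      (isOpen_Ioi (a := (0 : ℝ))) (fun z => by simp)
  filter_upwards [h] with ε hε F
  rw [surfaceIntegral_eq]
  refine sphereInt_congr fun y hy => ?_
  have hs := sin_pos_of_mem hy
  have hp : 0 < 1 + ε * (2 * (kappa * zeta w y)) := hε y hy
  congr 1
  rw [Matrix.det_fin_two, line_metric, line_metric, line_metric, line_metric]
  simp only [roundMetric, Matrix.of_apply, Matrix.cons_val', Matrix.cons_val_zero,
    Matrix.cons_val_one, Matrix.cons_val_fin_one]
  rw [show ∀ x : ℝ, x * 1 * (x * sin (y 0) ^ 2) - x * 0 * (x * 0) = (x * sin (y 0)) ^ 2 from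
    fun x => by ring, Real.sqrt_sq (by positivity), mul_div_cancel_right₀ _ hs.ne']

/-- The linearisation of integrals with respect to the perturbed limit metric. -/
lemma hasDerivAt_surfaceIntegral_line (r₀ : ℝ) (w : E3) {Φ : ℝ × Chart → ℝ} (hΦ : ContDiff ℝ ∞ Φ)
    {Φ' : Chart → ℝ} (h' : ∀ y, HasDerivAt (fun ε => Φ (ε, y)) (Φ' y) 0) :
    HasDerivAt (fun ε => surfaceIntegral ((limitData r₀).line (limitPert r₀ w) ε).g
      fun y => Φ (ε, y)) (sphereInt fun y => Φ' y + Φ (0, y) * (2 * (kappa * zeta w y))) 0 := by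
  have hz := contDiff_zeta w
  have hw : ContDiff ℝ ∞ fun p : ℝ × Chart => 1 + p.1 * (2 * (kappa * zeta w p.2)) :=
    contDiff_const.add (contDiff_fst.mul (contDiff_const.mul (contDiff_const.mul
      (hz.comp contDiff_snd))))
  have h := hasDerivAt_sphereInt_of_contDiff (hΦ.mul hw) 0
  refine (h.congr_of_eventuallyEq ?_).congr_deriv ?_
  · filter_upwards [eventually_surfaceIntegral_line r₀ w] with ε hε
    exact hε _
  · congr 1; ext y
    have hd := (h' y).fun_mul (((hasDerivAt_id' (0 : ℝ)).mul_const
      (2 * (kappa * zeta w y))).const_add 1)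
    refine hd.deriv.trans ?_
    ring

lemma energy_zero (r₀ : ℝ) : (limitData r₀).energy = r₀ / 2 := by
  have e : ∀ w, (limitData r₀).line (limitPert r₀ w) 0 = limitData r₀ := fun w => by
    simp [AsymptoticData.line]
  have h := (eventually_surfaceIntegral_line r₀ 0).self_of_nhds
  have hN := line_N r₀ 0 0
  rw [e] at h hN
  rw [AsymptoticData.energy, h, hN]
  simp only [zero_mul, sub_zero, add_zero, mul_one]
  rw [sphereInt_const]
  have := pi_pos
  field_simp
  ring

lemma line_zero (A δA : AsymptoticData) : A.line δA 0 = A := by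
  simp [AsymptoticData.line]

/-- N contributes -3r₀κζ and the area form 2r₀κζ; their sum is a multiple of ζ and has zero mean. -/
lemma hasDerivAt_energy (r₀ : ℝ) (w : E3) :
    HasDerivAt (fun ε => ((limitData r₀).line (limitPert r₀ w) ε).energy) 0 0 := by
  have hz := contDiff_zeta w
  have h := hasDerivAt_surfaceIntegral_line r₀ w
    (Φ := fun p => r₀ - p.1 * (3 * r₀ * (kappa * zeta w p.2)))
    (contDiff_const.sub (contDiff_fst.mul (contDiff_const.mul (contDiff_const.mul
      (hz.comp contDiff_snd))))) (Φ' := fun y => -(3 * r₀ * (kappa * zeta w y)))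
    (fun y => (((hasDerivAt_id' (0 : ℝ)).mul_const (3 * r₀ * (kappa * zeta w y))).const_sub
      r₀).congr_deriv (by ring))
  simp only [AsymptoticData.energy, line_N]
  refine (h.const_mul (1 / (8 * π))).congr_deriv ?_
  have e : (fun y => -(3 * r₀ * (kappa * zeta w y)) +
      (r₀ - 0 * (3 * r₀ * (kappa * zeta w y))) * (2 * (kappa * zeta w y))) =
      fun y => (-(r₀ * kappa)) * zeta w y := by ext y; ring
  rw [e, sphereInt_const_mul, sphereInt_zeta, mul_zero, mul_zero]

section Momentum

variable {r₀ : ℝ} {w : E3} {b : OrthonormalBasis (Fin 3) ℝ E3} {δY : Fin 3 → S2 → ℝ}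

lemma sphHarmonic_sph (b : OrthonormalBasis (Fin 3) ℝ E3) (i : Fin 3) (y : Chart) :
    sphHarmonic b i (sph y) = zeta (b i) y := rfl

lemma hasJet_varY (hY : ∀ i, ContMDiff (𝓡 2) 𝓘(ℝ, ℝ) ∞ (δY i)) (i : Fin 3) :
    HasJet (fun ε y => varY b δY ε i (sph y)) (zeta (b i)) (fun y => δY i (sph y)) := by
  refine ((HasJet.of_contDiff fun y _ => (contDiff_zeta (b i)).contDiffAt).add
    (HasJet.eps_mul fun y _ => (contDiff_comp_sph (hY i)).contDiffAt)).congr ?_ ?_ <;>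
    intro y _ <;> simp

/-- The linearised eigenvalue equation. -/
lemma hasDerivAt_eigen (hY : ∀ i, ContMDiff (𝓡 2) 𝓘(ℝ, ℝ) ∞ (δY i)) (i : Fin 3) {y : Chart}
    (hy : y ∈ chartDomain) :
    HasDerivAt (fun ε => laplacian ((limitData r₀).line (limitPert r₀ w) ε).g
        (fun z => varY b δY ε i (sph z)) y + 2 * varY b δY ε i (sph y))
      (roundLap (fun z => δY i (sph z)) y + 2 * δY i (sph y) +
        4 * kappa * (zeta w y * zeta (b i) y)) 0 := by
  have h1 := ((conformalJet_line r₀ w).laplacian (hasJet_varY (b := b) hY i)).hasDerivAt hy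
  have h2 := ((hasJet_varY (b := b) hY i).hasDerivAt hy).const_mul 2
  refine (h1.fun_add h2).congr_deriv ?_
  rw [roundLap_zeta _ hy]
  ring

/-- The linearised orthogonality relations. -/
lemma hasDerivAt_orthogonal (hY : ∀ i, ContMDiff (𝓡 2) 𝓘(ℝ, ℝ) ∞ (δY i)) (i j : Fin 3) :
    HasDerivAt (fun ε => surfaceIntegral ((limitData r₀).line (limitPert r₀ w) ε).g
        (fun y => varY b δY ε i (sph y) * varY b δY ε j (sph y)))
      (sphereInt fun y => δY i (sph y) * zeta (b j) y + zeta (b i) y * δY j (sph y)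
        + zeta (b i) y * zeta (b j) y * (2 * (kappa * zeta w y))) 0 := by
  have hs : ∀ i, ContDiff ℝ ∞ fun p : ℝ × Chart => zeta (b i) p.2 + p.1 * δY i (sph p.2) :=
    fun i => ((contDiff_zeta (b i)).comp contDiff_snd).add
      (contDiff_fst.mul ((contDiff_comp_sph (hY i)).comp contDiff_snd))
  have hd : ∀ i y, HasDerivAt (fun ε : ℝ => zeta (b i) y + ε * δY i (sph y)) (δY i (sph y)) 0 :=
    fun i y => (((hasDerivAt_id' (0 : ℝ)).mul_const _).const_add _).congr_deriv (one_mul _)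
  have h := hasDerivAt_surfaceIntegral_line r₀ w ((hs i).mul (hs j))
    (Φ' := fun y => δY i (sph y) * zeta (b j) y + zeta (b i) y * δY j (sph y))
    (fun y => ((hd i y).fun_mul (hd j y)).congr_deriv (by ring))
  refine h.congr_deriv ?_
  congr 1; ext y; ring

/-- The linearised momentum in terms of the integral of `δY`. -/
lemma hasDerivAt_momentum (hY : ∀ i, ContMDiff (𝓡 2) 𝓘(ℝ, ℝ) ∞ (δY i)) (i : Fin 3) :
    HasDerivAt (fun ε => ((limitData r₀).line (limitPert r₀ w) ε).momentum (varY b δY ε) i)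
      (1 / (8 * π) * (r₀ * sphereInt (fun y => δY i (sph y))
        - r₀ * kappa * (4 * π / 3 * inner ℝ w (b i)))) 0 := by
  have hz := contDiff_zeta w
  have hc := (contDiff_comp_sph (hY i)).continuous
  have hs : ContDiff ℝ ∞ fun p : ℝ × Chart => zeta (b i) p.2 + p.1 * δY i (sph p.2) :=
    ((contDiff_zeta (b i)).comp contDiff_snd).add
      (contDiff_fst.mul ((contDiff_comp_sph (hY i)).comp contDiff_snd))
  have hn : ContDiff ℝ ∞ fun p : ℝ × Chart => r₀ - p.1 * (3 * r₀ * (kappa * zeta w p.2)) :=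
    contDiff_const.sub (contDiff_fst.mul (contDiff_const.mul (contDiff_const.mul
      (hz.comp contDiff_snd))))
  have h := hasDerivAt_surfaceIntegral_line r₀ w (hs.mul hn)
    (Φ' := fun y => δY i (sph y) * r₀ + zeta (b i) y * -(3 * r₀ * (kappa * zeta w y)))
    (fun y => ((((hasDerivAt_id' (0 : ℝ)).mul_const (δY i (sph y))).const_add
      (zeta (b i) y)).fun_mul (((hasDerivAt_id' (0 : ℝ)).mul_const
        (3 * r₀ * (kappa * zeta w y))).const_sub r₀)).congr_deriv (by ring))
  simp only [AsymptoticData.momentum, line_N]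
  refine (h.const_mul (1 / (8 * π))).congr_deriv ?_
  congr 1
  rw [← sphereInt_zeta_mul_zeta, sub_eq_add_neg, ← neg_mul, ← sphereInt_const_mul,
    ← sphereInt_const_mul, ← sphereInt_add (F := fun y => r₀ * δY i (sph y))
      (G := fun y => -(r₀ * kappa) * (zeta w y * zeta (b i) y)) (continuous_const.mul hc)
      (by fun_prop)]
  congr 1; ext y; ring

lemma momentum_zero (r₀ : ℝ) (i : Fin 3) :
    (limitData r₀).momentum (varY b δY 0) i = 0 := by
  have h := (eventually_surfaceIntegral_line r₀ 0).self_of_nhds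
  have hN := line_N r₀ 0 0
  rw [line_zero] at h hN
  rw [AsymptoticData.momentum, h, hN]
  simp only [zero_mul, sub_zero, add_zero, mul_one, varY, sphHarmonic_sph, mul_comm _ r₀]
  rw [sphereInt_const_mul]
  have : sphereInt (fun y => zeta (b i) y) = 0 := sphereInt_zeta (b i)
  rw [this, mul_zero, mul_zero]

/-- Integrating the linearised eigenvalue equation Δ δY + 2 δY = -4κ ζ_w Y determines the mean of
δY, so the answer does not depend on the choice of δY. Together with -3 from N and +2 from the area
form, its contribution -2 gives -3 · r₀κ/6 = -r₀κ/2 times ⟨w, b i⟩. -/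
lemma IsAdmissible.hasDerivAt_momentum
    (h : IsAdmissible b (limitData r₀) (limitPert r₀ w) δY) (i : Fin 3) :
    HasDerivAt (fun ε => ((limitData r₀).line (limitPert r₀ w) ε).momentum (varY b δY ε) i)
      (inner ℝ w (b i) * (exp (3 / 2) / 3 - 4 / 3) * r₀) 0 := by
  have hc := (contDiff_comp_sph (h.smooth i)).continuous
  have hlap : ∀ y ∈ chartDomain, roundLap (fun z => δY i (sph z)) y =
      -2 * δY i (sph y) + -4 * kappa * (zeta w y * zeta (b i) y) := fun y hy => by
    have := (h.eigen i y hy).unique (hasDerivAt_eigen h.smooth i hy)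
    linarith
  have h0 := sphereInt_laplacian (contDiff_comp_sph (h.smooth i)) (azimuthPeriodic_comp_sph _)
    (f := fun y => -2 * δY i (sph y) + -4 * kappa * (zeta w y * zeta (b i) y)) ((continuous_const.mul hc).add (by fun_prop)) hlap
  rw [sphereInt_add (F := fun y => -2 * δY i (sph y))
    (G := fun y => -4 * kappa * (zeta w y * zeta (b i) y)) (continuous_const.mul hc)
    (by fun_prop), sphereInt_const_mul, sphereInt_const_mul, sphereInt_zeta_mul_zeta] at h0
  refine (CMAFoliation.hasDerivAt_momentum h.smooth i).congr_deriv ?_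
  have e : sphereInt (fun y => δY i (sph y)) = -2 * kappa * (4 * π / 3 * inner ℝ w (b i)) := by
    linarith
  rw [e, kappa]
  have := pi_pos
  field_simp
  ring

/-- The background has zero momentum, so |P|² is of second order and only the stationary energy
remains under the root, which is positive there. -/
lemma IsAdmissible.hasDerivAt_bondiMass (hr₀ : 0 < r₀)
    (h : IsAdmissible b (limitData r₀) (limitPert r₀ w) δY) :
    HasDerivAt (fun ε => ((limitData r₀).line (limitPert r₀ w) ε).bondiMass (varY b δY ε))
      0 0 := by
  have hE := (hasDerivAt_energy r₀ w).fun_pow 2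
  have hP := HasDerivAt.fun_sum (u := Finset.univ) fun i _ => (h.hasDerivAt_momentum i).fun_pow 2
  have hd := hE.fun_sub hP
  have hv : ((limitData r₀).line (limitPert r₀ w) 0).energy ^ 2 -
      ∑ i, ((limitData r₀).line (limitPert r₀ w) 0).momentum (varY b δY 0) i ^ 2 = (r₀ / 2) ^ 2 := by
    simp only [line_zero, energy_zero, momentum_zero]
    simp
  refine (hd.sqrt (by rw [hv]; positivity)).congr_deriv ?_
  simp only [line_zero, momentum_zero]
  simp

lemma exists_isAdmissible (r₀ : ℝ) (w : E3) (b : OrthonormalBasis (Fin 3) ℝ E3) :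
    ∃ δY, IsAdmissible b (limitData r₀) (limitPert r₀ w) δY := by
  -- The metric perturbation 2κζ_w g is the Lie derivative of g along X = -κ∇ζ_w, and δY = X(Y)
  -- transports the eigenfunctions along. The formula is the gradient product ⟨w, b i⟩ - ζ_w Y times
  -- -κ.
  set δY : Fin 3 → S2 → ℝ := fun i ϑ =>
    kappa * (inner ℝ w (ϑ : E3) * inner ℝ (b i) (ϑ : E3) - inner ℝ w (b i)) with hδ
  have hY : ∀ i, ContMDiff (𝓡 2) 𝓘(ℝ, ℝ) ∞ (δY i) := fun i =>
    contMDiff_const.mul (((contMDiff_inner w).mul (contMDiff_inner (b i))).sub contMDiff_const)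
  have hs : ∀ i y, δY i (sph y) = kappa * (zeta w y * zeta (b i) y - inner ℝ w (b i)) :=
    fun i y => rfl
  refine ⟨δY, hY, fun i y hy => (hasDerivAt_eigen hY i hy).congr_deriv ?_,
    fun i j => (hasDerivAt_orthogonal hY i j).congr_deriv ?_⟩
  · have e : (fun z => δY i (sph z)) =
        fun z => -(kappa * inner ℝ w (b i)) + kappa * (zeta w z * zeta (b i) z) := by
      ext z; rw [hs]; ring
    have hzz : ContDiff ℝ ∞ fun z => zeta w z * zeta (b i) z :=
      (contDiff_zeta w).mul (contDiff_zeta (b i))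
    rw [e, roundLap_add (F := fun _ => -(kappa * inner ℝ w (b i)))
      (fun _ _ => contDiffAt_const) (fun _ _ => (contDiff_const.mul hzz).contDiffAt) hy,
      roundLap_const, roundLap_const_mul kappa (fun _ _ => hzz.contDiffAt) hy,
      roundLap_zeta_mul_zeta w (b i) hy, hs]
    ring
  · have e : (fun y => δY i (sph y) * zeta (b j) y + zeta (b i) y * δY j (sph y)
        + zeta (b i) y * zeta (b j) y * (2 * (kappa * zeta w y))) =
        fun y => 4 * kappa * (zeta w y * (zeta (b i) y * zeta (b j) y)) +
          (-(kappa * inner ℝ w (b i)) * zeta (b j) y + -(kappa * inner ℝ w (b j)) * zeta (b i) y) := by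
      ext y; rw [hs, hs]; ring
    rw [e, sphereInt_add (F := fun y => 4 * kappa * (zeta w y * (zeta (b i) y * zeta (b j) y)))
      (G := fun y => -(kappa * inner ℝ w (b i)) * zeta (b j) y +
        -(kappa * inner ℝ w (b j)) * zeta (b i) y) (by fun_prop) (by fun_prop),
      sphereInt_add (F := fun y => -(kappa * inner ℝ w (b i)) * zeta (b j) y)
      (G := fun y => -(kappa * inner ℝ w (b j)) * zeta (b i) y) (by fun_prop) (by fun_prop),
      sphereInt_const_mul, sphereInt_const_mul, sphereInt_const_mul,
      sphereInt_zeta_mul_zeta_mul_zeta, sphereInt_zeta, sphereInt_zeta]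
    ring

end Momentum

/-- Vanishing would mean e³ = 16, but e³ > 2.7³ > 19. This is what makes the momentum map surjective
with only the constants in its kernel. -/
lemma exp_three_halves_ne : exp (3 / 2) / 3 - 4 / 3 ≠ 0 := by
  intro h
  have h1 : exp (3 / 2) = 4 := by linarith
  have h2 : exp (3 / 2) * exp (3 / 2) = exp 1 ^ 3 := by
    rw [← exp_add, ← exp_nat_mul]; norm_num
  have h3 : (2.7 : ℝ) ^ 3 ≤ exp 1 ^ 3 := by
    gcongr
    exact le_of_lt (lt_trans (by norm_num) exp_one_gt_d9)
  rw [← h2, h1] at h3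
  norm_num at h3

/-! ### Assembly, and the momentum as a linear map on `spaceV`. -/

/-- The linearised energy-momentum of the perturbation `c₀ + r₀ ⟨w, ϑ⟩`. -/
theorem hasLinearisedEnergyMomentum {r₀ : ℝ} (hr₀ : 0 < r₀)
    (b : OrthonormalBasis (Fin 3) ℝ E3) (c₀ : ℝ) (w : E3) :
    HasLinearisedEnergyMomentum r₀ b (fun ϑ => c₀ + r₀ * inner ℝ w (ϑ : E3)) 0
      (fun i => inner ℝ w (b i) * (exp (3 / 2) / 3 - 4 / 3) * r₀) 0 where
  exists_foliation := ⟨_, _, isLinearisedFoliation_explicit hr₀ c₀ w⟩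
  unique_foliation δh δf δh' δf' L L' u hu := by
    refine ⟨(L.eq_h hr₀ hu).trans (L'.eq_h hr₀ hu).symm, ?_⟩
    refine eq_of_eq_on_chartDomain (L.smooth_f.continuous_slice u) (L'.smooth_f.continuous_slice u)
      fun y _ => ?_
    exact ((zonalFoliation_of_isLinearisedFoliation hr₀ L hu).eq_f y).trans
      ((zonalFoliation_of_isLinearisedFoliation hr₀ L' hu).eq_f y).symm
  round δh δf L := IsProfileFoliation.isRoundJet (c₀ := c₀) (w := w) fun u hu =>
    zonalFoliation_of_isLinearisedFoliation hr₀ L hu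
  values δh δf L := by
    have Z : IsProfileFoliation r₀ c₀ w δh δf := fun u hu =>
      zonalFoliation_of_isLinearisedFoliation hr₀ L hu
    refine ⟨limitData r₀, limitPert r₀ w, Z.isAsymptoticJet, ?_, hasDerivAt_energy r₀ w,
      exists_isAdmissible r₀ w b, fun δY hY =>
        ⟨fun i => hY.hasDerivAt_momentum i, hY.hasDerivAt_bondiMass hr₀⟩⟩
    rw [energy_zero]
    exact Z.hawkingMass

/-- The perturbation with coefficients `c₀`, `c i`. -/
theorem hasLinearisedEnergyMomentum_coeff {r₀ : ℝ} (hr₀ : 0 < r₀)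
    (b : OrthonormalBasis (Fin 3) ℝ E3) (c₀ : ℝ) (c : Fin 3 → ℝ) :
    HasLinearisedEnergyMomentum r₀ b (fun ϑ => c₀ + r₀ * ∑ i, c i * sphHarmonic b i ϑ)
      0 (fun i => c i * (exp (3 / 2) / 3 - 4 / 3) * r₀) 0 := by
  have h := hasLinearisedEnergyMomentum hr₀ b c₀ (∑ i, c i • b i)
  have e1 : ∀ ϑ : S2, inner ℝ (∑ i, c i • b i) (ϑ : E3) = ∑ i, c i * sphHarmonic b i ϑ := fun ϑ => by
    simp only [sum_inner, real_inner_smul_left, sphHarmonic]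
  have e2 : ∀ j, inner ℝ (∑ i, c i • b i) (b j) = c j := fun j => by
    simp [sum_inner, real_inner_smul_left, b.inner_eq_ite]
  simpa only [e1, e2] using h

/-- The point `± b i` of the sphere. -/
def basisPoint (b : OrthonormalBasis (Fin 3) ℝ E3) (i : Fin 3) (σ : ℝ) (hσ : |σ| = 1) : S2 :=
  ⟨σ • b i, by simp [norm_smul, hσ]⟩

lemma sphHarmonic_basisPoint (b : OrthonormalBasis (Fin 3) ℝ E3) (i j : Fin 3) {σ : ℝ}
    (hσ : |σ| = 1) : sphHarmonic b j (basisPoint b i σ hσ) = if j = i then σ else 0 := by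
  simp [sphHarmonic, basisPoint, real_inner_smul_right, b.inner_eq_ite]

/-- The linearised linear momentum as a linear map. -/
def momentumMap (b : OrthonormalBasis (Fin 3) ℝ E3) : spaceV b →ₗ[ℝ] (Fin 3 → ℝ) where
  -- Half the difference of the values at ± b i is the coefficient of the i-th harmonic, and it
  -- annihilates constants. Reading off coefficients by evaluation makes well-definedness and
  -- linearity immediate. No factor r₀ appears since this coefficient is r₀ c_i.
  toFun v i := (v.1 (basisPoint b i 1 (by simp)) - v.1 (basisPoint b i (-1) (by simp))) / 2 *
    (exp (3 / 2) / 3 - 4 / 3)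
  map_add' v v' := by ext i; simp; ring
  map_smul' c v := by ext i; simp; ring

lemma mem_spaceV_iff (b : OrthonormalBasis (Fin 3) ℝ E3) (v : S2 → ℝ) : v ∈ spaceV b ↔
    ∃ (c₀ : ℝ) (c : Fin 3 → ℝ), v = fun ϑ => c₀ + ∑ i, c i * sphHarmonic b i ϑ := by
  rw [spaceV, Submodule.mem_span_insert]
  constructor
  · rintro ⟨a, z, hz, rfl⟩
    obtain ⟨c, rfl⟩ := (Submodule.mem_span_range_iff_exists_fun ℝ).1 hz
    exact ⟨a, c, by ext ϑ; simp⟩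
  · rintro ⟨a, c, rfl⟩
    exact ⟨a, ∑ i, c i • sphHarmonic b i,
      (Submodule.mem_span_range_iff_exists_fun ℝ).2 ⟨c, rfl⟩, by ext ϑ; simp⟩

lemma momentumMap_apply (b : OrthonormalBasis (Fin 3) ℝ E3) {v : spaceV b} {c₀ : ℝ}
    {c : Fin 3 → ℝ} (h : (v : S2 → ℝ) = fun ϑ => c₀ + ∑ i, c i * sphHarmonic b i ϑ) :
    momentumMap b v = fun i => c i * (exp (3 / 2) / 3 - 4 / 3) := by
  ext i
  simp only [momentumMap, LinearMap.coe_mk, AddHom.coe_mk, h, sphHarmonic_basisPoint]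
  simp

end CMAFoliation

end

theorem theorem12p1 (r₀ : ℝ) (hr₀ : 0 < r₀) (b : OrthonormalBasis (Fin 3) ℝ E3) :
    (∀ (c₀ : ℝ) (c : Fin 3 → ℝ),
      HasLinearisedEnergyMomentum r₀ b (fun ϑ => c₀ + r₀ * ∑ i, c i * sphHarmonic b i ϑ)
        0 (fun i => c i * (Real.exp (3 / 2) / 3 - 4 / 3) * r₀) 0) ∧
    ∃ Φ : spaceV b →ₗ[ℝ] (Fin 3 → ℝ),
      (∀ v : spaceV b, HasLinearisedEnergyMomentum r₀ b v 0 (Φ v) 0) ∧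
      Function.Surjective Φ ∧
      ∀ v : spaceV b, Φ v = 0 ↔ ∃ c₀ : ℝ, (v : S2 → ℝ) = fun _ => c₀ := by
  refine ⟨fun c₀ c => hasLinearisedEnergyMomentum_coeff hr₀ b c₀ c, momentumMap b, fun v => ?_,
    fun x => ?_, fun v => ?_⟩
  · obtain ⟨c₀, c, h⟩ := (mem_spaceV_iff b v).1 v.2
    -- The elements of `spaceV` carry no factor r₀, hence the rescaled coefficients.
    have h1 := hasLinearisedEnergyMomentum_coeff hr₀ b c₀ fun i => c i / r₀
    have e : (fun ϑ => c₀ + r₀ * ∑ i, c i / r₀ * sphHarmonic b i ϑ) = (v : S2 → ℝ) := by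
      rw [h]; ext ϑ
      rw [Finset.mul_sum]
      congr 1
      refine Finset.sum_congr rfl fun i _ => ?_
      field_simp
    rw [e] at h1
    rw [momentumMap_apply b h]
    convert h1 using 2 with i
    field_simp
  · have hk := exp_three_halves_ne
    refine ⟨⟨fun ϑ => 0 + ∑ i, x i / (Real.exp (3 / 2) / 3 - 4 / 3) * sphHarmonic b i ϑ,
      (mem_spaceV_iff b _).2 ⟨0, _, rfl⟩⟩, ?_⟩
    rw [momentumMap_apply b rfl]
    ext i
    exact div_mul_cancel₀ _ hk
  · constructor
    · intro h0
      obtain ⟨c₀, c, h⟩ := (mem_spaceV_iff b v).1 v.2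
      rw [momentumMap_apply b h] at h0
      have hc : ∀ i, c i = 0 := fun i =>
        (mul_eq_zero.1 (congrFun h0 i)).resolve_right exp_three_halves_ne
      exact ⟨c₀, by rw [h]; ext ϑ; simp [hc]⟩
    · rintro ⟨c₀, h⟩
      rw [momentumMap_apply b (c₀ := c₀) (c := 0) (by rw [h]; ext ϑ; simp)]
      ext i
      simp
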